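/- Let $\Bbbk$ be a commutative ring. A \emph{2-supercategory} is a (not necessarily strict) 2-category whose 2-morphism sets are $\Bbbk$-superspaces (modules with a decomposition into even and odd parts), with bilinear parity-preserving compositions, the super interchange law $(vu)\circ(yx)=(-1)^{|u||y|}(v\circ y)(u\circ x)$, and even coherence isomorphisms. Vertical composition of 2-morphisms is written $\circ$, horizontal composition is juxtaposition, and coherence isomorphisms of 2-categories are suppressed below. A \emph{$\Pi$-2-supercategory} $(\mathfrak A,\pi,\zeta)$ is a 2-supercategory with 1-morphisms $\pi_\lambda:\lambda\to\lambda$ and odd 2-isomorphisms $\zeta_\lambda:\pi_\lambda\Rightarrow 1_\lambda$ for all objects $\lambda$. A \emph{$\Pi$-2-category} $(\mathfrak A,\pi,\beta,\xi)$ is a $\Bbbk$-linear 2-category with 1-morphisms $\pi_\lambda:\lambda\to\lambda$, 2-isomorphisms $\beta_F:\pi_\mu F\Rightarrow F\pi_\lambda$ natural in $F:\lambda\to\mu$, and 2-isomorphisms $\xi_\lambda:\pi_\lambda^2\Rightarrow 1_\lambda$, such that $(\pi,\beta)$ is an object of the Drinfeld center, $\beta_{\pi_\lambda}=-1$, and $\xi_\mu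 F\xi_\lambda^{-1}=\beta_F\pi_\lambda\circ\pi_\mu\beta_F$. A \emph{$\Pi$-2-functor} is a $\Bbbk$-linear 2-functor $\mathbb R$ with (invertible) coherence maps $c:(\mathbb RG)(\mathbb RF)\Rightarrow\mathbb R(GF)$ and $i:1_{\mathbb R\lambda}\Rightarrow\mathbb R1_\lambda$, together with 2-isomorphisms $j:\pi_{\mathbb R\lambda}\Rightarrow\mathbb R\pi_\lambda$ satisfying $\mathbb R\beta_F\circ c\circ j(\mathbb RF)=c\circ(\mathbb RF)j\circ\beta_{\mathbb RF}$ and $\mathbb R\xi_\lambda\circ c\circ jj=i\circ\xi_{\mathbb R\lambda}$. A \emph{2-natural transformation} $(X,x):\mathbb R\Rightarrow\mathbb S$ has 1-morphisms $X_\lambda:\mathbb R\lambda\to\mathbb S\lambda$ and (even) 2-morphisms $x_F:X_\mu(\mathbb RF)\Rightarrow(\mathbb SF)X_\lambda$, not required to be invertible, natural in $F$ with respect to all 2-morphisms and compatible with the coherence maps $c$ and $i$; it is a \emph{$\Pi$-2-natural transformation} between $\Pi$-2-functors if moreover $x_{\pi_\lambda}\circ X_\lambda j\circ\beta_{X_\lambda}=jX_\lambda$.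 Let $\Pi\text{-2-}\mathfrak{SCat}$ consist of $\Pi$-2-supercategories, all 2-superfunctors and all 2-natural transformations, and $\Pi\text{-2-}\mathfrak{Cat}$ of $\Pi$-2-categories, $\Pi$-2-functors and $\Pi$-2-natural transformations. In both, objects and 1-morphisms form a category, and there are identity 2-morphisms, vertical composition, and whiskering of 2-morphisms with 1-morphisms on both sides. (As the $x_F$ need not be invertible and the 2-categories need not be strict, the remaining laws of a strict 2-category hold only up to modifications; they are not used here.) By a strict 2-functor between these we mean an assignment on objects, 1-morphisms and 2-morphisms that strictly preserves all of these operations; a strict 2-natural isomorphism between strict 2-functors is a family of isomorphisms in the target category, indexed by objects, that is strictly natural with respect to 1-morphisms and 2-morphisms. \textbf{Theorem.} The following assignments $\mathbb E_2$ and $\mathbb D_2$ are well defined. \emph{$\mathbb E_2:\Pi\text{-2-}\mathfrak{SCat}\to\Pi\text{-2-}\mathfrak{Cat}$} sends $(\mathfrak A,\pi,\zeta)$ to the 2-category $\underline{\mathfrak A}$ with the same objects and 1-morphisms and the even 2-morphisms, with $\beta_F=-\zeta_\mu F\zeta_\lambda^{-1}$ and $\xi_\lambda=\zeta_\lambda\zeta_\lambda$.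 It sends a 2-superfunctor $\mathbb R$ to its restriction $\underline{\mathbb R}$, with $j$ determined by $\mathbb R\zeta_\lambda\circ j=i\circ\zeta_{\mathbb R\lambda}$, and $(X,x)$ to the same data. \emph{$\mathbb D_2:\Pi\text{-2-}\mathfrak{Cat}\to\Pi\text{-2-}\mathfrak{SCat}$} sends $(\mathfrak A,\pi,\beta,\xi)$ to the 2-supercategory $\widehat{\mathfrak A}$ with the same objects and 1-morphisms, with even 2-morphisms $\mathrm{Hom}_{\mathfrak A}(F,G)$ and odd 2-morphisms $\mathrm{Hom}_{\mathfrak A}(F,\pi_\mu G)$ for $F,G:\lambda\to\mu$. The vertical composite of $x:F\Rightarrow G$ and $y:G\Rightarrow H$ is $y\circ x$ if $x$ is even, $\pi_\mu y\circ x$ if $x$ is odd and $y$ is even, and $-\xi_\mu H\circ\pi_\mu y\circ x$ if both are odd. The horizontal composite of $x:F\Rightarrow H$ (from $\lambda$ to $\mu$) and $y:G\Rightarrow K$ (from $\mu$ to $\nu$) is $yx$ if $x$ is even, $\beta_K^{-1}H\circ yx$ if $x$ is odd and $y$ is even, and $\xi_\nu KH\circ\pi_\nu\beta_K^{-1}H\circ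 yx$ if both are odd. The coherence isomorphisms and $\pi$ are those of $\mathfrak A$, and $\zeta_\lambda$ is $1_{\pi_\lambda}$ viewed as an odd 2-morphism. It sends a $\Pi$-2-functor $\mathbb R$ to the 2-superfunctor $\widehat{\mathbb R}$ with the same effect on objects, 1-morphisms and even 2-morphisms and the same $c$ and $i$, which sends an odd $x:F\Rightarrow\pi_\mu G$ to $j^{-1}(\mathbb RG)\circ c^{-1}\circ\mathbb Rx$; and it sends $(X,x)$ to the same data. Moreover, $\mathbb E_2$ and $\mathbb D_2$ are strict 2-functors, and they are mutually inverse 2-equivalences: \begin{itemize} \item there is a strict 2-natural isomorphism $\mathbb E_2\circ\mathbb D_2\cong I_{\Pi\text{-2-}\mathfrak{Cat}}$, whose component at $\mathfrak A$ is the identification $\underline{(\widehat{\mathfrak A})}=\mathfrak A$, i.e. is the identity on objects, 1-morphisms and 2-morphisms and has identity coherence maps $c,i,j$; \item there is a strict 2-natural isomorphism $\mathbb T:\mathbb D_2\circ\mathbb E_2\cong I_{\Pi\text{-2-}\mathfrak{SCat}}$, whose component $\mathbb T_{\mathfrak A}:\widehat{(\underline{\mathfrak A})}\to\mathfrak A$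 is the 2-superfunctor that is the identity on objects and 1-morphisms, has identity coherence maps, and sends an even 2-morphism $x$ to itself and the odd 2-morphism given by $x:F\Rightarrow\pi_\mu G$ to $\zeta_\mu G\circ x$. \end{itemize} In particular, each $\Pi$-2-supercategory is isomorphic to the $\Pi$-2-supercategory associated to its underlying $\Pi$-2-category. -/

import Mathlib

open CategoryTheory Bicategory

set_option linter.checkUnivs false
set_option linter.unusedVariables false

universe w v u t

namespace PiTwo

/-- A pair of arrows in opposite directions; `IsInverse` says that they are mutually inverse. -/
@[ext]
structure InvPair {C : Type u} [CategoryStruct.{v} C] (X Y : C) where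
  hom : X ⟶ Y
  inv : Y ⟶ X

structure InvPair.IsInverse {C : Type u} [CategoryStruct.{v} C] {X Y : C} (e : InvPair X Y) :
    Prop where
  hom_inv : e.hom ≫ e.inv = 𝟙 X
  inv_hom : e.inv ≫ e.hom = 𝟙 Y

/-- Laws of a supercategory: morphism spaces are superspaces (`k`-modules with a decomposition
`deg 0 ⊕ deg 1`), and composition is bilinear, even, associative and unital. -/
structure IsSupercategory (k : Type t) [CommRing k] (C : Type u) [CategoryStruct.{v} C]
    [∀ X Y : C, AddCommGroup (X ⟶ Y)] [∀ X Y : C, Module k (X ⟶ Y)]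
    (deg : ∀ X Y : C, ZMod 2 → Submodule k (X ⟶ Y)) : Prop where
  id_comp : ∀ {X Y : C} (f : X ⟶ Y), 𝟙 X ≫ f = f
  comp_id : ∀ {X Y : C} (f : X ⟶ Y), f ≫ 𝟙 Y = f
  assoc : ∀ {X Y Z W : C} (f : X ⟶ Y) (g : Y ⟶ Z) (h : Z ⟶ W), (f ≫ g) ≫ h = f ≫ g ≫ h
  add_comp : ∀ {X Y Z : C} (f f' : X ⟶ Y) (g : Y ⟶ Z), (f + f') ≫ g = f ≫ g + f' ≫ g
  comp_add : ∀ {X Y Z : C} (f : X ⟶ Y) (g g' : Y ⟶ Z), f ≫ (g + g') = f ≫ g + f ≫ g'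
  smul_comp : ∀ {X Y Z : C} (r : k) (f : X ⟶ Y) (g : Y ⟶ Z), (r • f) ≫ g = r • (f ≫ g)
  comp_smul : ∀ {X Y Z : C} (r : k) (f : X ⟶ Y) (g : Y ⟶ Z), f ≫ (r • g) = r • (f ≫ g)
  isCompl : ∀ X Y : C, IsCompl (deg X Y 0) (deg X Y 1)
  id_mem : ∀ X : C, 𝟙 X ∈ deg X X 0
  comp_mem : ∀ {X Y Z : C} {p q : ZMod 2} {f : X ⟶ Y} {g : Y ⟶ Z},
    f ∈ deg X Y p → g ∈ deg Y Z q → f ≫ g ∈ deg X Z (p + q)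

/-- The data of a 2-supercategory. Composites are written in diagrammatic order: for
`f : a ⟶ b` and `g : b ⟶ c`, the 1-morphism `f ≫ g` is the horizontal composite usually
written `g f`, and for 2-morphisms `x : f ⟶ f'` and `y : g ⟶ g'` the 2-morphism
`hcomp x y : f ≫ g ⟶ f' ≫ g'` is the horizontal composite usually written `y x`. -/
structure TwoSupercatData (k : Type t) [CommRing k] where
  Obj : Type u
  [catStruct : CategoryStruct.{v} Obj]
  [homStruct : ∀ a b : Obj, CategoryStruct.{w} (a ⟶ b)]
  [homAdd : ∀ {a b : Obj} (f g : a ⟶ b), AddCommGroup (f ⟶ g)]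
  [homMod : ∀ {a b : Obj} (f g : a ⟶ b), Module k (f ⟶ g)]
  deg : ∀ {a b : Obj} (f g : a ⟶ b), ZMod 2 → Submodule k (f ⟶ g)
  hcomp : ∀ {a b c : Obj} {f f' : a ⟶ b} {g g' : b ⟶ c},
    (f ⟶ f') → (g ⟶ g') → (f ≫ g ⟶ f' ≫ g')
  assoc : ∀ {a b c d : Obj} (f : a ⟶ b) (g : b ⟶ c) (h : c ⟶ d),
    InvPair ((f ≫ g) ≫ h) (f ≫ g ≫ h)
  lunit : ∀ {a b : Obj} (f : a ⟶ b), InvPair (𝟙 a ≫ f) f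
  runit : ∀ {a b : Obj} (f : a ⟶ b), InvPair (f ≫ 𝟙 b) f

attribute [instance] TwoSupercatData.catStruct TwoSupercatData.homStruct
  TwoSupercatData.homAdd TwoSupercatData.homMod

/-- Laws of a 2-supercategory: horizontal composition is a superfunctor
`Hom(b, c) ⊠ Hom(a, b) → Hom(a, c)`, i.e. an even bilinear operation on 2-morphisms which
preserves identities and satisfies the super interchange law; the coherence maps are even
supernatural isomorphisms that satisfy the pentagon and triangle axioms. -/
structure IsTwoSupercat {k : Type t} [CommRing k] (A : TwoSupercatData.{w, v, u} k) : Prop where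
  hom : ∀ a b : A.Obj, IsSupercategory k (a ⟶ b) (fun f g => A.deg f g)
  add_hcomp : ∀ {a b c : A.Obj} {f f' : a ⟶ b} {g g' : b ⟶ c} (x x' : f ⟶ f') (y : g ⟶ g'),
    A.hcomp (x + x') y = A.hcomp x y + A.hcomp x' y
  hcomp_add : ∀ {a b c : A.Obj} {f f' : a ⟶ b} {g g' : b ⟶ c} (x : f ⟶ f') (y y' : g ⟶ g'),
    A.hcomp x (y + y') = A.hcomp x y + A.hcomp x y'
  smul_hcomp : ∀ {a b c : A.Obj} {f f' : a ⟶ b} {g g' : b ⟶ c} (r : k) (x : f ⟶ f')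
    (y : g ⟶ g'), A.hcomp (r • x) y = r • A.hcomp x y
  hcomp_smul : ∀ {a b c : A.Obj} {f f' : a ⟶ b} {g g' : b ⟶ c} (r : k) (x : f ⟶ f')
    (y : g ⟶ g'), A.hcomp x (r • y) = r • A.hcomp x y
  hcomp_mem : ∀ {a b c : A.Obj} {f f' : a ⟶ b} {g g' : b ⟶ c} {p q : ZMod 2}
    {x : f ⟶ f'} {y : g ⟶ g'}, x ∈ A.deg f f' p → y ∈ A.deg g g' q →
    A.hcomp x y ∈ A.deg (f ≫ g) (f' ≫ g') (p + q)
  hcomp_id : ∀ {a b c : A.Obj} (f : a ⟶ b) (g : b ⟶ c),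
    A.hcomp (𝟙 f) (𝟙 g) = 𝟙 (f ≫ g)
  /-- `(v u) ∘ (y x) = (-1)^{|u||y|} (v ∘ y) (u ∘ x)` -/
  interchange : ∀ {a b c : A.Obj} {f f' f'' : a ⟶ b} {g g' g'' : b ⟶ c} {p q : ZMod 2}
    (x : f ⟶ f') {u : f' ⟶ f''} {y : g ⟶ g'} (v : g' ⟶ g''),
    u ∈ A.deg f' f'' p → y ∈ A.deg g g' q →
    A.hcomp x y ≫ A.hcomp u v = (-1 : k) ^ (p.val * q.val) • A.hcomp (x ≫ u) (y ≫ v)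
  assoc_inverse : ∀ {a b c d : A.Obj} (f : a ⟶ b) (g : b ⟶ c) (h : c ⟶ d),
    (A.assoc f g h).IsInverse
  assoc_mem : ∀ {a b c d : A.Obj} (f : a ⟶ b) (g : b ⟶ c) (h : c ⟶ d),
    (A.assoc f g h).hom ∈ A.deg _ _ 0
  assoc_naturality : ∀ {a b c d : A.Obj} {f f' : a ⟶ b} {g g' : b ⟶ c} {h h' : c ⟶ d}
    (x : f ⟶ f') (y : g ⟶ g') (z : h ⟶ h'),
    A.hcomp (A.hcomp x y) z ≫ (A.assoc f' g' h').hom =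
      (A.assoc f g h).hom ≫ A.hcomp x (A.hcomp y z)
  lunit_inverse : ∀ {a b : A.Obj} (f : a ⟶ b), (A.lunit f).IsInverse
  lunit_mem : ∀ {a b : A.Obj} (f : a ⟶ b), (A.lunit f).hom ∈ A.deg _ _ 0
  lunit_naturality : ∀ {a b : A.Obj} {f f' : a ⟶ b} (x : f ⟶ f'),
    A.hcomp (𝟙 (𝟙 a)) x ≫ (A.lunit f').hom = (A.lunit f).hom ≫ x
  runit_inverse : ∀ {a b : A.Obj} (f : a ⟶ b), (A.runit f).IsInverse
  runit_mem : ∀ {a b : A.Obj} (f : a ⟶ b), (A.runit f).hom ∈ A.deg _ _ 0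
  runit_naturality : ∀ {a b : A.Obj} {f f' : a ⟶ b} (x : f ⟶ f'),
    A.hcomp x (𝟙 (𝟙 b)) ≫ (A.runit f').hom = (A.runit f).hom ≫ x
  pentagon : ∀ {a b c d e : A.Obj} (f : a ⟶ b) (g : b ⟶ c) (h : c ⟶ d) (i : d ⟶ e),
    A.hcomp (A.assoc f g h).hom (𝟙 i) ≫ (A.assoc f (g ≫ h) i).hom ≫
      A.hcomp (𝟙 f) (A.assoc g h i).hom =
    (A.assoc (f ≫ g) h i).hom ≫ (A.assoc f g (h ≫ i)).hom
  triangle : ∀ {a b c : A.Obj} (f : a ⟶ b) (g : b ⟶ c),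
    (A.assoc f (𝟙 b) g).hom ≫ A.hcomp (𝟙 f) (A.lunit g).hom = A.hcomp (A.runit f).hom (𝟙 g)

/-- A 2-supercategory over `k`. -/
structure TwoSupercat (k : Type t) [CommRing k] extends TwoSupercatData.{w, v, u} k where
  isTwoSupercat : IsTwoSupercat toTwoSupercatData

/-- The data of a 2-superfunctor, with its coherence maps `c` and `i`. -/
structure TwoSuperfunctorData {k : Type t} [CommRing k] (A B : TwoSupercatData.{w, v, u} k) where
  obj : A.Obj → B.Obj
  map : ∀ {a b : A.Obj}, (a ⟶ b) → (obj a ⟶ obj b)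
  map₂ : ∀ {a b : A.Obj} {f g : a ⟶ b}, (f ⟶ g) → (map f ⟶ map g)
  c : ∀ {a b c : A.Obj} (f : a ⟶ b) (g : b ⟶ c), InvPair (map f ≫ map g) (map (f ≫ g))
  i : ∀ a : A.Obj, InvPair (𝟙 (obj a)) (map (𝟙 a))

/-- Laws of a 2-superfunctor. -/
structure IsTwoSuperfunctor {k : Type t} [CommRing k] {A B : TwoSupercatData.{w, v, u} k}
    (R : TwoSuperfunctorData A B) : Prop where
  map₂_id : ∀ {a b : A.Obj} (f : a ⟶ b), R.map₂ (𝟙 f) = 𝟙 (R.map f)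
  map₂_comp : ∀ {a b : A.Obj} {f g h : a ⟶ b} (x : f ⟶ g) (y : g ⟶ h),
    R.map₂ (x ≫ y) = R.map₂ x ≫ R.map₂ y
  map₂_add : ∀ {a b : A.Obj} {f g : a ⟶ b} (x y : f ⟶ g),
    R.map₂ (x + y) = R.map₂ x + R.map₂ y
  map₂_smul : ∀ {a b : A.Obj} {f g : a ⟶ b} (r : k) (x : f ⟶ g),
    R.map₂ (r • x) = r • R.map₂ x
  map₂_mem : ∀ {a b : A.Obj} {f g : a ⟶ b} {p : ZMod 2} {x : f ⟶ g},
    x ∈ A.deg f g p → R.map₂ x ∈ B.deg (R.map f) (R.map g) p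
  c_inverse : ∀ {a b c : A.Obj} (f : a ⟶ b) (g : b ⟶ c), (R.c f g).IsInverse
  c_mem : ∀ {a b c : A.Obj} (f : a ⟶ b) (g : b ⟶ c), (R.c f g).hom ∈ B.deg _ _ 0
  c_naturality : ∀ {a b c : A.Obj} {f f' : a ⟶ b} {g g' : b ⟶ c} (x : f ⟶ f') (y : g ⟶ g'),
    B.hcomp (R.map₂ x) (R.map₂ y) ≫ (R.c f' g').hom = (R.c f g).hom ≫ R.map₂ (A.hcomp x y)
  i_inverse : ∀ a : A.Obj, (R.i a).IsInverse
  i_mem : ∀ a : A.Obj, (R.i a).hom ∈ B.deg _ _ 0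
  map₂_assoc : ∀ {a b c d : A.Obj} (f : a ⟶ b) (g : b ⟶ c) (h : c ⟶ d),
    B.hcomp (R.c f g).hom (𝟙 (R.map h)) ≫ (R.c (f ≫ g) h).hom ≫ R.map₂ (A.assoc f g h).hom =
      (B.assoc (R.map f) (R.map g) (R.map h)).hom ≫
        B.hcomp (𝟙 (R.map f)) (R.c g h).hom ≫ (R.c f (g ≫ h)).hom
  map₂_lunit : ∀ {a b : A.Obj} (f : a ⟶ b),
    B.hcomp (R.i a).hom (𝟙 (R.map f)) ≫ (R.c (𝟙 a) f).hom ≫ R.map₂ (A.lunit f).hom =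
      (B.lunit (R.map f)).hom
  map₂_runit : ∀ {a b : A.Obj} (f : a ⟶ b),
    B.hcomp (𝟙 (R.map f)) (R.i b).hom ≫ (R.c f (𝟙 b)).hom ≫ R.map₂ (A.runit f).hom =
      (B.runit (R.map f)).hom

/-- A 2-superfunctor. -/
structure TwoSuperfunctor {k : Type t} [CommRing k] (A B : TwoSupercatData.{w, v, u} k)
    extends TwoSuperfunctorData A B where
  isTwoSuperfunctor : IsTwoSuperfunctor toTwoSuperfunctorData

/-- The data `(X, x)` of a 2-natural transformation; `naturality f` is the component `x_f`, from
the composite usually written `X_b (R f)` to the composite usually written `(S f) X_a`. -/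
structure TwoNatData {k : Type t} [CommRing k] {A B : TwoSupercatData.{w, v, u} k}
    (R S : TwoSuperfunctorData A B) where
  app : ∀ a : A.Obj, R.obj a ⟶ S.obj a
  naturality : ∀ {a b : A.Obj} (f : a ⟶ b), R.map f ≫ app b ⟶ app a ≫ S.map f

/-- Laws of a 2-natural transformation between 2-superfunctors: the `x_f` form even supernatural
transformations, compatible with horizontal composition and with units. -/
structure IsTwoNat {k : Type t} [CommRing k] {A B : TwoSupercatData.{w, v, u} k}
    {R S : TwoSuperfunctorData A B} (X : TwoNatData R S) : Prop where
  mem : ∀ {a b : A.Obj} (f : a ⟶ b), X.naturality f ∈ B.deg _ _ 0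
  naturality₂ : ∀ {a b : A.Obj} {f g : a ⟶ b} (y : f ⟶ g),
    B.hcomp (R.map₂ y) (𝟙 (X.app b)) ≫ X.naturality g =
      X.naturality f ≫ B.hcomp (𝟙 (X.app a)) (S.map₂ y)
  naturality_comp : ∀ {a b c : A.Obj} (f : a ⟶ b) (g : b ⟶ c),
    B.hcomp (R.c f g).hom (𝟙 (X.app c)) ≫ X.naturality (f ≫ g) =
      (B.assoc (R.map f) (R.map g) (X.app c)).hom ≫
        B.hcomp (𝟙 (R.map f)) (X.naturality g) ≫
          (B.assoc (R.map f) (X.app b) (S.map g)).inv ≫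
            B.hcomp (X.naturality f) (𝟙 (S.map g)) ≫
              (B.assoc (X.app a) (S.map f) (S.map g)).hom ≫
                B.hcomp (𝟙 (X.app a)) (S.c f g).hom
  naturality_id : ∀ a : A.Obj,
    (B.runit (X.app a)).hom ≫ (B.lunit (X.app a)).inv ≫
        B.hcomp (R.i a).hom (𝟙 (X.app a)) ≫ X.naturality (𝟙 a) =
      B.hcomp (𝟙 (X.app a)) (S.i a).hom

/-- A 2-natural transformation between 2-superfunctors. -/
@[ext]
structure TwoNat {k : Type t} [CommRing k] {A B : TwoSupercatData.{w, v, u} k}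
    (R S : TwoSuperfunctorData A B) extends TwoNatData R S where
  isTwoNat : IsTwoNat toTwoNatData

/-- The data of a Π-2-supercategory. -/
structure PiTwoSupercatData (k : Type t) [CommRing k] extends TwoSupercatData.{w, v, u} k where
  pi : ∀ a : Obj, a ⟶ a
  zeta : ∀ a : Obj, InvPair (pi a) (𝟙 a)

/-- A Π-2-supercategory: a 2-supercategory with an odd 2-isomorphism `ζ_a : π_a ⟶ 𝟙 a`
for each object `a`. -/
structure IsPiTwoSupercat {k : Type t} [CommRing k] (A : PiTwoSupercatData.{w, v, u} k) :
    Prop where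
  isTwoSupercat : IsTwoSupercat A.toTwoSupercatData
  zeta_inverse : ∀ a : A.Obj, (A.zeta a).IsInverse
  zeta_mem : ∀ a : A.Obj, (A.zeta a).hom ∈ A.deg _ _ 1

/-- A Π-2-supercategory. -/
structure PiTwoSupercat (k : Type t) [CommRing k] extends PiTwoSupercatData.{w, v, u} k where
  isPiTwoSupercat : IsPiTwoSupercat toPiTwoSupercatData


section Even

variable {k : Type t} [CommRing k]

theorem InvPair.IsInverse.inv_mem {C : Type u} [CategoryStruct.{v} C]
    [∀ X Y : C, AddCommGroup (X ⟶ Y)] [∀ X Y : C, Module k (X ⟶ Y)]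
    {deg : ∀ X Y : C, ZMod 2 → Submodule k (X ⟶ Y)} (h : IsSupercategory k C deg)
    {X Y : C} {e : InvPair X Y} (he : e.IsInverse) {p : ZMod 2} (hp : e.hom ∈ deg X Y p) :
    e.inv ∈ deg Y X p := by
  have key : ∀ p : ZMod 2, IsCompl (deg Y X p) (deg Y X (p + 1)) := by
    intro p
    fin_cases p
    · exact h.isCompl Y X
    · exact (h.isCompl Y X).symm
  have hz : ∀ {f : X ⟶ X} , f ∈ deg X X 0 → f ∈ deg X X 1 → f = 0 := fun h0 h1 =>
    Submodule.disjoint_def.1 (h.isCompl X X).disjoint _ h0 h1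
  obtain ⟨y, hy, z, hz', hyz⟩ := Submodule.mem_sup.1
    ((key p).sup_eq_top ▸ Submodule.mem_top : e.inv ∈ deg Y X p ⊔ deg Y X (p + 1))
  have h1 := he.hom_inv
  rw [← hyz, h.comp_add] at h1
  have hpp : p + p = 0 := CharTwo.add_self_eq_zero p
  have m1 : e.hom ≫ y ∈ deg X X 0 := hpp ▸ h.comp_mem hp hy
  have m2 : e.hom ≫ z ∈ deg X X 1 := by
    have := h.comp_mem hp hz'
    rwa [← add_assoc, hpp, zero_add] at this
  have h2 : e.hom ≫ z = 0 := by
    refine hz ?_ m2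
    rw [eq_sub_of_add_eq' h1]
    exact Submodule.sub_mem _ (h.id_mem X) m1
  have h3 : z = 0 := by
    have : e.inv ≫ (e.hom ≫ z) = z := by rw [← h.assoc, he.inv_hom, h.id_comp]
    rw [← this, h2]
    have := h.comp_smul (0 : k) e.inv (0 : X ⟶ X)
    simpa using this
  rw [← hyz, h3, add_zero]
  exact hy

namespace TwoSupercat

variable (A : TwoSupercat.{w, v, u} k) {a b c : A.Obj}

theorem interchange_left {f f' f'' : a ⟶ b} {g g' g'' : b ⟶ c}
    (x : f ⟶ f') {u : f' ⟶ f''} (y : g ⟶ g') (v : g' ⟶ g'') (hu : u ∈ A.deg f' f'' 0) :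
    A.hcomp x y ≫ A.hcomp u v = A.hcomp (x ≫ u) (y ≫ v) := by
  have hA := A.isTwoSupercat
  obtain ⟨y0, h0, y1, h1, rfl⟩ := Submodule.mem_sup.1
    (((hA.hom b c).isCompl g g').sup_eq_top ▸ Submodule.mem_top : y ∈ A.deg g g' 0 ⊔ A.deg g g' 1)
  have e0 := hA.interchange x v hu h0
  have e1 := hA.interchange x v hu h1
  simp only [ZMod.val_zero, zero_mul, pow_zero, one_smul] at e0 e1
  rw [hA.hcomp_add, (hA.hom a c).add_comp, e0, e1, ← hA.hcomp_add, (hA.hom b c).add_comp]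

theorem interchange_right {f f' f'' : a ⟶ b} {g g' g'' : b ⟶ c}
    (x : f ⟶ f') (u : f' ⟶ f'') {y : g ⟶ g'} (v : g' ⟶ g'') (hy : y ∈ A.deg g g' 0) :
    A.hcomp x y ≫ A.hcomp u v = A.hcomp (x ≫ u) (y ≫ v) := by
  have hA := A.isTwoSupercat
  obtain ⟨u0, h0, u1, h1, rfl⟩ := Submodule.mem_sup.1
    (((hA.hom a b).isCompl f' f'').sup_eq_top ▸ Submodule.mem_top :
      u ∈ A.deg f' f'' 0 ⊔ A.deg f' f'' 1)
  have e0 := hA.interchange x v h0 hy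
  have e1 := hA.interchange x v h1 hy
  simp only [ZMod.val_zero, mul_zero, pow_zero, one_smul] at e0 e1
  rw [hA.add_hcomp, (hA.hom a c).comp_add, e0, e1, ← hA.add_hcomp, (hA.hom a b).comp_add]

theorem id_mem (f : a ⟶ b) : 𝟙 f ∈ A.deg f f 0 := (A.isTwoSupercat.hom a b).id_mem f

theorem comp_mem {f g h : a ⟶ b} {x : f ⟶ g} {y : g ⟶ h} (hx : x ∈ A.deg f g 0)
    (hy : y ∈ A.deg g h 0) : x ≫ y ∈ A.deg f h 0 := by
  simpa using (A.isTwoSupercat.hom a b).comp_mem hx hy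

theorem hcomp_mem {f f' : a ⟶ b} {g g' : b ⟶ c} {x : f ⟶ f'} {y : g ⟶ g'}
    (hx : x ∈ A.deg f f' 0) (hy : y ∈ A.deg g g' 0) : A.hcomp x y ∈ A.deg _ _ 0 := by
  simpa using A.isTwoSupercat.hcomp_mem hx hy

theorem hcomp_id_comp (f : a ⟶ b) {g g' g'' : b ⟶ c} (y : g ⟶ g') (v : g' ⟶ g'') :
    A.hcomp (𝟙 f) (y ≫ v) = A.hcomp (𝟙 f) y ≫ A.hcomp (𝟙 f) v := by
  rw [A.interchange_left _ _ _ (A.id_mem f), (A.isTwoSupercat.hom a b).id_comp]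

theorem comp_hcomp_id {f f' f'' : a ⟶ b} (x : f ⟶ f') (u : f' ⟶ f'') (g : b ⟶ c) :
    A.hcomp (x ≫ u) (𝟙 g) = A.hcomp x (𝟙 g) ≫ A.hcomp u (𝟙 g) := by
  rw [A.interchange_right _ _ _ (A.id_mem g), (A.isTwoSupercat.hom b c).id_comp]

/-- Even 2-morphisms. -/
abbrev EvenHom (f g : a ⟶ b) : Type w := A.deg f g 0

variable {A}

def EvenHom.id (f : a ⟶ b) : A.EvenHom f f := ⟨𝟙 f, A.id_mem f⟩

def EvenHom.comp {f g h : a ⟶ b} (x : A.EvenHom f g) (y : A.EvenHom g h) : A.EvenHom f h :=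
  ⟨x.1 ≫ y.1, A.comp_mem x.2 y.2⟩

def EvenHom.hcomp {f f' : a ⟶ b} {g g' : b ⟶ c} (x : A.EvenHom f f') (y : A.EvenHom g g') :
    A.EvenHom (f ≫ g) (f' ≫ g') :=
  ⟨A.hcomp x.1 y.1, A.hcomp_mem x.2 y.2⟩

variable (A)

theorem id_hcomp {f g : a ⟶ b} (x : f ⟶ g) :
    A.hcomp (𝟙 (𝟙 a)) x = (A.lunit f).hom ≫ x ≫ (A.lunit g).inv := by
  have hA := A.isTwoSupercat
  rw [← (hA.hom a b).assoc, ← hA.lunit_naturality x, (hA.hom a b).assoc,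
    (hA.lunit_inverse g).hom_inv, (hA.hom a b).comp_id]

theorem hcomp_id {f g : a ⟶ b} (x : f ⟶ g) :
    A.hcomp x (𝟙 (𝟙 b)) = (A.runit f).hom ≫ x ≫ (A.runit g).inv := by
  have hA := A.isTwoSupercat
  rw [← (hA.hom a b).assoc, ← hA.runit_naturality x, (hA.hom a b).assoc,
    (hA.runit_inverse g).hom_inv, (hA.hom a b).comp_id]

theorem hcomp_assoc {d : A.Obj} {f f' : a ⟶ b} {g g' : b ⟶ c} {h h' : c ⟶ d}
    (x : f ⟶ f') (y : g ⟶ g') (z : h ⟶ h') :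
    A.hcomp (A.hcomp x y) z =
      (A.assoc f g h).hom ≫ A.hcomp x (A.hcomp y z) ≫ (A.assoc f' g' h').inv := by
  have hA := A.isTwoSupercat
  rw [← (hA.hom a d).assoc, ← hA.assoc_naturality, (hA.hom a d).assoc,
    (hA.assoc_inverse f' g' h').hom_inv, (hA.hom a d).comp_id]

theorem hcomp_assoc' {d : A.Obj} {f f' : a ⟶ b} {g g' : b ⟶ c} {h h' : c ⟶ d}
    (x : f ⟶ f') (y : g ⟶ g') (z : h ⟶ h') :
    A.hcomp x (A.hcomp y z) =
      (A.assoc f g h).inv ≫ A.hcomp (A.hcomp x y) z ≫ (A.assoc f' g' h').hom := by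
  have hA := A.isTwoSupercat
  rw [hA.assoc_naturality, ← (hA.hom a d).assoc, (hA.assoc_inverse f g h).inv_hom,
    (hA.hom a d).id_comp]

theorem hcomp_exchange {f f' : a ⟶ b} {g g' : b ⟶ c} {x : f ⟶ f'} (y : g ⟶ g')
    (hx : x ∈ A.deg f f' 0) :
    A.hcomp (𝟙 f) y ≫ A.hcomp x (𝟙 g') = A.hcomp x (𝟙 g) ≫ A.hcomp (𝟙 f') y := by
  have hA := A.isTwoSupercat
  rw [A.interchange_left _ _ _ hx, A.interchange_left _ _ _ (A.id_mem f'),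
    (hA.hom a b).id_comp, (hA.hom a b).comp_id, (hA.hom b c).id_comp, (hA.hom b c).comp_id]

theorem EvenHom.id_comp {f g : a ⟶ b} (x : A.EvenHom f g) : (EvenHom.id f).comp x = x :=
  Subtype.ext ((A.isTwoSupercat.hom a b).id_comp x.1)

theorem EvenHom.comp_id {f g : a ⟶ b} (x : A.EvenHom f g) : x.comp (EvenHom.id g) = x :=
  Subtype.ext ((A.isTwoSupercat.hom a b).comp_id x.1)

theorem EvenHom.assoc {f g h i : a ⟶ b} (x : A.EvenHom f g) (y : A.EvenHom g h)
    (z : A.EvenHom h i) : (x.comp y).comp z = x.comp (y.comp z) :=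
  Subtype.ext ((A.isTwoSupercat.hom a b).assoc x.1 y.1 z.1)

theorem comp_id_hcomp {d : A.Obj} (f : a ⟶ b) (g : b ⟶ c) {h h' : c ⟶ d} (y : h ⟶ h') :
    A.hcomp (𝟙 (f ≫ g)) y =
      (A.assoc f g h).hom ≫ A.hcomp (𝟙 f) (A.hcomp (𝟙 g) y) ≫ (A.assoc f g h').inv := by
  rw [← A.hcomp_assoc, A.isTwoSupercat.hcomp_id]

theorem hcomp_id_comp' {d : A.Obj} {f f' : a ⟶ b} (x : f ⟶ f') (g : b ⟶ c) (h : c ⟶ d) :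
    A.hcomp x (𝟙 (g ≫ h)) =
      (A.assoc f g h).inv ≫ A.hcomp (A.hcomp x (𝟙 g)) (𝟙 h) ≫ (A.assoc f' g h).hom := by
  rw [← A.hcomp_assoc', A.isTwoSupercat.hcomp_id]

variable {A} in
theorem EvenHom.ext {f g : a ⟶ b} {x y : A.EvenHom f g} (h : x.1 = y.1) : x = y := Subtype.ext h

/-- The category of 1-morphisms and even 2-morphisms. -/
@[reducible]
def evenCategory (a b : A.Obj) : Category.{w} (a ⟶ b) where
  Hom f g := A.EvenHom f g
  id f := EvenHom.id f
  comp x y := EvenHom.comp x y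
  id_comp x := EvenHom.id_comp A x
  comp_id x := EvenHom.comp_id A x
  assoc x y z := EvenHom.assoc A x y z

/-- An even 2-isomorphism is an isomorphism in the category of even 2-morphisms. -/
def evenIso {a b : A.Obj} {f g : a ⟶ b} (e : InvPair f g) (he : e.IsInverse)
    (h0 : e.hom ∈ A.deg f g 0) : @Iso (a ⟶ b) (A.evenCategory a b) f g :=
  @Iso.mk (a ⟶ b) (A.evenCategory a b) f g
    (⟨e.hom, h0⟩ : A.EvenHom f g)
    (⟨e.inv, he.inv_mem (A.isTwoSupercat.hom a b) h0⟩ : A.EvenHom g f)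
    (EvenHom.ext he.hom_inv) (EvenHom.ext he.inv_hom)

/-- The underlying 2-category of a 2-supercategory: the same objects and 1-morphisms, and the
even 2-morphisms. -/
@[reducible]
def even : Bicategory.{w, v} A.Obj where
  toCategoryStruct := A.catStruct
  homCategory a b := A.evenCategory a b
  whiskerLeft f _ _ y := EvenHom.hcomp (EvenHom.id f) y
  whiskerRight x g := EvenHom.hcomp x (EvenHom.id g)
  associator f g h := A.evenIso (A.assoc f g h) (A.isTwoSupercat.assoc_inverse f g h)
    (A.isTwoSupercat.assoc_mem f g h)
  leftUnitor f := A.evenIso (A.lunit f) (A.isTwoSupercat.lunit_inverse f)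
    (A.isTwoSupercat.lunit_mem f)
  rightUnitor f := A.evenIso (A.runit f) (A.isTwoSupercat.runit_inverse f)
    (A.isTwoSupercat.runit_mem f)
  whiskerLeft_id f g := EvenHom.ext (A.isTwoSupercat.hcomp_id f g)
  whiskerLeft_comp f _ _ _ x y := EvenHom.ext (A.hcomp_id_comp f (Subtype.val x) (Subtype.val y))
  id_whiskerLeft x := EvenHom.ext (A.id_hcomp (Subtype.val x))
  comp_whiskerLeft f g _ _ y := EvenHom.ext (A.comp_id_hcomp f g (Subtype.val y))
  id_whiskerRight f g := EvenHom.ext (A.isTwoSupercat.hcomp_id f g)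
  comp_whiskerRight x y g := EvenHom.ext (A.comp_hcomp_id (Subtype.val x) (Subtype.val y) g)
  whiskerRight_id x := EvenHom.ext (A.hcomp_id (Subtype.val x))
  whiskerRight_comp x g h := EvenHom.ext (A.hcomp_id_comp' (Subtype.val x) g h)
  whisker_assoc f _ _ y h := EvenHom.ext (A.hcomp_assoc (EvenHom.id f).1 (Subtype.val y)
    (EvenHom.id h).1)
  whisker_exchange x y := EvenHom.ext (A.hcomp_exchange (Subtype.val y) (Subtype.property x))
  pentagon f g h i := EvenHom.ext (A.isTwoSupercat.pentagon f g h i)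
  triangle f g := EvenHom.ext (A.isTwoSupercat.triangle f g)

end TwoSupercat

variable {A B : TwoSupercat.{w, v, u} k}

/-- The coherence isomorphism `c` among even 2-morphisms. -/
abbrev TwoSuperfunctor.evenC (R : TwoSuperfunctor A.toTwoSupercatData B.toTwoSupercatData)
    {a b c : A.Obj} (f : a ⟶ b) (g : b ⟶ c) :=
  B.evenIso (R.c f g) (R.isTwoSuperfunctor.c_inverse f g) (R.isTwoSuperfunctor.c_mem f g)

/-- The coherence isomorphism `i` among even 2-morphisms. -/
abbrev TwoSuperfunctor.evenI (R : TwoSuperfunctor A.toTwoSupercatData B.toTwoSupercatData)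
    (a : A.Obj) :=
  B.evenIso (R.i a) (R.isTwoSuperfunctor.i_inverse a) (R.isTwoSuperfunctor.i_mem a)

/-- The 2-superfunctor `R` restricted to even 2-morphisms, as a pseudofunctor. -/
def TwoSuperfunctor.even (R : TwoSuperfunctor A.toTwoSupercatData B.toTwoSupercatData) :
    @Pseudofunctor A.Obj A.even B.Obj B.even :=
  letI := A.even
  letI := B.even
  { obj := R.obj
    map := R.map
    map₂ := fun x => (⟨R.map₂ (Subtype.val x), R.isTwoSuperfunctor.map₂_mem (Subtype.property x)⟩ :
      B.EvenHom _ _)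
    map₂_id := fun f => TwoSupercat.EvenHom.ext (R.isTwoSuperfunctor.map₂_id f)
    map₂_comp := fun x y => TwoSupercat.EvenHom.ext
      (R.isTwoSuperfunctor.map₂_comp (Subtype.val x) (Subtype.val y))
    mapId := fun a => (R.evenI a).symm
    mapComp := fun f g => (R.evenC f g).symm
    map₂_whisker_left := fun f g h y => by
      refine (Iso.eq_inv_comp (R.evenC _ _)).2 ?_
      refine TwoSupercat.EvenHom.ext ?_
      have := R.isTwoSuperfunctor.c_naturality (TwoSupercat.EvenHom.id f).1 (Subtype.val y)
      erw [R.isTwoSuperfunctor.map₂_id] at this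
      exact this.symm
    map₂_whisker_right := fun x h => by
      refine (Iso.eq_inv_comp (R.evenC _ _)).2 ?_
      refine TwoSupercat.EvenHom.ext ?_
      have := R.isTwoSuperfunctor.c_naturality (Subtype.val x) (TwoSupercat.EvenHom.id h).1
      erw [R.isTwoSuperfunctor.map₂_id] at this
      exact this.symm
    map₂_associator := fun f g h => by
      refine (Iso.eq_inv_comp (R.evenC (f ≫ g) h)).2 ?_
      refine (Iso.eq_inv_comp (whiskerRightIso (R.evenC f g) (R.map h))).2 ?_
      exact TwoSupercat.EvenHom.ext (R.isTwoSuperfunctor.map₂_assoc f g h)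
    map₂_left_unitor := fun {a b} f => by
      refine (Iso.eq_inv_comp (R.evenC (𝟙 a) f)).2 ?_
      refine (Iso.eq_inv_comp (whiskerRightIso (R.evenI a) (R.map f))).2 ?_
      exact TwoSupercat.EvenHom.ext (R.isTwoSuperfunctor.map₂_lunit f)
    map₂_right_unitor := fun {a b} f => by
      refine (Iso.eq_inv_comp (R.evenC f (𝟙 b))).2 ?_
      refine (Iso.eq_inv_comp (whiskerLeftIso (R.map f) (R.evenI b))).2 ?_
      exact TwoSupercat.EvenHom.ext (R.isTwoSuperfunctor.map₂_runit f) }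

theorem assoc_five {C : Type u} [Category.{v} C] {X₀ X₁ X₂ X₃ X₄ X₅ X₆ : C} (f₁ : X₀ ⟶ X₁)
    (f₂ : X₁ ⟶ X₂) (f₃ : X₂ ⟶ X₃) (f₄ : X₃ ⟶ X₄) (f₅ : X₄ ⟶ X₅) (f₆ : X₅ ⟶ X₆) :
    (f₁ ≫ f₂ ≫ f₃ ≫ f₄ ≫ f₅) ≫ f₆ = f₁ ≫ f₂ ≫ f₃ ≫ f₄ ≫ f₅ ≫ f₆ := by
  simp only [Category.assoc]

/-- A 2-natural transformation, regarded as an oplax transformation of pseudofunctors between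
the underlying 2-categories. -/
def TwoNat.even {R S : TwoSuperfunctor A.toTwoSupercatData B.toTwoSupercatData}
    (X : TwoNat R.toTwoSuperfunctorData S.toTwoSuperfunctorData) :
    @Oplax.OplaxTrans A.Obj A.even B.Obj B.even
      (@Pseudofunctor.toOplax A.Obj A.even B.Obj B.even R.even)
      (@Pseudofunctor.toOplax A.Obj A.even B.Obj B.even S.even) :=
  letI := A.even
  letI := B.even
  { app := X.app
    naturality := fun f => (⟨X.naturality f, X.isTwoNat.mem f⟩ : B.EvenHom _ _)
    naturality_naturality := fun y =>
      TwoSupercat.EvenHom.ext (X.isTwoNat.naturality₂ (Subtype.val y))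
    naturality_id := fun a => by
      refine (Iso.comp_inv_eq (whiskerLeftIso (X.app a) (S.evenI a))).2 ?_
      refine Eq.trans ?_ (Category.assoc _ _ _).symm
      refine (Iso.eq_inv_comp (whiskerRightIso (R.evenI a) (X.app a))).2 ?_
      refine Eq.trans ?_ (Category.assoc _ _ _).symm
      refine (Iso.inv_comp_eq (λ_ _)).1 ?_
      refine (Iso.inv_comp_eq (ρ_ _).symm).1 ?_
      exact TwoSupercat.EvenHom.ext (X.isTwoNat.naturality_id a)
    naturality_comp := fun {a b c} f g => by
      refine (Iso.comp_inv_eq (whiskerLeftIso (X.app a) (S.evenC f g))).2 ?_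
      refine Eq.trans ?_ (Category.assoc _ _ _).symm
      refine (Iso.eq_inv_comp (whiskerRightIso (R.evenC f g) (X.app c))).2 ?_
      exact (TwoSupercat.EvenHom.ext (X.isTwoNat.naturality_comp f g)).trans
        (@assoc_five _ (B.evenCategory _ _) _ _ _ _ _ _ _ _ _ _ _ _ _).symm }

/-- The coherence axioms of a 2-natural transformation may be checked on underlying
2-categories. -/
theorem IsTwoNat.of_even {A B : TwoSupercat.{w, v, u} k}
    {R S : TwoSuperfunctor A.toTwoSupercatData B.toTwoSupercatData}
    {X : TwoNatData R.toTwoSuperfunctorData S.toTwoSuperfunctorData}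
    (mem : ∀ {a b : A.Obj} (f : a ⟶ b), X.naturality f ∈ B.deg _ _ 0)
    (nat : ∀ {a b : A.Obj} {f g : a ⟶ b} (y : f ⟶ g),
      B.hcomp (R.map₂ y) (𝟙 (X.app b)) ≫ X.naturality g =
        X.naturality f ≫ B.hcomp (𝟙 (X.app a)) (S.map₂ y))
    (η : @Oplax.OplaxTrans A.Obj A.even B.Obj B.even
      (@Pseudofunctor.toOplax A.Obj A.even B.Obj B.even R.even)
      (@Pseudofunctor.toOplax A.Obj A.even B.Obj B.even S.even))
    (h : (letI := A.even; letI := B.even; η.app) = X.app)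
    (h' : ∀ {a b : A.Obj} (f : a ⟶ b), HEq
      (Subtype.val (letI := A.even; letI := B.even; η.naturality f)) (X.naturality f)) :
    IsTwoNat X := by
  let _ := A.even
  let _ := B.even
  obtain ⟨app, naturality⟩ := X
  obtain ⟨app', naturality', n1, n2, n3⟩ := η
  dsimp only at h
  subst h
  have h' : ∀ {a b : A.Obj} (f : a ⟶ b), naturality' f = ⟨naturality f, mem f⟩ :=
    fun f => TwoSupercat.EvenHom.ext (eq_of_heq (h' f))
  obtain rfl : @naturality' = fun {a b} f => ⟨naturality f, mem f⟩ := by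
    funext a b f; exact h' f
  refine ⟨mem, nat, ?_, ?_⟩
  · intro a b c f g
    have e := (Iso.comp_inv_eq (whiskerLeftIso (app' a) (S.evenC f g))).1 (n3 f g)
    replace e := e.trans (Category.assoc _ _ _)
    replace e := (Iso.eq_inv_comp (whiskerRightIso (R.evenC f g) (app' c))).1 e
    replace e := e.trans (assoc_five _ _ _ _ _ _)
    exact congrArg Subtype.val e
  · intro a
    have e := (Iso.comp_inv_eq (whiskerLeftIso (app' a) (S.evenI a))).1 (n2 a)
    replace e := e.trans (Category.assoc _ _ _)
    replace e := (Iso.eq_inv_comp (whiskerRightIso (R.evenI a) (app' a))).1 e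
    replace e := e.trans (Category.assoc _ _ _)
    replace e := (Iso.inv_comp_eq (λ_ _)).2 e
    replace e := (Iso.inv_comp_eq (ρ_ _).symm).2 e
    exact congrArg Subtype.val e

end Even


section Whiskering

variable {B : Type u} [Bicategory.{w, v} B] {C : Type u} [Bicategory.{w, v} C] {D : Type u}
  [Bicategory.{w, v} D]

theorem map₂_naturality (T : Pseudofunctor C D) {a b c d : C} {f f' : a ⟶ b} {X : b ⟶ d}
    {Y : a ⟶ c} {g g' : c ⟶ d} (y : f ⟶ f') (z : g ⟶ g') (x : f ≫ X ⟶ Y ≫ g)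
    (x' : f' ≫ X ⟶ Y ≫ g') (h : y ▷ X ≫ x' = x ≫ Y ◁ z) :
    T.map₂ y ▷ T.map X ≫ (T.mapComp f' X).inv ≫ T.map₂ x' ≫ (T.mapComp Y g').hom =
      ((T.mapComp f X).inv ≫ T.map₂ x ≫ (T.mapComp Y g).hom) ≫ T.map Y ◁ T.map₂ z := by
  have h1 := congrArg T.map₂ h
  simp only [T.map₂_comp, T.map₂_whisker_left, T.map₂_whisker_right, Category.assoc] at h1
  rw [← cancel_epi (T.mapComp f X).hom, ← cancel_mono (T.mapComp Y g').inv]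
  simpa using h1

theorem map₂_naturality_id (T : Pseudofunctor C D) {a b : C} {X : a ⟶ b} {r : a ⟶ a} {s : b ⟶ b}
    (x : r ≫ X ⟶ X ≫ s) (i : r ⟶ 𝟙 a) (j : s ⟶ 𝟙 b)
    (h : x ≫ X ◁ j = i ▷ X ≫ (λ_ X).hom ≫ (ρ_ X).inv) :
    ((T.mapComp r X).inv ≫ T.map₂ x ≫ (T.mapComp X s).hom) ≫
        T.map X ◁ (T.map₂ j ≫ (T.mapId b).hom) =
      (T.map₂ i ≫ (T.mapId a).hom) ▷ T.map X ≫ (λ_ (T.map X)).hom ≫ (ρ_ (T.map X)).inv := by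
  have h1 := congrArg T.map₂ h
  have h2 : T.map₂ (ρ_ X).hom ≫ T.map₂ (ρ_ X).inv = 𝟙 _ := by
    rw [← T.map₂_comp, Iso.hom_inv_id, T.map₂_id]
  have h3 : T.map₂ (ρ_ X).inv ≫ T.map₂ (ρ_ X).hom = 𝟙 _ := by
    rw [← T.map₂_comp, Iso.inv_hom_id, T.map₂_id]
  rw [← cancel_epi (T.mapComp r X).hom]
  simp only [T.map₂_comp, T.map₂_whisker_left, T.map₂_whisker_right, Category.assoc,
    Bicategory.whiskerLeft_comp, comp_whiskerRight, T.whiskerLeft_mapId_hom,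
    T.whiskerRight_mapId_hom] at h1 ⊢
  simp only [Iso.hom_inv_id_assoc]
  rw [reassoc_of% h1, Iso.inv_hom_id_assoc, reassoc_of% h3]

theorem map₂_naturality_comp (T : Pseudofunctor C D) {a b c a' b' c' : C} {X : a ⟶ a'}
    {Y : b ⟶ b'} {Z : c ⟶ c'} {f : a ⟶ b} {g : b ⟶ c} {e : a ⟶ c} {f' : a' ⟶ b'} {g' : b' ⟶ c'}
    {e' : a' ⟶ c'} (x : f ≫ Y ⟶ X ≫ f') (y : g ≫ Z ⟶ Y ≫ g') (z : e ≫ Z ⟶ X ≫ e')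
    (m : e ⟶ f ≫ g) (m' : e' ⟶ f' ≫ g')
    (h : z ≫ X ◁ m' = m ▷ Z ≫ (α_ _ _ _).hom ≫ f ◁ y ≫ (α_ _ _ _).inv ≫ x ▷ g' ≫
      (α_ _ _ _).hom) :
    ((T.mapComp e Z).inv ≫ T.map₂ z ≫ (T.mapComp X e').hom) ≫
        T.map X ◁ (T.map₂ m' ≫ (T.mapComp f' g').hom) =
      (T.map₂ m ≫ (T.mapComp f g).hom) ▷ T.map Z ≫ (α_ _ _ _).hom ≫
        T.map f ◁ ((T.mapComp g Z).inv ≫ T.map₂ y ≫ (T.mapComp Y g').hom) ≫ (α_ _ _ _).inv ≫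
        ((T.mapComp f Y).inv ≫ T.map₂ x ≫ (T.mapComp X f').hom) ▷ T.map g' ≫ (α_ _ _ _).hom := by
  have h1 := congrArg T.map₂ h
  have h2 : T.map₂ (α_ f Y g').inv = (T.mapComp f (Y ≫ g')).hom ≫ T.map f ◁ (T.mapComp Y g').hom ≫
      (α_ _ _ _).inv ≫ (T.mapComp f Y).inv ▷ T.map g' ≫ (T.mapComp (f ≫ Y) g').inv := by
    rw [← cancel_epi (T.map₂ (α_ f Y g').hom), ← T.map₂_comp, Iso.hom_inv_id, T.map₂_id]
    simp
  rw [← cancel_epi (T.mapComp e Z).hom]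
  simp only [T.map₂_comp, T.map₂_whisker_left, T.map₂_whisker_right, Category.assoc,
    Bicategory.whiskerLeft_comp, comp_whiskerRight, h2, T.map₂_associator] at h1 ⊢
  replace h1 := congrArg (fun z => z ≫ (T.mapComp X (f' ≫ g')).hom ≫
    T.map X ◁ (T.mapComp f' g').hom) h1
  simp only [Category.assoc, Iso.inv_hom_id_assoc, Iso.hom_inv_id_assoc,
    whiskerLeft_inv_hom] at h1 ⊢
  simpa using h1

theorem naturality_whisker {a c a' c' : B} {X : a ⟶ a'} {Z : c ⟶ c'} {e e₁ : a ⟶ c}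
    {e' e₁' : a' ⟶ c'} (x : e ≫ Z ⟶ X ≫ e') (x₁ : e₁ ≫ Z ⟶ X ≫ e₁') (m : e ⟶ e₁)
    (m' : e' ⟶ e₁') {e₂ : a ⟶ c} {e₂' : a' ⟶ c'} (n : e₁ ⟶ e₂) (n' : e₁' ⟶ e₂')
    (r : e₂ ≫ Z ⟶ X ≫ e₂') (h : m ▷ Z ≫ x₁ = x ≫ X ◁ m') (h' : x₁ ≫ X ◁ n' = n ▷ Z ≫ r) :
    x ≫ X ◁ (m' ≫ n') = (m ≫ n) ▷ Z ≫ r := by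
  rw [Bicategory.whiskerLeft_comp, comp_whiskerRight, Category.assoc, ← h', ← reassoc_of% h]

/-- Whiskering of an oplax transformation with a pseudofunctor on the source side. -/
def oplaxWhiskerLeft (R : Pseudofunctor B C) {S T : Pseudofunctor C D}
    (η : Oplax.OplaxTrans S.toOplax T.toOplax) :
    Oplax.OplaxTrans (R.comp S).toOplax (R.comp T).toOplax where
  app a := η.app (R.obj a)
  naturality f := η.naturality (R.map f)
  naturality_naturality y := η.naturality_naturality (R.map₂ y)
  naturality_id a := naturality_whisker _ _ _ _ _ _ _
    (η.naturality_naturality (R.mapId a).hom) (η.naturality_id (R.obj a))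
  naturality_comp f g := naturality_whisker _ _ _ _ _ _ _
    (η.naturality_naturality (R.mapComp f g).hom) (η.naturality_comp (R.map f) (R.map g))

/-- Whiskering of an oplax transformation with a pseudofunctor on the target side. -/
def oplaxWhiskerRight {R S : Pseudofunctor B C} (η : Oplax.OplaxTrans R.toOplax S.toOplax)
    (T : Pseudofunctor C D) :
    Oplax.OplaxTrans (R.comp T).toOplax (S.comp T).toOplax where
  app a := T.map (η.app a)
  naturality {a b} f := (T.mapComp (R.map f) (η.app b)).inv ≫ T.map₂ (η.naturality f) ≫
    (T.mapComp (η.app a) (S.map f)).hom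
  naturality_naturality y := map₂_naturality T _ _ _ _ (η.naturality_naturality y)
  naturality_id a := map₂_naturality_id T _ _ _ (η.naturality_id a)
  naturality_comp f g := map₂_naturality_comp T _ _ _ _ _ (η.naturality_comp f g)

end Whiskering

section SuperComposition

variable {k : Type t} [CommRing k]

/-- The identity 2-superfunctor. -/
abbrev TwoSuperfunctorData.id (A : TwoSupercatData.{w, v, u} k) : TwoSuperfunctorData A A where
  obj a := a
  map f := f
  map₂ x := x
  c f g := ⟨𝟙 (f ≫ g), 𝟙 (f ≫ g)⟩
  i a := ⟨𝟙 (𝟙 a), 𝟙 (𝟙 a)⟩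

/-- The composite of two 2-superfunctors. -/
abbrev TwoSuperfunctorData.comp {A B C : TwoSupercatData.{w, v, u} k} (R : TwoSuperfunctorData A B)
    (S : TwoSuperfunctorData B C) : TwoSuperfunctorData A C where
  obj a := S.obj (R.obj a)
  map f := S.map (R.map f)
  map₂ x := S.map₂ (R.map₂ x)
  c f g := ⟨(S.c (R.map f) (R.map g)).hom ≫ S.map₂ (R.c f g).hom,
    S.map₂ (R.c f g).inv ≫ (S.c (R.map f) (R.map g)).inv⟩
  i a := ⟨(S.i (R.obj a)).hom ≫ S.map₂ (R.i a).hom, S.map₂ (R.i a).inv ≫ (S.i (R.obj a)).inv⟩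

def TwoSuperfunctor.id (A : TwoSupercat.{w, v, u} k) :
    TwoSuperfunctor A.toTwoSupercatData A.toTwoSupercatData where
  toTwoSuperfunctorData := .id A.toTwoSupercatData
  isTwoSuperfunctor := by
    have hA := A.isTwoSupercat
    have idc := fun {a b : A.Obj} {f g : a ⟶ b} (x : f ⟶ g) => (hA.hom a b).id_comp x
    have cid := fun {a b : A.Obj} {f g : a ⟶ b} (x : f ⟶ g) => (hA.hom a b).comp_id x
    refine ⟨fun _ => rfl, fun _ _ => rfl, fun _ _ => rfl, fun _ _ => rfl, fun h => h, ?_, ?_, ?_, ?_, ?_,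
      ?_, ?_, ?_⟩
    · exact fun f g => ⟨idc _, idc _⟩
    · exact fun f g => A.id_mem (f ≫ g)
    · exact fun x y => (cid _).trans (idc _).symm
    · exact fun a => ⟨idc _, idc _⟩
    · exact fun a => A.id_mem (𝟙 a)
    · intro a b c d f g h
      dsimp only [TwoSuperfunctorData.id]
      rw [hA.hcomp_id, hA.hcomp_id, idc, idc, idc, cid]
    · intro a b f
      dsimp only [TwoSuperfunctorData.id]
      rw [hA.hcomp_id, idc, idc]
    · intro a b f
      dsimp only [TwoSuperfunctorData.id]
      rw [hA.hcomp_id, idc, idc]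

theorem InvPair.IsInverse.comp {C : Type u} [CategoryStruct.{v} C] {X Y Z : C}
    (assoc : ∀ {X Y Z W : C} (f : X ⟶ Y) (g : Y ⟶ Z) (h : Z ⟶ W), (f ≫ g) ≫ h = f ≫ g ≫ h)
    (comp_id : ∀ {X Y : C} (f : X ⟶ Y), f ≫ 𝟙 Y = f)
    {e : InvPair X Y} {e' : InvPair Y Z} (h : e.IsInverse) (h' : e'.IsInverse) :
    (⟨e.hom ≫ e'.hom, e'.inv ≫ e.inv⟩ : InvPair X Z).IsInverse := by
  constructor
  · dsimp only
    rw [assoc, ← assoc e'.hom, h'.hom_inv, ← assoc, comp_id, h.hom_inv]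
  · dsimp only
    rw [assoc, ← assoc e.inv, h.inv_hom, ← assoc, comp_id, h'.inv_hom]

theorem IsTwoSuperfunctor.map_inverse {A B : TwoSupercatData.{w, v, u} k}
    {R : TwoSuperfunctorData A B} (h : IsTwoSuperfunctor R) {a b : A.Obj} {f g : a ⟶ b}
    {e : InvPair f g} (he : e.IsInverse) :
    (⟨R.map₂ e.hom, R.map₂ e.inv⟩ : InvPair (R.map f) (R.map g)).IsInverse :=
  ⟨by rw [← h.map₂_comp, he.hom_inv, h.map₂_id], by rw [← h.map₂_comp, he.inv_hom, h.map₂_id]⟩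

/-- The underlying ordinary category of a supercategory. -/
@[reducible]
def IsSupercategory.category {C : Type u} [CategoryStruct.{v} C]
    [∀ X Y : C, AddCommGroup (X ⟶ Y)] [∀ X Y : C, Module k (X ⟶ Y)]
    {deg : ∀ X Y : C, ZMod 2 → Submodule k (X ⟶ Y)} (h : IsSupercategory k C deg) :
    Category.{v} C where
  id_comp := h.id_comp
  comp_id := h.comp_id
  assoc := h.assoc

theorem assoc_square {C : Type u} (_ : Category.{v} C) {X₀ X₁ X₂ X₂' X₃ X₄ X₅ : C} {p₁ : X₀ ⟶ X₁}
    {p₂ : X₁ ⟶ X₂} {p₃ : X₂ ⟶ X₃} {p₃' : X₁ ⟶ X₂'} {q : X₂' ⟶ X₃} {r : X₃ ⟶ X₄} {s : X₄ ⟶ X₅}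
    {l : X₂' ⟶ X₅} {m : X₀ ⟶ X₅} (e₁ : p₂ ≫ p₃ = p₃' ≫ q) (e₂ : q ≫ r ≫ s = l)
    (e₃ : p₁ ≫ p₃' ≫ l = m) : (p₁ ≫ p₂) ≫ (p₃ ≫ r) ≫ s = m := by
  rw [← e₃, ← e₂, ← Category.assoc p₃', ← e₁]
  simp only [Category.assoc]

theorem assoc_hexagon {C : Type u} (hC : Category.{v} C)
    {X₀ X₁ X₂ X₂' X₃ X₄ X₅ Y₁ Y₂ Y₃ Y₃' Y₄ : C} {p₁ : X₀ ⟶ X₁} {p₂ : X₁ ⟶ X₂} {p₃ : X₂ ⟶ X₃}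
    {p₃' : X₁ ⟶ X₂'} {q : X₂' ⟶ X₃} {r : X₃ ⟶ X₄} {s : X₄ ⟶ X₅} {l : X₂' ⟶ Y₃'} {m : X₀ ⟶ Y₁}
    {n₁ : Y₁ ⟶ Y₂} {n₂ : Y₂ ⟶ Y₃} {n₃ : Y₃ ⟶ Y₄} {n₃' : Y₂ ⟶ Y₃'} {n₄ : Y₃' ⟶ Y₄} {z : Y₄ ⟶ X₅}
    (e₁ : p₂ ≫ p₃ = p₃' ≫ q) (e₂ : q ≫ r ≫ s = l ≫ n₄ ≫ z)
    (e₃ : p₁ ≫ p₃' ≫ l = m ≫ n₁ ≫ n₃') (e₄ : n₂ ≫ n₃ = n₃' ≫ n₄) :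
    (p₁ ≫ p₂) ≫ (p₃ ≫ r) ≫ s = m ≫ (n₁ ≫ n₂) ≫ n₃ ≫ z := by
  rw [assoc_square hC e₁ e₂ rfl]
  have : (p₁ ≫ p₃' ≫ l) ≫ n₄ ≫ z = m ≫ n₁ ≫ (n₃' ≫ n₄) ≫ z := by
    rw [e₃]; simp only [Category.assoc]
  rw [← e₄] at this
  simpa only [Category.assoc] using this

def TwoSuperfunctor.comp {A B C : TwoSupercat.{w, v, u} k}
    (R : TwoSuperfunctor A.toTwoSupercatData B.toTwoSupercatData)
    (S : TwoSuperfunctor B.toTwoSupercatData C.toTwoSupercatData) :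
    TwoSuperfunctor A.toTwoSupercatData C.toTwoSupercatData where
  toTwoSuperfunctorData := R.toTwoSuperfunctorData.comp S.toTwoSuperfunctorData
  isTwoSuperfunctor := by
    have hC := C.isTwoSupercat
    have hR := R.isTwoSuperfunctor
    have hS := S.isTwoSuperfunctor
    have cid := fun {a b : C.Obj} {f g : a ⟶ b} (x : f ⟶ g) => (hC.hom a b).comp_id x
    have as := fun {a b : C.Obj} {f g h i : a ⟶ b} (x : f ⟶ g) (y : g ⟶ h) (z : h ⟶ i) =>
      (hC.hom a b).assoc x y z
    constructor <;> dsimp only [TwoSuperfunctorData.comp]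
    · intro a b f; rw [hR.map₂_id, hS.map₂_id]
    · intro a b f g h x y; rw [hR.map₂_comp, hS.map₂_comp]
    · intro a b f g x y; rw [hR.map₂_add, hS.map₂_add]
    · intro a b f g r x; rw [hR.map₂_smul, hS.map₂_smul]
    · exact fun hx => hS.map₂_mem (hR.map₂_mem hx)
    · intro a b c f g
      exact (hS.c_inverse _ _).comp as cid (hS.map_inverse (hR.c_inverse f g))
    · intro a b c f g
      exact C.comp_mem (hS.c_mem _ _) (hS.map₂_mem (hR.c_mem f g))
    · intro a b c f f' g g' x y
      rw [← as, hS.c_naturality, as, as, ← hS.map₂_comp, ← hS.map₂_comp, hR.c_naturality]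
    · intro a
      exact (hS.i_inverse _).comp as cid (hS.map_inverse (hR.i_inverse a))
    · intro a
      exact C.comp_mem (hS.i_mem _) (hS.map₂_mem (hR.i_mem a))
    · intro a b c d f g h
      have e1 := hS.c_naturality (R.c f g).hom (𝟙 (R.map h))
      have e2 := hS.c_naturality (𝟙 (R.map f)) (R.c g h).hom
      have e3 := congrArg S.map₂ (hR.map₂_assoc f g h)
      have e4 := hS.map₂_assoc (R.map f) (R.map g) (R.map h)
      simp only [hS.map₂_comp, hS.map₂_id] at e1 e2 e3 e4
      rw [C.comp_hcomp_id, C.hcomp_id_comp]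
      exact assoc_hexagon (hC.hom _ _).category e1 e3 e4 e2
    · intro a b f
      have e1 := hS.c_naturality (R.i a).hom (𝟙 (R.map f))
      have e3 := congrArg S.map₂ (hR.map₂_lunit f)
      have e4 := hS.map₂_lunit (R.map f)
      simp only [hS.map₂_comp, hS.map₂_id] at e1 e3 e4
      rw [C.comp_hcomp_id]
      exact assoc_square (hC.hom _ _).category e1 e3 e4
    · intro a b f
      have e1 := hS.c_naturality (𝟙 (R.map f)) (R.i b).hom
      have e3 := congrArg S.map₂ (hR.map₂_runit f)
      have e4 := hS.map₂_runit (R.map f)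
      simp only [hS.map₂_comp, hS.map₂_id] at e1 e3 e4
      rw [C.hcomp_id_comp]
      exact assoc_square (hC.hom _ _).category e1 e3 e4

end SuperComposition

section SuperNat

variable {k : Type t} [CommRing k]

/-- The identity 2-natural transformation. -/
abbrev TwoNatData.id {A B : TwoSupercatData.{w, v, u} k} (R : TwoSuperfunctorData A B) :
    TwoNatData R R where
  app a := 𝟙 (R.obj a)
  naturality f := (B.runit (R.map f)).hom ≫ (B.lunit (R.map f)).inv

/-- Vertical composition of 2-natural transformations. -/
abbrev TwoNatData.vcomp {A B : TwoSupercatData.{w, v, u} k} {R S T : TwoSuperfunctorData A B}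
    (X : TwoNatData R S) (Y : TwoNatData S T) : TwoNatData R T where
  app a := X.app a ≫ Y.app a
  naturality {a b} f := (B.assoc (R.map f) (X.app b) (Y.app b)).inv ≫
    B.hcomp (X.naturality f) (𝟙 (Y.app b)) ≫ (B.assoc (X.app a) (S.map f) (Y.app b)).hom ≫
      B.hcomp (𝟙 (X.app a)) (Y.naturality f) ≫ (B.assoc (X.app a) (Y.app a) (T.map f)).inv

/-- Whiskering of a 2-natural transformation with a 2-superfunctor on the source side. -/
abbrev TwoNatData.whiskerLeft {A B C : TwoSupercatData.{w, v, u} k} (R : TwoSuperfunctorData A B)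
    {S T : TwoSuperfunctorData B C} (X : TwoNatData S T) :
    TwoNatData (R.comp S) (R.comp T) where
  app a := X.app (R.obj a)
  naturality f := X.naturality (R.map f)

/-- Whiskering of a 2-natural transformation with a 2-superfunctor on the target side. -/
abbrev TwoNatData.whiskerRight {A B C : TwoSupercatData.{w, v, u} k}
    {R S : TwoSuperfunctorData A B} (X : TwoNatData R S) (T : TwoSuperfunctorData B C) :
    TwoNatData (R.comp T) (S.comp T) where
  app a := T.map (X.app a)
  naturality {a b} f := (T.c (R.map f) (X.app b)).hom ≫ T.map₂ (X.naturality f) ≫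
    (T.c (X.app a) (S.map f)).inv

variable {A B C : TwoSupercat.{w, v, u} k}

theorem InvPair.IsInverse.square {C : Type u} (_ : Category.{v} C) {X Y X' Y' : C}
    {e : InvPair X Y} {e' : InvPair X' Y'} (he : e.IsInverse) (he' : e'.IsInverse) {x : X ⟶ X'}
    {y : Y ⟶ Y'} (h : x ≫ e'.hom = e.hom ≫ y) : y ≫ e'.inv = e.inv ≫ x := by
  have : e.inv ≫ (x ≫ e'.hom) ≫ e'.inv = e.inv ≫ (e.hom ≫ y) ≫ e'.inv := by rw [h]
  rw [Category.assoc, he'.hom_inv, Category.comp_id, Category.assoc, ← Category.assoc e.inv,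
    he.inv_hom, Category.id_comp] at this
  exact this.symm

theorem square_comp {C : Type u} (_ : Category.{v} C) {X Y Z X' Y' Z' : C} {f : X ⟶ Y}
    {g : Y ⟶ Z} {f' : X' ⟶ Y'} {g' : Y' ⟶ Z'} {x : X ⟶ X'} {y : Y ⟶ Y'} {z : Z ⟶ Z'}
    (h : x ≫ f' = f ≫ y) (h' : y ≫ g' = g ≫ z) : x ≫ f' ≫ g' = (f ≫ g) ≫ z := by
  rw [← Category.assoc, h, Category.assoc, h', Category.assoc]

def TwoNat.id (R : TwoSuperfunctor A.toTwoSupercatData B.toTwoSupercatData) :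
    TwoNat R.toTwoSuperfunctorData R.toTwoSuperfunctorData where
  toTwoNatData := .id R.toTwoSuperfunctorData
  isTwoNat := by
    have hB := B.isTwoSupercat
    refine IsTwoNat.of_even ?_ ?_ (@Oplax.OplaxTrans.id A.Obj A.even B.Obj B.even _) ?_ ?_
    · intro a b f
      exact B.comp_mem (hB.runit_mem _) ((hB.lunit_inverse _).inv_mem (hB.hom _ _) (hB.lunit_mem _))
    · intro a b f g y
      exact square_comp (hB.hom _ _).category (hB.runit_naturality _)
        (InvPair.IsInverse.square (hB.hom _ _).category (hB.lunit_inverse _) (hB.lunit_inverse _)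
          (hB.lunit_naturality _))
    · rfl
    · intro a b f
      exact HEq.rfl

def TwoNat.vcomp {R S T : TwoSuperfunctor A.toTwoSupercatData B.toTwoSupercatData}
    (X : TwoNat R.toTwoSuperfunctorData S.toTwoSuperfunctorData)
    (Y : TwoNat S.toTwoSuperfunctorData T.toTwoSuperfunctorData) :
    TwoNat R.toTwoSuperfunctorData T.toTwoSuperfunctorData where
  toTwoNatData := X.toTwoNatData.vcomp Y.toTwoNatData
  isTwoNat := by
    have hB := B.isTwoSupercat
    refine IsTwoNat.of_even ?_ ?_
      (@Oplax.OplaxTrans.vcomp A.Obj A.even B.Obj B.even _ _ _ X.even Y.even) ?_ ?_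
    · intro a b f
      exact B.comp_mem ((hB.assoc_inverse _ _ _).inv_mem (hB.hom _ _) (hB.assoc_mem _ _ _))
        (B.comp_mem (B.hcomp_mem (X.isTwoNat.mem f) (B.id_mem _)) (B.comp_mem (hB.assoc_mem _ _ _)
          (B.comp_mem (B.hcomp_mem (B.id_mem _) (Y.isTwoNat.mem f))
            ((hB.assoc_inverse _ _ _).inv_mem (hB.hom _ _) (hB.assoc_mem _ _ _)))))
    · intro a b f g y
      have e1 := hB.assoc_naturality (R.map₂ y) (𝟙 (X.app b)) (𝟙 (Y.app b))
      have e2 := congrArg (fun z => B.hcomp z (𝟙 (Y.app b))) (X.isTwoNat.naturality₂ y)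
      have e3 := hB.assoc_naturality (𝟙 (X.app a)) (S.map₂ y) (𝟙 (Y.app b))
      have e4 := congrArg (fun z => B.hcomp (𝟙 (X.app a)) z) (Y.isTwoNat.naturality₂ y)
      have e5 := hB.assoc_naturality (𝟙 (X.app a)) (𝟙 (Y.app a)) (T.map₂ y)
      simp only [B.comp_hcomp_id, B.hcomp_id_comp, hB.hcomp_id] at e1 e2 e3 e4 e5
      exact square_comp (hB.hom _ _).category
        (InvPair.IsInverse.square (hB.hom _ _).category (hB.assoc_inverse _ _ _)
          (hB.assoc_inverse _ _ _) e1)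
        (square_comp (hB.hom _ _).category e2 (square_comp (hB.hom _ _).category e3
          (square_comp (hB.hom _ _).category e4
            (InvPair.IsInverse.square (hB.hom _ _).category (hB.assoc_inverse _ _ _)
              (hB.assoc_inverse _ _ _) e5))))
    · rfl
    · intro a b f
      exact HEq.rfl

def TwoNat.whiskerLeft (R : TwoSuperfunctor A.toTwoSupercatData B.toTwoSupercatData)
    {S T : TwoSuperfunctor B.toTwoSupercatData C.toTwoSupercatData}
    (X : TwoNat S.toTwoSuperfunctorData T.toTwoSuperfunctorData) :
    TwoNat (R.comp S).toTwoSuperfunctorData (R.comp T).toTwoSuperfunctorData where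
  toTwoNatData := .whiskerLeft R.toTwoSuperfunctorData X.toTwoNatData
  isTwoNat := by
    refine IsTwoNat.of_even (R := R.comp S) (S := R.comp T) (fun f => X.isTwoNat.mem (R.map f))
      (fun y => X.isTwoNat.naturality₂ (R.map₂ y))
      (@oplaxWhiskerLeft A.Obj A.even B.Obj B.even C.Obj C.even R.even _ _ X.even) ?_ ?_
    · rfl
    · intro a b f
      exact HEq.rfl

def TwoNat.whiskerRight {R S : TwoSuperfunctor A.toTwoSupercatData B.toTwoSupercatData}
    (X : TwoNat R.toTwoSuperfunctorData S.toTwoSuperfunctorData)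
    (T : TwoSuperfunctor B.toTwoSupercatData C.toTwoSupercatData) :
    TwoNat (R.comp T).toTwoSuperfunctorData (S.comp T).toTwoSuperfunctorData where
  toTwoNatData := X.toTwoNatData.whiskerRight T.toTwoSuperfunctorData
  isTwoNat := by
    have hC := C.isTwoSupercat
    have hT := T.isTwoSuperfunctor
    refine IsTwoNat.of_even (R := R.comp T) (S := S.comp T) ?_ ?_
      (@oplaxWhiskerRight A.Obj A.even B.Obj B.even C.Obj C.even _ _ X.even T.even) ?_ ?_
    · intro a b f
      exact C.comp_mem (hT.c_mem _ _) (C.comp_mem (hT.map₂_mem (X.isTwoNat.mem f))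
        ((hT.c_inverse _ _).inv_mem (hC.hom _ _) (hT.c_mem _ _)))
    · intro a b f g y
      have e1 := hT.c_naturality (R.map₂ y) (𝟙 (X.app b))
      have e2 := congrArg T.map₂ (X.isTwoNat.naturality₂ y)
      have e3 := hT.c_naturality (𝟙 (X.app a)) (S.map₂ y)
      simp only [hT.map₂_comp, hT.map₂_id] at e1 e2 e3
      exact square_comp (hC.hom _ _).category e1 (square_comp (hC.hom _ _).category e2
        (InvPair.IsInverse.square (hC.hom _ _).category (hT.c_inverse _ _) (hT.c_inverse _ _) e3))
    · rfl
    · intro a b f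
      exact HEq.rfl

end SuperNat

section Pi

/-- A `k`-linear 2-category: the morphism categories are `k`-linear and horizontal composition is
bilinear on 2-morphisms. -/
class LinearBicategory (k : Type t) [CommRing k] (B : Type u) [Bicategory.{w, v} B] where
  [preadditive : ∀ a b : B, Preadditive (a ⟶ b)]
  [linear : ∀ a b : B, Linear k (a ⟶ b)]
  whiskerLeft_add : ∀ {a b c : B} (f : a ⟶ b) {g h : b ⟶ c} (x y : g ⟶ h),
    f ◁ (x + y) = f ◁ x + f ◁ y
  whiskerLeft_smul : ∀ {a b c : B} (f : a ⟶ b) {g h : b ⟶ c} (r : k) (x : g ⟶ h),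
    f ◁ (r • x) = r • f ◁ x
  add_whiskerRight : ∀ {a b c : B} {f g : a ⟶ b} (x y : f ⟶ g) (h : b ⟶ c),
    (x + y) ▷ h = x ▷ h + y ▷ h
  smul_whiskerRight : ∀ {a b c : B} {f g : a ⟶ b} (r : k) (x : f ⟶ g) (h : b ⟶ c),
    (r • x) ▷ h = r • x ▷ h

attribute [reducible] LinearBicategory.preadditive LinearBicategory.linear
attribute [instance] LinearBicategory.preadditive LinearBicategory.linear

/-- The data of a Π-2-category: a `k`-linear 2-category with 1-morphisms `π_a` and 2-morphisms
`β_f` (from the composite usually written `π_b f` to the one usually written `f π_a`) and `ξ_a`. -/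
structure PiTwoCatData (k : Type t) [CommRing k] where
  Obj : Type u
  [bicat : Bicategory.{w, v} Obj]
  [lin : LinearBicategory k Obj]
  pi : ∀ a : Obj, a ⟶ a
  β : ∀ {a b : Obj} (f : a ⟶ b), InvPair (f ≫ pi b) (pi a ≫ f)
  ξ : ∀ a : Obj, InvPair (pi a ≫ pi a) (𝟙 a)

attribute [instance] PiTwoCatData.bicat PiTwoCatData.lin

/-- Laws of a Π-2-category: `β` and `ξ` are invertible, `(π, β)` is an object of the Drinfeld
center, `β_π = -1`, and `ξ_b f ξ_a⁻¹ = β_f π_a ∘ π_b β_f`, with the coherence maps of the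
2-category inserted. -/
structure IsPiTwoCat {k : Type t} [CommRing k] (A : PiTwoCatData.{w, v, u} k) : Prop where
  β_inverse : ∀ {a b : A.Obj} (f : a ⟶ b), (A.β f).IsInverse
  ξ_inverse : ∀ a : A.Obj, (A.ξ a).IsInverse
  β_naturality : ∀ {a b : A.Obj} {f g : a ⟶ b} (x : f ⟶ g),
    x ▷ A.pi b ≫ (A.β g).hom = (A.β f).hom ≫ A.pi a ◁ x
  β_comp : ∀ {a b c : A.Obj} (f : a ⟶ b) (g : b ⟶ c),
    (A.β (f ≫ g)).hom = (α_ f g (A.pi c)).hom ≫ f ◁ (A.β g).hom ≫ (α_ f (A.pi b) g).inv ≫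
      (A.β f).hom ▷ g ≫ (α_ (A.pi a) f g).hom
  β_id : ∀ a : A.Obj, (A.β (𝟙 a)).hom = (λ_ (A.pi a)).hom ≫ (ρ_ (A.pi a)).inv
  β_pi : ∀ a : A.Obj, (A.β (A.pi a)).hom = -𝟙 (A.pi a ≫ A.pi a)
  ξ_β : ∀ {a b : A.Obj} (f : a ⟶ b),
    (α_ f (A.pi b) (A.pi b)).hom ≫ f ◁ (A.ξ b).hom ≫ (ρ_ f).hom =
      (A.β f).hom ▷ A.pi b ≫ (α_ (A.pi a) f (A.pi b)).hom ≫ A.pi a ◁ (A.β f).hom ≫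
        (α_ (A.pi a) (A.pi a) f).inv ≫ (A.ξ a).hom ▷ f ≫ (λ_ f).hom

/-- A Π-2-category. -/
structure PiTwoCat (k : Type t) [CommRing k] extends PiTwoCatData.{w, v, u} k where
  isPiTwoCat : IsPiTwoCat toPiTwoCatData

variable {k : Type t} [CommRing k]

/-- The data of a Π-2-functor: a 2-functor with 2-morphisms `j`. The coherence maps usually
written `c` and `i` are the inverses of `mapComp` and `mapId`. -/
structure PiFunctorData (A B : PiTwoCatData.{w, v, u} k) extends Pseudofunctor A.Obj B.Obj where
  j : ∀ a : A.Obj, InvPair (B.pi (obj a)) (map (A.pi a))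

/-- Laws of a Π-2-functor. -/
structure IsPiFunctor {A B : PiTwoCatData.{w, v, u} k} (R : PiFunctorData A B) : Prop where
  map₂_add : ∀ {a b : A.Obj} {f g : a ⟶ b} (x y : f ⟶ g), R.map₂ (x + y) = R.map₂ x + R.map₂ y
  map₂_smul : ∀ {a b : A.Obj} {f g : a ⟶ b} (r : k) (x : f ⟶ g),
    R.map₂ (r • x) = r • R.map₂ x
  j_inverse : ∀ a : A.Obj, (R.j a).IsInverse
  j_β : ∀ {a b : A.Obj} (f : a ⟶ b),
    R.map f ◁ (R.j b).hom ≫ (R.mapComp f (A.pi b)).inv ≫ R.map₂ (A.β f).hom =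
      (B.β (R.map f)).hom ≫ (R.j a).hom ▷ R.map f ≫ (R.mapComp (A.pi a) f).inv
  j_ξ : ∀ a : A.Obj,
    ((R.j a).hom ▷ B.pi (R.obj a) ≫ R.map (A.pi a) ◁ (R.j a).hom) ≫
        (R.mapComp (A.pi a) (A.pi a)).inv ≫ R.map₂ (A.ξ a).hom =
      (B.ξ (R.obj a)).hom ≫ (R.mapId a).inv

/-- A Π-2-functor. -/
structure PiFunctor (A B : PiTwoCatData.{w, v, u} k) extends PiFunctorData A B where
  isPiFunctor : IsPiFunctor toPiFunctorData

/-- A 2-natural transformation between the 2-functors underlying two Π-2-functors. -/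
abbrev PiNatData {A B : PiTwoCatData.{w, v, u} k} (R S : PiFunctorData A B) :=
  Oplax.OplaxTrans R.toPseudofunctor.toOplax S.toPseudofunctor.toOplax

/-- The additional law of a Π-2-natural transformation. -/
def IsPiNat {A B : PiTwoCatData.{w, v, u} k} {R S : PiFunctorData A B} (X : PiNatData R S) :
    Prop :=
  ∀ a : A.Obj, (B.β (X.app a)).hom ≫ (R.j a).hom ▷ X.app a ≫ X.naturality (A.pi a) =
    X.app a ◁ (S.j a).hom

/-- A Π-2-natural transformation. -/
@[ext]
structure PiNat {A B : PiTwoCatData.{w, v, u} k} (R S : PiFunctorData A B) where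
  toNat : PiNatData R S
  isPiNat : IsPiNat toNat

theorem whiskerLeft_mapComp_inv {B C : Type u} [Bicategory.{w, v} B] [Bicategory.{w, v} C]
    (T : Pseudofunctor B C) {a b c : B} (f : a ⟶ b) {g h : b ⟶ c} (x : g ⟶ h) :
    T.map f ◁ T.map₂ x ≫ (T.mapComp f h).inv = (T.mapComp f g).inv ≫ T.map₂ (f ◁ x) := by
  rw [T.map₂_whisker_left, Iso.inv_hom_id_assoc]

theorem whiskerRight_mapComp_inv {B C : Type u} [Bicategory.{w, v} B] [Bicategory.{w, v} C]
    (T : Pseudofunctor B C) {a b c : B} {f g : a ⟶ b} (x : f ⟶ g) (h : b ⟶ c) :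
    T.map₂ x ▷ T.map h ≫ (T.mapComp g h).inv = (T.mapComp f h).inv ≫ T.map₂ (x ▷ h) := by
  rw [T.map₂_whisker_right, Iso.inv_hom_id_assoc]

/-- The identity Π-2-functor. -/
abbrev PiFunctorData.id (A : PiTwoCatData.{w, v, u} k) : PiFunctorData A A where
  toPseudofunctor := Pseudofunctor.id A.Obj
  j a := ⟨𝟙 (A.pi a), 𝟙 (A.pi a)⟩

/-- The composite of two Π-2-functors. -/
abbrev PiFunctorData.comp {A B C : PiTwoCatData.{w, v, u} k} (R : PiFunctorData A B)
    (S : PiFunctorData B C) : PiFunctorData A C where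
  toPseudofunctor := R.toPseudofunctor.comp S.toPseudofunctor
  j a := ⟨(S.j (R.obj a)).hom ≫ S.map₂ (R.j a).hom, S.map₂ (R.j a).inv ≫ (S.j (R.obj a)).inv⟩

def PiFunctor.id (A : PiTwoCatData.{w, v, u} k) : PiFunctor A A where
  toPiFunctorData := .id A
  isPiFunctor := by
    refine ⟨fun _ _ => rfl, fun _ _ => rfl, fun a => ⟨Category.id_comp _, Category.id_comp _⟩,
      ?_, ?_⟩
    · intro a b f
      have : f ◁ 𝟙 (A.pi b) ≫ 𝟙 (f ≫ A.pi b) ≫ (A.β f).hom =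
          (A.β f).hom ≫ 𝟙 (A.pi a) ▷ f ≫ 𝟙 (A.pi a ≫ f) := by simp
      exact this
    · intro a
      have : (𝟙 (A.pi a) ▷ A.pi a ≫ A.pi a ◁ 𝟙 (A.pi a)) ≫ 𝟙 (A.pi a ≫ A.pi a) ≫ (A.ξ a).hom =
          (A.ξ a).hom ≫ 𝟙 (𝟙 a) := by simp
      exact this

def PiFunctor.comp {A B C : PiTwoCatData.{w, v, u} k} (R : PiFunctor A B) (S : PiFunctor B C) :
    PiFunctor A C where
  toPiFunctorData := R.toPiFunctorData.comp S.toPiFunctorData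
  isPiFunctor := by
    have hR := R.isPiFunctor
    have hS := S.isPiFunctor
    refine ⟨?_, ?_, ?_, ?_, ?_⟩
    · intro a b f g x y
      exact (congrArg S.map₂ (hR.map₂_add x y)).trans (hS.map₂_add _ _)
    · intro a b f g r x
      exact (congrArg S.map₂ (hR.map₂_smul r x)).trans (hS.map₂_smul _ _)
    · intro a
      refine InvPair.IsInverse.comp Category.assoc Category.comp_id (hS.j_inverse _)
        (e' := ⟨S.map₂ (R.j a).hom, S.map₂ (R.j a).inv⟩) ⟨?_, ?_⟩
      · dsimp only
        rw [← S.map₂_comp, (hR.j_inverse a).hom_inv, S.map₂_id]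
      · dsimp only
        rw [← S.map₂_comp, (hR.j_inverse a).inv_hom, S.map₂_id]
    · intro a b f
      have e1 := congrArg S.map₂ (hR.j_β f)
      have e2 := hS.j_β (R.map f)
      have : S.map (R.map f) ◁ ((S.j (R.obj b)).hom ≫ S.map₂ (R.j b).hom) ≫
          ((S.mapComp (R.map f) (R.map (A.pi b))).inv ≫ S.map₂ (R.mapComp f (A.pi b)).inv) ≫
            S.map₂ (R.map₂ (A.β f).hom) =
          (C.β (S.map (R.map f))).hom ≫ ((S.j (R.obj a)).hom ≫ S.map₂ (R.j a).hom) ▷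
            S.map (R.map f) ≫ (S.mapComp (R.map (A.pi a)) (R.map f)).inv ≫
              S.map₂ (R.mapComp (A.pi a) f).inv := by
        have n1 := whiskerLeft_mapComp_inv S.toPseudofunctor (R.map f) (R.j b).hom
        have n2 := whiskerRight_mapComp_inv S.toPseudofunctor (R.j a).hom (R.map f)
        simp only [S.map₂_comp] at e1
        rw [Bicategory.whiskerLeft_comp, comp_whiskerRight]
        simp only [Category.assoc]
        rw [reassoc_of% n1, e1, reassoc_of% e2, reassoc_of% n2]
      exact this
    · intro a
      have e1 := congrArg S.map₂ (hR.j_ξ a)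
      have e2 := hS.j_ξ (R.obj a)
      have : (((S.j (R.obj a)).hom ≫ S.map₂ (R.j a).hom) ▷ C.pi (S.obj (R.obj a)) ≫
          S.map (R.map (A.pi a)) ◁ ((S.j (R.obj a)).hom ≫ S.map₂ (R.j a).hom)) ≫
          ((S.mapComp (R.map (A.pi a)) (R.map (A.pi a))).inv ≫
            S.map₂ (R.mapComp (A.pi a) (A.pi a)).inv) ≫ S.map₂ (R.map₂ (A.ξ a).hom) =
          (C.ξ (S.obj (R.obj a))).hom ≫ (S.mapId (R.obj a)).inv ≫ S.map₂ (R.mapId a).inv := by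
        have n1 := whiskerLeft_mapComp_inv S.toPseudofunctor (R.map (A.pi a)) (R.j a).hom
        have n2 := whiskerRight_mapComp_inv S.toPseudofunctor (R.j a).hom (B.pi (R.obj a))
        simp only [S.map₂_comp, Category.assoc] at e1 e2
        rw [Bicategory.whiskerLeft_comp, comp_whiskerRight]
        simp only [Category.assoc]
        rw [reassoc_of% n1, ← whisker_exchange_assoc, reassoc_of% n2, e1, reassoc_of% e2]
      exact this

theorem PiNat.whiskerRight_aux {B C : Type u} [Bicategory.{w, v} B] [Bicategory.{w, v} C]
    (T : Pseudofunctor B C) {a b : B} {X : a ⟶ b} {p r : a ⟶ a} {q s : b ⟶ b}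
    {P : T.obj a ⟶ T.obj a} {Q : T.obj b ⟶ T.obj b} {β : X ≫ q ⟶ p ≫ X}
    {i : p ⟶ r} {j : q ⟶ s} {x : r ≫ X ⟶ X ≫ s} {β' : T.map X ≫ Q ⟶ P ≫ T.map X}
    {i' : P ⟶ T.map p} {j' : Q ⟶ T.map q}
    (h : β ≫ i ▷ X ≫ x = X ◁ j)
    (h' : T.map X ◁ j' ≫ (T.mapComp X q).inv ≫ T.map₂ β =
      β' ≫ i' ▷ T.map X ≫ (T.mapComp p X).inv) :
    β' ≫ (i' ≫ T.map₂ i) ▷ T.map X ≫ (T.mapComp r X).inv ≫ T.map₂ x ≫ (T.mapComp X s).hom =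
      T.map X ◁ (j' ≫ T.map₂ j) := by
  have e1 := congrArg T.map₂ h
  have n1 := whiskerLeft_mapComp_inv T X j
  have n2 := whiskerRight_mapComp_inv T i X
  simp only [T.map₂_comp] at e1
  rw [← cancel_mono (T.mapComp X s).inv]
  rw [Bicategory.whiskerLeft_comp, comp_whiskerRight]
  simp only [Category.assoc, Iso.hom_inv_id, Category.comp_id]
  rw [n1, ← e1, reassoc_of% h', reassoc_of% n2]

theorem PiNat.vcomp_aux {B : Type u} [Bicategory.{w, v} B] {a b c : B} {X : a ⟶ b} {Y : b ⟶ c}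
    {p p' : a ⟶ a} {q q' : b ⟶ b} {r r' : c ⟶ c} {i : p ⟶ p'} {j : q ⟶ q'} {l : r ⟶ r'}
    {x : p' ≫ X ⟶ X ≫ q'} {y : q' ≫ Y ⟶ Y ≫ r'} {β : X ≫ q ⟶ p ≫ X} {β' : Y ≫ r ⟶ q ≫ Y}
    (h : β ≫ i ▷ X ≫ x = X ◁ j) (h' : β' ≫ j ▷ Y ≫ y = Y ◁ l) :
    ((α_ X Y r).hom ≫ X ◁ β' ≫ (α_ X q Y).inv ≫ β ▷ Y ≫ (α_ p X Y).hom) ≫ i ▷ (X ≫ Y) ≫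
        (α_ p' X Y).inv ≫ x ▷ Y ≫ (α_ X q' Y).hom ≫ X ◁ y ≫ (α_ X Y r').inv =
      (X ≫ Y) ◁ l := by
  have e1 : β ▷ Y ≫ i ▷ X ▷ Y ≫ x ▷ Y = (X ◁ j) ▷ Y := by
    rw [← h, comp_whiskerRight, comp_whiskerRight]
  have e2 : X ◁ β' ≫ X ◁ j ▷ Y ≫ X ◁ y = X ◁ Y ◁ l := by
    rw [← h', Bicategory.whiskerLeft_comp, Bicategory.whiskerLeft_comp]
  simp only [whisker_assoc, comp_whiskerLeft, whiskerRight_comp, Category.assoc,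
    Iso.hom_inv_id_assoc] at e1 ⊢
  rw [reassoc_of% e1]
  simp only [Iso.inv_hom_id_assoc]
  rw [reassoc_of% e2]

def PiNat.id {A B : PiTwoCatData.{w, v, u} k} (hB : IsPiTwoCat B) (R : PiFunctorData A B) :
    PiNat R R where
  toNat := Oplax.OplaxTrans.id _
  isPiNat a := by
    have : (B.β (𝟙 (R.obj a))).hom ≫ (R.j a).hom ▷ 𝟙 (R.obj a) ≫
        (ρ_ (R.map (A.pi a))).hom ≫ (λ_ (R.map (A.pi a))).inv = 𝟙 (R.obj a) ◁ (R.j a).hom := by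
      rw [hB.β_id]; simp
    exact this

theorem PiNat.whiskerLeft_aux {B : Type u} [Bicategory.{w, v} B] {a b : B} {X : a ⟶ b}
    {p p' p'' : a ⟶ a} {q q' q'' : b ⟶ b} {i : p ⟶ p'} {i' : p' ⟶ p''} {j : q ⟶ q'}
    {j' : q' ⟶ q''} {x : p' ≫ X ⟶ X ≫ q'} {x' : p'' ≫ X ⟶ X ≫ q''} {β : X ≫ q ⟶ p ≫ X}
    (h : β ≫ i ▷ X ≫ x = X ◁ j) (h' : i' ▷ X ≫ x' = x ≫ X ◁ j') :
    β ≫ (i ≫ i') ▷ X ≫ x' = X ◁ (j ≫ j') := by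
  rw [Bicategory.whiskerLeft_comp, comp_whiskerRight, Category.assoc, h', reassoc_of% h]

/-- Vertical composition of Π-2-natural transformations. -/
def PiNat.vcomp {A B : PiTwoCatData.{w, v, u} k} (hB : IsPiTwoCat B) {R S T : PiFunctorData A B}
    (X : PiNat R S) (Y : PiNat S T) : PiNat R T where
  toNat := X.toNat.vcomp Y.toNat
  isPiNat a := by
    have e := PiNat.vcomp_aux (X.isPiNat a) (Y.isPiNat a)
    rw [← hB.β_comp] at e
    exact e

/-- Whiskering of a Π-2-natural transformation with a Π-2-functor on the source side. -/
def PiNat.whiskerLeft {A B C : PiTwoCatData.{w, v, u} k} (R : PiFunctorData A B)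
    {S T : PiFunctorData B C} (X : PiNat S T) : PiNat (R.comp S) (R.comp T) where
  toNat := oplaxWhiskerLeft R.toPseudofunctor X.toNat
  isPiNat a := PiNat.whiskerLeft_aux (X.isPiNat (R.obj a))
    (X.toNat.naturality_naturality (R.j a).hom)

/-- Whiskering of a Π-2-natural transformation with a Π-2-functor on the target side. -/
def PiNat.whiskerRight {A B C : PiTwoCatData.{w, v, u} k} {R S : PiFunctorData A B}
    (X : PiNat R S) (T : PiFunctor B C) :
    PiNat (R.comp T.toPiFunctorData) (S.comp T.toPiFunctorData) where
  toNat := oplaxWhiskerRight X.toNat T.toPseudofunctor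
  isPiNat a := PiNat.whiskerRight_aux T.toPseudofunctor (X.isPiNat a)
    (T.isPiFunctor.j_β (X.toNat.app a))

end Pi

section TwoCategories

/-- Objects, 1-morphisms forming a category, and 2-morphisms, with identities, vertical
composition and whiskering. No law involving 2-morphisms is imposed: 2-natural transformations
with non-invertible components satisfy the laws of a strict 2-category only up to modification. -/
class PreTwoCategory (C : Type u) extends Category.{v} C where
  Hom₂ : ∀ {X Y : C}, (X ⟶ Y) → (X ⟶ Y) → Type w
  id₂ : ∀ {X Y : C} (f : X ⟶ Y), Hom₂ f f
  vcomp : ∀ {X Y : C} {f g h : X ⟶ Y}, Hom₂ f g → Hom₂ g h → Hom₂ f h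
  whiskerLeft : ∀ {X Y Z : C} (f : X ⟶ Y) {g h : Y ⟶ Z}, Hom₂ g h → Hom₂ (f ≫ g) (f ≫ h)
  whiskerRight : ∀ {X Y Z : C} {f g : X ⟶ Y}, Hom₂ f g → ∀ h : Y ⟶ Z, Hom₂ (f ≫ h) (g ≫ h)

/-- The data of a strict 2-functor. -/
structure TwoPrefunctor (C D : Type*) [PreTwoCategory C] [PreTwoCategory D] where
  obj : C → D
  map : ∀ {X Y : C}, (X ⟶ Y) → (obj X ⟶ obj Y)
  map₂ : ∀ {X Y : C} {f g : X ⟶ Y},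
    PreTwoCategory.Hom₂ f g → PreTwoCategory.Hom₂ (map f) (map g)

namespace TwoPrefunctor

open PreTwoCategory

variable {C D E : Type*} [PreTwoCategory C] [PreTwoCategory D] [PreTwoCategory E]

/-- A strict 2-functor preserves all the operations strictly. -/
structure IsStrict (F : TwoPrefunctor C D) : Prop where
  map_id : ∀ X : C, F.map (𝟙 X) = 𝟙 (F.obj X)
  map_comp : ∀ {X Y Z : C} (f : X ⟶ Y) (g : Y ⟶ Z), F.map (f ≫ g) = F.map f ≫ F.map g
  map₂_id : ∀ {X Y : C} (f : X ⟶ Y), F.map₂ (id₂ f) = id₂ (F.map f)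
  map₂_vcomp : ∀ {X Y : C} {f g h : X ⟶ Y} (x : Hom₂ f g) (y : Hom₂ g h),
    F.map₂ (vcomp x y) = vcomp (F.map₂ x) (F.map₂ y)
  map₂_whiskerLeft : ∀ {X Y Z : C} (f : X ⟶ Y) {g h : Y ⟶ Z} (x : Hom₂ g h),
    HEq (F.map₂ (whiskerLeft f x)) (whiskerLeft (F.map f) (F.map₂ x))
  map₂_whiskerRight : ∀ {X Y Z : C} {f g : X ⟶ Y} (x : Hom₂ f g) (h : Y ⟶ Z),
    HEq (F.map₂ (whiskerRight x h)) (whiskerRight (F.map₂ x) (F.map h))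

/-- The identity. -/
def id (C : Type*) [PreTwoCategory C] : TwoPrefunctor C C where
  obj X := X
  map f := f
  map₂ x := x

/-- Composition, in diagrammatic order. -/
def comp (F : TwoPrefunctor C D) (G : TwoPrefunctor D E) : TwoPrefunctor C E where
  obj X := G.obj (F.obj X)
  map f := G.map (F.map f)
  map₂ x := G.map₂ (F.map₂ x)

/-- A strict 2-natural isomorphism: invertible components, strictly natural with respect to
1-morphisms and 2-morphisms. -/
structure StrictNatIso (F G : TwoPrefunctor C D) where
  app : ∀ X : C, F.obj X ≅ G.obj X
  naturality : ∀ {X Y : C} (f : X ⟶ Y), F.map f ≫ (app Y).hom = (app X).hom ≫ G.map f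
  naturality₂ : ∀ {X Y : C} {f g : X ⟶ Y} (x : Hom₂ f g),
    HEq (whiskerRight (F.map₂ x) (app Y).hom) (whiskerLeft (app X).hom (G.map₂ x))

end TwoPrefunctor

variable {k : Type t} [CommRing k]

/-- The 2-supercategory underlying a Π-2-supercategory. -/
abbrev PiTwoSupercat.toTwoSupercat (A : PiTwoSupercat.{w, v, u} k) : TwoSupercat.{w, v, u} k :=
  ⟨A.toTwoSupercatData, A.isPiTwoSupercat.isTwoSupercat⟩

theorem TwoSuperfunctor.ext' {A B : TwoSupercatData.{w, v, u} k} {obj : A.Obj → B.Obj}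
    {map : ∀ {a b : A.Obj}, (a ⟶ b) → (obj a ⟶ obj b)}
    {map₂ : ∀ {a b : A.Obj} {f g : a ⟶ b}, (f ⟶ g) → (map f ⟶ map g)}
    {c c' : ∀ {a b c : A.Obj} (f : a ⟶ b) (g : b ⟶ c), InvPair (map f ≫ map g) (map (f ≫ g))}
    {i i' : ∀ a : A.Obj, InvPair (𝟙 (obj a)) (map (𝟙 a))}
    {h : IsTwoSuperfunctor ⟨obj, map, map₂, c, i⟩} {h' : IsTwoSuperfunctor ⟨obj, map, map₂, c', i'⟩}
    (hc : ∀ {a b d : A.Obj} (f : a ⟶ b) (g : b ⟶ d), c f g = c' f g) (hi : ∀ a, i a = i' a) :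
    (⟨⟨obj, map, map₂, c, i⟩, h⟩ : TwoSuperfunctor A B) = ⟨⟨obj, map, map₂, c', i'⟩, h'⟩ := by
  obtain rfl : @c = @c' := by funext a b d f g; exact hc f g
  obtain rfl : i = i' := funext hi
  rfl

theorem PiFunctor.ext' {A B : PiTwoCatData.{w, v, u} k} {R S : PiFunctor A B}
    (h : R.toPrelaxFunctor = S.toPrelaxFunctor) (hId : ∀ a, HEq (R.mapId a).hom (S.mapId a).hom)
    (hComp : ∀ {a b c : A.Obj} (f : a ⟶ b) (g : b ⟶ c),
      HEq (R.mapComp f g).hom (S.mapComp f g).hom)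
    (hj : ∀ a, HEq (R.j a).hom (S.j a).hom) (hj' : ∀ a, HEq (R.j a).inv (S.j a).inv) : R = S := by
  obtain ⟨⟨⟨P, mapId, mapComp, _, _, _, _, _⟩, j⟩, _⟩ := R
  obtain ⟨⟨⟨Q, mapId', mapComp', _, _, _, _, _⟩, j'⟩, _⟩ := S
  dsimp only at h
  subst h
  obtain rfl : mapId = mapId' := by funext a; exact Iso.ext (eq_of_heq (hId a))
  obtain rfl : @mapComp = @mapComp' := by
    funext a b c f g; exact Iso.ext (eq_of_heq (hComp f g))
  obtain rfl : j = j' := by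
    funext a; exact InvPair.ext (eq_of_heq (hj a)) (eq_of_heq (hj' a))
  rfl

/-- Π-2-supercategories, 2-superfunctors and 2-natural transformations. -/
instance : PreTwoCategory.{max w v u} (PiTwoSupercat.{w, v, u} k) where
  Hom A B := TwoSuperfunctor A.toTwoSupercat.toTwoSupercatData B.toTwoSupercat.toTwoSupercatData
  id A := TwoSuperfunctor.id A.toTwoSupercat
  comp {A B C} R S := TwoSuperfunctor.comp (A := A.toTwoSupercat) (B := B.toTwoSupercat)
    (C := C.toTwoSupercat) R S
  id_comp {A B} R := by
    have hB := B.isPiTwoSupercat.isTwoSupercat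
    have h := R.isTwoSuperfunctor
    refine TwoSuperfunctor.ext' (fun f g => InvPair.ext ?_ ?_) (fun a => InvPair.ext ?_ ?_)
    · exact (congrArg _ (h.map₂_id _)).trans ((hB.hom _ _).comp_id _)
    · exact (congrArg (· ≫ (R.c f g).inv) (h.map₂_id _)).trans ((hB.hom _ _).id_comp _)
    · exact (congrArg _ (h.map₂_id _)).trans ((hB.hom _ _).comp_id _)
    · exact (congrArg (· ≫ (R.i a).inv) (h.map₂_id _)).trans ((hB.hom _ _).id_comp _)
  comp_id {A B} R := by
    have hB := B.isPiTwoSupercat.isTwoSupercat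
    refine TwoSuperfunctor.ext' (fun f g => InvPair.ext ?_ ?_) (fun a => InvPair.ext ?_ ?_)
    · exact (hB.hom _ _).id_comp _
    · exact (hB.hom _ _).comp_id _
    · exact (hB.hom _ _).id_comp _
    · exact (hB.hom _ _).comp_id _
  assoc {A B C D} R S T := by
    have hD := D.isPiTwoSupercat.isTwoSupercat
    have h := T.isTwoSuperfunctor
    refine TwoSuperfunctor.ext' (fun f g => InvPair.ext ?_ ?_) (fun a => InvPair.ext ?_ ?_)
    · exact (congrArg _ (h.map₂_comp _ _)).trans ((hD.hom _ _).assoc _ _ _).symm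
    · exact (congrArg (· ≫ (T.c _ _).inv) (h.map₂_comp _ _)).trans ((hD.hom _ _).assoc _ _ _)
    · exact (congrArg _ (h.map₂_comp _ _)).trans ((hD.hom _ _).assoc _ _ _).symm
    · exact (congrArg (· ≫ (T.i _).inv) (h.map₂_comp _ _)).trans ((hD.hom _ _).assoc _ _ _)
  Hom₂ R S := TwoNat R.toTwoSuperfunctorData S.toTwoSuperfunctorData
  id₂ {A B} R := TwoNat.id (A := A.toTwoSupercat) (B := B.toTwoSupercat) R
  vcomp {A B R S T} X Y := TwoNat.vcomp (A := A.toTwoSupercat) (B := B.toTwoSupercat)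
    (R := R) (S := S) (T := T) X Y
  whiskerLeft {A B C} R {S T} X := TwoNat.whiskerLeft (A := A.toTwoSupercat)
    (B := B.toTwoSupercat) (C := C.toTwoSupercat) R (S := S) (T := T) X
  whiskerRight {A B C R S} X T := TwoNat.whiskerRight (A := A.toTwoSupercat)
    (B := B.toTwoSupercat) (C := C.toTwoSupercat) (R := R) (S := S) X T

/-- Π-2-categories, Π-2-functors and Π-2-natural transformations. -/
instance : PreTwoCategory.{max w v u} (PiTwoCat.{w, v, u} k) where
  Hom A B := PiFunctor A.toPiTwoCatData B.toPiTwoCatData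
  id A := PiFunctor.id A.toPiTwoCatData
  comp R S := R.comp S
  id_comp R := PiFunctor.ext' rfl
    (fun a => heq_of_eq ((congrArg (· ≫ (R.mapId a).hom) (R.map₂_id _)).trans (Category.id_comp _)))
    (fun f g => heq_of_eq
      ((congrArg (· ≫ (R.mapComp f g).hom) (R.map₂_id _)).trans (Category.id_comp _)))
    (fun a => heq_of_eq ((congrArg ((R.j a).hom ≫ ·) (R.map₂_id _)).trans (Category.comp_id _)))
    (fun a => heq_of_eq ((congrArg (· ≫ (R.j a).inv) (R.map₂_id _)).trans (Category.id_comp _)))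
  comp_id R := PiFunctor.ext' rfl (fun a => heq_of_eq (Category.comp_id _))
    (fun f g => heq_of_eq (Category.comp_id _)) (fun a => heq_of_eq (Category.id_comp _))
    (fun a => heq_of_eq (Category.comp_id _))
  assoc R S T := PiFunctor.ext' rfl
    (fun a => heq_of_eq ((congrArg (· ≫ (T.mapId _).hom) (T.map₂_comp _ _)).trans
      (Category.assoc _ _ _)))
    (fun f g => heq_of_eq ((congrArg (· ≫ (T.mapComp _ _).hom) (T.map₂_comp _ _)).trans
      (Category.assoc _ _ _)))
    (fun a => heq_of_eq ((congrArg ((T.j _).hom ≫ ·) (T.map₂_comp _ _)).trans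
      (Category.assoc _ _ _).symm))
    (fun a => heq_of_eq ((congrArg (· ≫ (T.j _).inv) (T.map₂_comp _ _)).trans
      (Category.assoc _ _ _)))
  Hom₂ R S := PiNat R.toPiFunctorData S.toPiFunctorData
  id₂ {_ B} R := PiNat.id B.isPiTwoCat R.toPiFunctorData
  vcomp {_ B _ _ _} X Y := PiNat.vcomp B.isPiTwoCat X Y
  whiskerLeft R _ _ X := PiNat.whiskerLeft R.toPiFunctorData X
  whiskerRight X T := PiNat.whiskerRight X T

end TwoCategories

section Underlying

variable {k : Type t} [CommRing k]

/-- Even 2-morphisms in opposite directions. -/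
@[reducible]
def TwoSupercat.evenPair (A : TwoSupercat.{w, v, u} k) {a b : A.Obj} {f g : a ⟶ b}
    (x : A.EvenHom f g) (y : A.EvenHom g f) :
    @InvPair (a ⟶ b) (A.evenCategory a b).toCategoryStruct f g :=
  @InvPair.mk (a ⟶ b) (A.evenCategory a b).toCategoryStruct f g x y

@[reducible]
def TwoSupercat.evenPreadditive (A : TwoSupercat.{w, v, u} k) (a b : A.Obj) :
    @Preadditive (a ⟶ b) (A.evenCategory a b) :=
  letI := A.evenCategory a b
  { homGroup := fun f g => (inferInstance : AddCommGroup (A.EvenHom f g))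
    add_comp := fun _ _ _ x x' y => TwoSupercat.EvenHom.ext
      ((A.isTwoSupercat.hom _ _).add_comp (Subtype.val x) (Subtype.val x') (Subtype.val y))
    comp_add := fun _ _ _ x y y' => TwoSupercat.EvenHom.ext
      ((A.isTwoSupercat.hom _ _).comp_add (Subtype.val x) (Subtype.val y) (Subtype.val y')) }

/-- The underlying 2-category of a 2-supercategory is `k`-linear. -/
@[reducible]
def TwoSupercat.evenLinear (A : TwoSupercat.{w, v, u} k) : @LinearBicategory k _ A.Obj A.even :=
  letI := A.even
  letI := A.evenPreadditive
  { preadditive := A.evenPreadditive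
    linear := fun _ _ =>
      { homModule := fun f g => (inferInstance : Module k (A.EvenHom f g))
        smul_comp := fun _ _ _ r x y => TwoSupercat.EvenHom.ext
          ((A.isTwoSupercat.hom _ _).smul_comp r (Subtype.val x) (Subtype.val y))
        comp_smul := fun _ _ _ x r y => TwoSupercat.EvenHom.ext
          ((A.isTwoSupercat.hom _ _).comp_smul r (Subtype.val x) (Subtype.val y)) }
    whiskerLeft_add := fun f _ _ x y => TwoSupercat.EvenHom.ext
      (A.isTwoSupercat.hcomp_add (TwoSupercat.EvenHom.id f).1 (Subtype.val x) (Subtype.val y))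
    whiskerLeft_smul := fun f _ _ r x => TwoSupercat.EvenHom.ext
      (A.isTwoSupercat.hcomp_smul r (TwoSupercat.EvenHom.id f).1 (Subtype.val x))
    add_whiskerRight := fun x y h => TwoSupercat.EvenHom.ext
      (A.isTwoSupercat.add_hcomp (Subtype.val x) (Subtype.val y) (TwoSupercat.EvenHom.id h).1)
    smul_whiskerRight := fun r x h => TwoSupercat.EvenHom.ext
      (A.isTwoSupercat.smul_hcomp r (Subtype.val x) (TwoSupercat.EvenHom.id h).1) }

namespace PiTwoSupercat

variable (A : PiTwoSupercat.{w, v, u} k) {a b : A.Obj}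

theorem zeta_inv_mem (a : A.Obj) : (A.zeta a).inv ∈ A.deg _ _ 1 :=
  (A.isPiTwoSupercat.zeta_inverse a).inv_mem (A.isPiTwoSupercat.isTwoSupercat.hom a a)
    (A.isPiTwoSupercat.zeta_mem a)

theorem lunit_inv_mem (f : a ⟶ b) : (A.lunit f).inv ∈ A.deg _ _ 0 :=
  (A.isPiTwoSupercat.isTwoSupercat.lunit_inverse f).inv_mem
    (A.isPiTwoSupercat.isTwoSupercat.hom a b) (A.isPiTwoSupercat.isTwoSupercat.lunit_mem f)

theorem runit_inv_mem (f : a ⟶ b) : (A.runit f).inv ∈ A.deg _ _ 0 :=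
  (A.isPiTwoSupercat.isTwoSupercat.runit_inverse f).inv_mem
    (A.isPiTwoSupercat.isTwoSupercat.hom a b) (A.isPiTwoSupercat.isTwoSupercat.runit_mem f)

/-- `β_f = -ζ_b f ζ_a⁻¹`. -/
def betaHom (f : a ⟶ b) : A.toTwoSupercat.EvenHom (f ≫ A.pi b) (A.pi a ≫ f) :=
  ⟨-((A.lunit (f ≫ A.pi b)).inv ≫ A.hcomp (A.zeta a).inv (A.hcomp (𝟙 f) (A.zeta b).hom) ≫
    A.hcomp (𝟙 (A.pi a)) (A.runit f).hom), by
      have hA := A.isPiTwoSupercat.isTwoSupercat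
      have h1 := hA.hcomp_mem (A.zeta_inv_mem a)
        (hA.hcomp_mem ((hA.hom a b).id_mem f) (A.isPiTwoSupercat.zeta_mem b))
      have h2 := hA.hcomp_mem ((hA.hom a a).id_mem (A.pi a)) (hA.runit_mem f)
      exact Submodule.neg_mem _
        ((hA.hom a b).comp_mem (A.lunit_inv_mem _) ((hA.hom a b).comp_mem h1 h2))⟩

/-- `β_f⁻¹ = ζ_b⁻¹ f ζ_a`. -/
def betaInv (f : a ⟶ b) : A.toTwoSupercat.EvenHom (A.pi a ≫ f) (f ≫ A.pi b) :=
  ⟨A.hcomp (𝟙 (A.pi a)) (A.runit f).inv ≫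
    A.hcomp (A.zeta a).hom (A.hcomp (𝟙 f) (A.zeta b).inv) ≫ (A.lunit (f ≫ A.pi b)).hom, by
      have hA := A.isPiTwoSupercat.isTwoSupercat
      have h1 := hA.hcomp_mem (A.isPiTwoSupercat.zeta_mem a)
        (hA.hcomp_mem ((hA.hom a b).id_mem f) (A.zeta_inv_mem b))
      have h2 := hA.hcomp_mem ((hA.hom a a).id_mem (A.pi a)) (A.runit_inv_mem f)
      exact (hA.hom a b).comp_mem h2 ((hA.hom a b).comp_mem h1 (hA.lunit_mem _))⟩

/-- `ξ_a = ζ_a ζ_a`. -/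
def xiHom (a : A.Obj) : A.toTwoSupercat.EvenHom (A.pi a ≫ A.pi a) (𝟙 a) :=
  ⟨A.hcomp (A.zeta a).hom (A.zeta a).hom ≫ (A.lunit (𝟙 a)).hom, by
    have hA := A.isPiTwoSupercat.isTwoSupercat
    exact (hA.hom a a).comp_mem
      (hA.hcomp_mem (A.isPiTwoSupercat.zeta_mem a) (A.isPiTwoSupercat.zeta_mem a))
      (hA.lunit_mem _)⟩

/-- `ξ_a⁻¹ = -ζ_a⁻¹ ζ_a⁻¹`. -/
def xiInv (a : A.Obj) : A.toTwoSupercat.EvenHom (𝟙 a) (A.pi a ≫ A.pi a) :=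
  ⟨-((A.lunit (𝟙 a)).inv ≫ A.hcomp (A.zeta a).inv (A.zeta a).inv), by
    have hA := A.isPiTwoSupercat.isTwoSupercat
    exact Submodule.neg_mem _ ((hA.hom a a).comp_mem (A.lunit_inv_mem _)
      (hA.hcomp_mem (A.zeta_inv_mem a) (A.zeta_inv_mem a)))⟩

/-- The data of the underlying Π-2-category of a Π-2-supercategory. -/
@[reducible]
def underData : PiTwoCatData.{w, v, u} k :=
  letI := A.toTwoSupercat.even
  letI := A.toTwoSupercat.evenLinear
  { Obj := A.Obj
    pi := A.pi
    β := fun {a b} f => A.toTwoSupercat.evenPair (A.betaHom f) (A.betaInv f)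
    ξ := fun a => A.toTwoSupercat.evenPair (A.xiHom a) (A.xiInv a) }

variable {A} {B : PiTwoSupercat.{w, v, u} k}

/-- `j_a : π_{R a} ⟶ R π_a` is such that `R ζ_a ∘ j_a = i ∘ ζ_{R a}`. -/
def jHom (R : A ⟶ B) (a : A.Obj) :
    B.toTwoSupercat.EvenHom (B.pi (R.obj a)) (R.map (A.pi a)) :=
  ⟨(B.zeta (R.obj a)).hom ≫ (R.i a).hom ≫ R.map₂ (A.zeta a).inv, by
    have hB := B.isPiTwoSupercat.isTwoSupercat.hom (R.obj a) (R.obj a)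
    exact hB.comp_mem (B.isPiTwoSupercat.zeta_mem _) (hB.comp_mem (R.isTwoSuperfunctor.i_mem a)
      (R.isTwoSuperfunctor.map₂_mem (A.zeta_inv_mem a)))⟩

/-- The inverse of `j_a`. -/
def jInv (R : A ⟶ B) (a : A.Obj) :
    B.toTwoSupercat.EvenHom (R.map (A.pi a)) (B.pi (R.obj a)) :=
  ⟨R.map₂ (A.zeta a).hom ≫ (R.i a).inv ≫ (B.zeta (R.obj a)).inv, by
    have hB := B.isPiTwoSupercat.isTwoSupercat.hom (R.obj a) (R.obj a)
    exact hB.comp_mem (R.isTwoSuperfunctor.map₂_mem (A.isPiTwoSupercat.zeta_mem a))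
      (hB.comp_mem ((R.isTwoSuperfunctor.i_inverse a).inv_mem hB (R.isTwoSuperfunctor.i_mem a))
        (B.zeta_inv_mem _))⟩

/-- The data of the Π-2-functor underlying a 2-superfunctor: its restriction to even
2-morphisms, with the 2-morphisms `j`. -/
@[reducible]
def underMap (R : A ⟶ B) : PiFunctorData A.underData B.underData where
  toPseudofunctor := TwoSuperfunctor.even (A := A.toTwoSupercat) (B := B.toTwoSupercat) R
  j a := B.toTwoSupercat.evenPair (jHom R a) (jInv R a)

/-- The data of the Π-2-natural transformation underlying a 2-natural transformation. -/
@[reducible]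
def underNat {R S : A ⟶ B} (X : PreTwoCategory.Hom₂ R S) :
    PiNatData (underMap R) (underMap S) :=
  TwoNat.even (A := A.toTwoSupercat) (B := B.toTwoSupercat) (R := R) (S := S) X

end PiTwoSupercat

end Underlying

section Associated

variable {k : Type t} [CommRing k]

namespace PiTwoCatData

variable (A : PiTwoCatData.{w, v, u} k) {a b c : A.Obj}

/-- A 2-morphism `f ⟶ g` of the associated 2-supercategory is a pair of an even part, a 2-morphism
`f ⟶ g`, and an odd part, a 2-morphism from `f` to the composite usually written `π_b g`. -/
abbrev HatHom (f g : a ⟶ b) : Type w := (f ⟶ g) × (f ⟶ g ≫ A.pi b)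

/-- `ξ_b g`, from the composite usually written `π_b π_b g` to `g`. -/
def xiWhisker (g : a ⟶ b) : (g ≫ A.pi b) ≫ A.pi b ⟶ g :=
  (α_ g (A.pi b) (A.pi b)).hom ≫ g ◁ (A.ξ b).hom ≫ (ρ_ g).hom

/-- `(β_k)⁻¹ h`, from the composite usually written `k π_b h` to the one written `π_c k h`. -/
def betaWhisker (h : a ⟶ b) (k : b ⟶ c) : (h ≫ A.pi b) ≫ k ⟶ (h ≫ k) ≫ A.pi c :=
  (α_ h (A.pi b) k).hom ≫ h ◁ (A.β k).inv ≫ (α_ h k (A.pi c)).inv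

variable {A}

/-- Vertical composition; the composite of two odd 2-morphisms `x` and `y` is
`-ξ_b h ∘ π_b y ∘ x`. -/
def hatComp {f g h : a ⟶ b} (x : A.HatHom f g) (y : A.HatHom g h) : A.HatHom f h :=
  (x.1 ≫ y.1 - x.2 ≫ y.2 ▷ A.pi b ≫ A.xiWhisker h, x.1 ≫ y.2 + x.2 ≫ y.1 ▷ A.pi b)

/-- Horizontal composition; the composite of two odd 2-morphisms `x` and `y` is
`ξ_c k h ∘ π_c (β_k)⁻¹ h ∘ y x`. -/
def hatHcomp {f h : a ⟶ b} {g k : b ⟶ c} (x : A.HatHom f h) (y : A.HatHom g k) :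
    A.HatHom (f ≫ g) (h ≫ k) :=
  (x.1 ▷ g ≫ h ◁ y.1 +
      (x.2 ▷ g ≫ (h ≫ A.pi b) ◁ y.2) ≫ (α_ (h ≫ A.pi b) k (A.pi c)).inv ≫
        A.betaWhisker h k ▷ A.pi c ≫ A.xiWhisker (h ≫ k),
    (x.1 ▷ g ≫ h ◁ y.2) ≫ (α_ h k (A.pi c)).inv +
      (x.2 ▷ g ≫ (h ≫ A.pi b) ◁ y.1) ≫ A.betaWhisker h k)

variable (A)

/-- The 1-morphisms and the 2-morphisms of the associated 2-supercategory. -/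
@[reducible]
def hatHomStruct (a b : A.Obj) : CategoryStruct.{w} (a ⟶ b) where
  Hom f g := A.HatHom f g
  id f := (𝟙 f, 0)
  comp x y := hatComp x y

/-- Isomorphisms viewed as pairs of even 2-morphisms. -/
@[reducible]
def hatIso {a b : A.Obj} {f g : a ⟶ b} (e : f ≅ g) :
    @InvPair (a ⟶ b) (A.hatHomStruct a b) f g :=
  @InvPair.mk (a ⟶ b) (A.hatHomStruct a b) f g ((e.hom, 0) : A.HatHom f g)
    ((e.inv, 0) : A.HatHom g f)

/-- The data of the associated Π-2-supercategory of a Π-2-category; `ζ_a` is `1_{π_a}` viewed as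
an odd 2-morphism. -/
@[reducible]
def hatData : PiTwoSupercatData.{w, v, u} k where
  Obj := A.Obj
  catStruct := A.bicat.toCategoryStruct
  homStruct a b := A.hatHomStruct a b
  homAdd f g := (inferInstance : AddCommGroup (A.HatHom f g))
  homMod f g := (inferInstance : Module k (A.HatHom f g))
  deg f g p := ((if p = 0 then Submodule.prod ⊤ ⊥ else Submodule.prod ⊥ ⊤ :
    Submodule k (A.HatHom f g)))
  hcomp x y := hatHcomp x y
  assoc f g h := A.hatIso (α_ f g h)
  lunit f := A.hatIso (λ_ f)
  runit f := A.hatIso (ρ_ f)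
  pi := A.pi
  zeta a := @InvPair.mk (a ⟶ a) (A.hatHomStruct a a) (A.pi a) (𝟙 a)
    ((0, (λ_ (A.pi a)).inv) : A.HatHom (A.pi a) (𝟙 a))
    ((0, -(A.ξ a).inv) : A.HatHom (𝟙 a) (A.pi a))

variable {A} {B : PiTwoCatData.{w, v, u} k}

/-- The data of the 2-superfunctor associated to a Π-2-functor; on odd 2-morphisms it is
`x ↦ j⁻¹ (R g) ∘ c⁻¹ ∘ R x`. -/
@[reducible]
def hatMap (R : PiFunctorData A B) :
    TwoSuperfunctorData A.hatData.toTwoSupercatData B.hatData.toTwoSupercatData where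
  obj := R.obj
  map f := R.map f
  map₂ {_ b f g} x := ((R.map₂ (Prod.fst x), R.map₂ (Prod.snd x) ≫ (R.mapComp g (A.pi b)).hom ≫
    R.map g ◁ (R.j b).inv) : B.HatHom (R.map f) (R.map g))
  c f g := B.hatIso (R.mapComp f g).symm
  i a := B.hatIso (R.mapId a).symm

/-- The data of the 2-natural transformation associated to a Π-2-natural transformation. -/
@[reducible]
def hatNat {R S : PiFunctorData A B} (X : PiNatData R S) : TwoNatData (hatMap R) (hatMap S) where
  app := X.app
  naturality {a b} f := ((X.naturality f, 0) : B.HatHom (R.map f ≫ X.app b) (X.app a ≫ S.map f))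

end PiTwoCatData

end Associated

section Main

variable (k : Type t) [CommRing k]

/-- The laws of the objects, 1-morphisms and 2-morphisms in the image of `𝔼₂` hold. -/
structure UnderlyingWellDefined : Prop where
  obj : ∀ A : PiTwoSupercat.{w, v, u} k, IsPiTwoCat A.underData
  map : ∀ {A B : PiTwoSupercat.{w, v, u} k} (R : A ⟶ B), IsPiFunctor (PiTwoSupercat.underMap R)
  nat : ∀ {A B : PiTwoSupercat.{w, v, u} k} {R S : A ⟶ B} (X : PreTwoCategory.Hom₂ R S),
    IsPiNat (PiTwoSupercat.underNat X)

/-- The laws of the objects, 1-morphisms and 2-morphisms in the image of `𝔻₂` hold. -/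
structure AssociatedWellDefined : Prop where
  obj : ∀ A : PiTwoCat.{w, v, u} k, IsPiTwoSupercat A.hatData
  map : ∀ {A B : PiTwoCat.{w, v, u} k} (R : A ⟶ B),
    IsTwoSuperfunctor (PiTwoCatData.hatMap (PiFunctor.toPiFunctorData R))
  nat : ∀ {A B : PiTwoCat.{w, v, u} k} {R S : A ⟶ B} (X : PreTwoCategory.Hom₂ R S),
    IsTwoNat (PiTwoCatData.hatNat (PiNat.toNat X))

variable {k}

/-- `𝔼₂`, from Π-2-supercategories to Π-2-categories. -/
def E₂ (h : UnderlyingWellDefined.{w, v, u} k) :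
    TwoPrefunctor (PiTwoSupercat.{w, v, u} k) (PiTwoCat.{w, v, u} k) where
  obj A := ⟨A.underData, h.obj A⟩
  map R := ⟨PiTwoSupercat.underMap R, h.map R⟩
  map₂ X := ⟨PiTwoSupercat.underNat X, h.nat X⟩

/-- `𝔻₂`, from Π-2-categories to Π-2-supercategories. -/
def D₂ (h : AssociatedWellDefined.{w, v, u} k) :
    TwoPrefunctor (PiTwoCat.{w, v, u} k) (PiTwoSupercat.{w, v, u} k) where
  obj A := ⟨A.hatData, h.obj A⟩
  map R := ⟨PiTwoCatData.hatMap (PiFunctor.toPiFunctorData R), h.map R⟩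
  map₂ X := ⟨PiTwoCatData.hatNat (PiNat.toNat X), h.nat X⟩

/-- `x₀ + ζ_b g ∘ x₁`. -/
def PiTwoSupercat.evalHom (A : PiTwoSupercat.{w, v, u} k) {a b : A.Obj} {f g : a ⟶ b}
    (x₀ : f ⟶ g) (x₁ : f ⟶ g ≫ A.pi b) : f ⟶ g :=
  x₀ + x₁ ≫ A.hcomp (𝟙 g) (A.zeta b).hom ≫ (A.runit g).hom

/-- The identity as a pair of 2-morphisms. -/
def PiTwoSupercat.idPair (A : PiTwoSupercat.{w, v, u} k) {a b : A.Obj} (f : a ⟶ b) :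
    InvPair f f :=
  ⟨𝟙 f, 𝟙 f⟩

/-- The data of the canonical 2-superfunctor to a Π-2-supercategory from the Π-2-supercategory
associated to its underlying Π-2-category: it is the identity on objects and 1-morphisms, sends an
even 2-morphism to itself, and sends an odd one, given by an even `x` from `f` to the composite
usually written `π_b g`, to `ζ_b g ∘ x`; its coherence maps are identities. -/
@[reducible]
def TData (A : PiTwoSupercat.{w, v, u} k) :
    TwoSuperfunctorData A.underData.hatData.toTwoSupercatData A.toTwoSupercatData where
  obj a := a
  map f := f
  map₂ x := A.evalHom (Subtype.val (Prod.fst x)) (Subtype.val (Prod.snd x))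
  c f g := A.idPair (f ≫ g)
  i a := A.idPair (𝟙 a)

/-- The 1-morphism `S` to a Π-2-category `A` from the Π-2-category underlying its associated
Π-2-supercategory is the identity: on objects, on 1-morphisms, and on 2-morphisms (an even
2-morphism of the associated Π-2-supercategory is a 2-morphism of `A`), with identity coherence
maps. -/
structure IsCanonicalIdentity {A : PiTwoCat.{w, v, u} k} {h : IsPiTwoSupercat A.hatData}
    (S : PiFunctorData (PiTwoSupercat.underData ⟨A.hatData, h⟩) A.toPiTwoCatData) : Prop where
  obj : ∀ a : A.Obj, S.obj a = a
  map : ∀ {a b : A.Obj} (f : a ⟶ b), HEq (S.map f) f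
  map₂ : ∀ {a b : A.Obj} {f g : a ⟶ b}
    (x : (⟨A.hatData, h⟩ : PiTwoSupercat k).toTwoSupercat.EvenHom f g),
    HEq (S.map₂ x) (Prod.fst (Subtype.val x))
  mapComp : ∀ {a b c : A.Obj} (f : a ⟶ b) (g : b ⟶ c), HEq (S.mapComp f g).hom (𝟙 (f ≫ g))
  mapId : ∀ a : A.Obj, HEq (S.mapId a).hom (𝟙 (𝟙 a))
  j : ∀ a : A.Obj, HEq (S.j a).hom (𝟙 (A.pi a))

end Main

end PiTwo

open PiTwo

/-!
Both constructions rest on the odd 2-isomorphism `ζ`, and on the fact that an odd 2-morphism into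
`g` is the same thing as an even 2-morphism into `π g`.

*From Π-2-supercategories to Π-2-categories.* Whiskering `ζ` on the two sides of a 1-morphism
`f : a ⟶ b` gives odd 2-isomorphisms `zr f : π_b f ⟶ f` and `zl f : f π_a ⟶ f`. The 2-morphism `β_f`
is the only one with `zl f ∘ β_f = zr f` (`betaHom_zl`), and `ξ_b f` is `zr f` applied twice
(`zr_zr`). Every law of a Π-2-category may be checked after composing with the invertible `zl`,
where it becomes a compatibility of `zr` and `zl` with composition, units and naturality. The sign
in `β_π = -1` is the sign in the super interchange law for two copies of `ζ` (`zr_pi`). In the same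
way `j` is characterized by `R ζ ∘ j = i ∘ ζ`, which identifies `R (zr f)` with `zr (R f)` up to `c`
and `j` (`map_zr`, `map_zl`), and the law of a Π-2-natural transformation is naturality at `ζ`.

*From Π-2-categories to Π-2-supercategories.* A 2-morphism is a pair of an even and an odd part.
The horizontal composite of two pairs is a right whiskering followed by a left whiskering
(`IsPiTwoCat.hatHcomp_eq`), so that the axioms reduce to functoriality of the two whiskerings, to
their compatibility with the coherence maps, and to the exchange of one with the other. The last is
strict if one of the two 2-morphisms is even; for two odd ones the sign comes from `β_π = -1`
(`IsPiTwoCat.hat_exchange_odd`). Associativity of vertical composition is `ξ π = π ξ`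
(`IsPiTwoCat.xiWhisker_comp_pi`), and functoriality of right whiskering is the relation between `ξ`
and `β` (`IsPiTwoCat.betaWhisker_betaWhisker_xiWhisker`).

*The two composites.* The map `eval` that sends `(x₀, x₁)` to `x₀ + ζ_b g ∘ x₁` respects both
compositions and is bijective, because 2-morphisms decompose into even and odd parts and
composition with `ζ_b g` exchanges the two; hence `TData` is an isomorphism, and it is natural by
`map_zr`. In the other order an even pair is just a 2-morphism of the original 2-category, and the
`β`, `ξ` and `j` recovered from `ζ` are the original ones, by the uniqueness properties above
(`betaHom_hat`, `xiHom_hat`, `jHom_hatMap`).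
-/

namespace PiTwo

/-! ### The 2-isomorphisms `ζ_b f` and `f ζ_a` of a Π-2-supercategory -/

section Super

variable {k : Type t} [CommRing k]

namespace PiTwoSupercat

variable (A : PiTwoSupercat.{w, v, u} k) {a b c d : A.Obj}

/-- The category of 1-morphisms `a ⟶ b` and all 2-morphisms, even or not. -/
@[reducible]
def homCategory (a b : A.Obj) : Category.{w} (a ⟶ b) :=
  (A.isPiTwoSupercat.isTwoSupercat.hom a b).category

attribute [local instance] homCategory

/-- The additive structure on all 2-morphisms between parallel 1-morphisms. -/
@[reducible]
def homPreadditive (a b : A.Obj) : Preadditive (a ⟶ b) where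
  homGroup f g := inferInstanceAs (AddCommGroup (f ⟶ g))
  add_comp _ _ _ x x' y := (A.isPiTwoSupercat.isTwoSupercat.hom a b).add_comp x x' y
  comp_add _ _ _ x y y' := (A.isPiTwoSupercat.isTwoSupercat.hom a b).comp_add x y y'

attribute [local instance] homPreadditive

theorem whiskerLeft_comp (f : a ⟶ b) {g g' g'' : b ⟶ c} (y : g ⟶ g') (v : g' ⟶ g'') :
    A.hcomp (𝟙 f) (y ≫ v) = A.hcomp (𝟙 f) y ≫ A.hcomp (𝟙 f) v :=
  A.toTwoSupercat.hcomp_id_comp f y v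

theorem comp_whiskerRight {f f' f'' : a ⟶ b} (x : f ⟶ f') (u : f' ⟶ f'') (g : b ⟶ c) :
    A.hcomp (x ≫ u) (𝟙 g) = A.hcomp x (𝟙 g) ≫ A.hcomp u (𝟙 g) :=
  A.toTwoSupercat.comp_hcomp_id x u g

theorem hcomp_id (f : a ⟶ b) (g : b ⟶ c) : A.hcomp (𝟙 f) (𝟙 g) = 𝟙 (f ≫ g) :=
  A.isPiTwoSupercat.isTwoSupercat.hcomp_id f g

theorem hcomp_eq {f f' : a ⟶ b} {g g' : b ⟶ c} (x : f ⟶ f') (y : g ⟶ g') :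
    A.hcomp x y = A.hcomp x (𝟙 g) ≫ A.hcomp (𝟙 f') y := by
  have := A.toTwoSupercat.interchange_left x (𝟙 g) y (A.toTwoSupercat.id_mem f')
  rw [this]
  congr 1
  · exact (Category.comp_id x).symm
  · exact (Category.id_comp y).symm

theorem exchange_even_left {f f' : a ⟶ b} {g g' : b ⟶ c} {x : f ⟶ f'} (y : g ⟶ g')
    (hx : x ∈ A.deg f f' 0) :
    A.hcomp (𝟙 f) y ≫ A.hcomp x (𝟙 g') = A.hcomp x (𝟙 g) ≫ A.hcomp (𝟙 f') y :=
  A.toTwoSupercat.hcomp_exchange y hx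

theorem exchange_even_right {f f' : a ⟶ b} {g g' : b ⟶ c} (x : f ⟶ f') {y : g ⟶ g'}
    (hy : y ∈ A.deg g g' 0) :
    A.hcomp (𝟙 f) y ≫ A.hcomp x (𝟙 g') = A.hcomp x (𝟙 g) ≫ A.hcomp (𝟙 f') y := by
  rw [← A.hcomp_eq]
  have := A.toTwoSupercat.interchange_right (𝟙 f) x (𝟙 g') hy
  rw [this]
  congr 1
  · exact Category.id_comp x
  · exact Category.comp_id y

/-- Sliding two odd 2-morphisms past each other costs a sign. -/
theorem exchange_odd {f f' : a ⟶ b} {g g' : b ⟶ c} {x : f ⟶ f'} {y : g ⟶ g'}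
    (hx : x ∈ A.deg f f' 1) (hy : y ∈ A.deg g g' 1) :
    A.hcomp (𝟙 f) y ≫ A.hcomp x (𝟙 g') = -(A.hcomp x (𝟙 g) ≫ A.hcomp (𝟙 f') y) := by
  rw [← A.hcomp_eq]
  have := A.isPiTwoSupercat.isTwoSupercat.interchange (𝟙 f) (𝟙 g') hx hy
  rw [this]
  have e : (-1 : k) ^ ((1 : ZMod 2).val * (1 : ZMod 2).val) = -1 := by
    rw [show (1 : ZMod 2).val = 1 from rfl]; simp
  rw [e, neg_one_smul]
  congr 2
  · exact Category.id_comp x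
  · exact Category.comp_id y

theorem assoc_hom_inv (f : a ⟶ b) (g : b ⟶ c) (h : c ⟶ d) :
    (A.assoc f g h).hom ≫ (A.assoc f g h).inv = 𝟙 _ :=
  (A.isPiTwoSupercat.isTwoSupercat.assoc_inverse f g h).hom_inv

theorem assoc_inv_hom (f : a ⟶ b) (g : b ⟶ c) (h : c ⟶ d) :
    (A.assoc f g h).inv ≫ (A.assoc f g h).hom = 𝟙 _ :=
  (A.isPiTwoSupercat.isTwoSupercat.assoc_inverse f g h).inv_hom

theorem zeta_hom_inv (a : A.Obj) : (A.zeta a).hom ≫ (A.zeta a).inv = 𝟙 _ :=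
  (A.isPiTwoSupercat.zeta_inverse a).hom_inv

theorem zeta_inv_hom (a : A.Obj) : (A.zeta a).inv ≫ (A.zeta a).hom = 𝟙 _ :=
  (A.isPiTwoSupercat.zeta_inverse a).inv_hom

theorem runit_hom_inv (f : a ⟶ b) : (A.runit f).hom ≫ (A.runit f).inv = 𝟙 _ :=
  (A.isPiTwoSupercat.isTwoSupercat.runit_inverse f).hom_inv

theorem runit_inv_hom (f : a ⟶ b) : (A.runit f).inv ≫ (A.runit f).hom = 𝟙 _ :=
  (A.isPiTwoSupercat.isTwoSupercat.runit_inverse f).inv_hom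

theorem lunit_hom_inv (f : a ⟶ b) : (A.lunit f).hom ≫ (A.lunit f).inv = 𝟙 _ :=
  (A.isPiTwoSupercat.isTwoSupercat.lunit_inverse f).hom_inv

theorem lunit_inv_hom (f : a ⟶ b) : (A.lunit f).inv ≫ (A.lunit f).hom = 𝟙 _ :=
  (A.isPiTwoSupercat.isTwoSupercat.lunit_inverse f).inv_hom

/-- The odd 2-isomorphism `ζ_b f`, from the composite usually written `π_b f` to `f`. -/
def zr (f : a ⟶ b) : f ≫ A.pi b ⟶ f := A.hcomp (𝟙 f) (A.zeta b).hom ≫ (A.runit f).hom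

/-- The inverse of `zr`. -/
def zrInv (f : a ⟶ b) : f ⟶ f ≫ A.pi b := (A.runit f).inv ≫ A.hcomp (𝟙 f) (A.zeta b).inv

/-- The odd 2-isomorphism `f ζ_a`, from the composite usually written `f π_a` to `f`. -/
def zl (f : a ⟶ b) : A.pi a ≫ f ⟶ f := A.hcomp (A.zeta a).hom (𝟙 f) ≫ (A.lunit f).hom

/-- The inverse of `zl`. -/
def zlInv (f : a ⟶ b) : f ⟶ A.pi a ≫ f := (A.lunit f).inv ≫ A.hcomp (A.zeta a).inv (𝟙 f)

theorem zr_zrInv (f : a ⟶ b) : A.zr f ≫ A.zrInv f = 𝟙 _ := by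
  unfold zr zrInv
  rw [Category.assoc, ← Category.assoc (A.runit f).hom, A.runit_hom_inv, Category.id_comp,
    ← A.whiskerLeft_comp, A.zeta_hom_inv, A.hcomp_id]

theorem zrInv_zr (f : a ⟶ b) : A.zrInv f ≫ A.zr f = 𝟙 _ := by
  unfold zr zrInv
  rw [Category.assoc, ← Category.assoc (A.hcomp _ _),
    ← A.whiskerLeft_comp, A.zeta_inv_hom, A.hcomp_id, Category.id_comp, A.runit_inv_hom]

theorem zl_zlInv (f : a ⟶ b) : A.zl f ≫ A.zlInv f = 𝟙 _ := by
  unfold zl zlInv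
  rw [Category.assoc, ← Category.assoc (A.lunit f).hom, A.lunit_hom_inv, Category.id_comp,
    ← A.comp_whiskerRight, A.zeta_hom_inv, A.hcomp_id]

theorem zlInv_zl (f : a ⟶ b) : A.zlInv f ≫ A.zl f = 𝟙 _ := by
  unfold zl zlInv
  rw [Category.assoc, ← Category.assoc (A.hcomp _ _),
    ← A.comp_whiskerRight, A.zeta_inv_hom, A.hcomp_id, Category.id_comp, A.lunit_inv_hom]

instance (f : a ⟶ b) : IsIso (A.zl f) := ⟨A.zlInv f, A.zl_zlInv f, A.zlInv_zl f⟩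

instance (f : a ⟶ b) : IsIso (A.zr f) := ⟨A.zrInv f, A.zr_zrInv f, A.zrInv_zr f⟩

theorem zr_mem (f : a ⟶ b) : A.zr f ∈ A.deg _ _ 1 := by
  have hA := A.isPiTwoSupercat.isTwoSupercat
  exact (hA.hom a b).comp_mem (hA.hcomp_mem ((hA.hom a b).id_mem f)
    (A.isPiTwoSupercat.zeta_mem b)) (hA.runit_mem f)

theorem zrInv_mem (f : a ⟶ b) : A.zrInv f ∈ A.deg _ _ 1 := by
  have hA := A.isPiTwoSupercat.isTwoSupercat
  exact (hA.hom a b).comp_mem (A.runit_inv_mem f) (hA.hcomp_mem ((hA.hom a b).id_mem f)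
    (A.zeta_inv_mem b))

theorem runit_nat {f g : a ⟶ b} (x : f ⟶ g) :
    A.hcomp x (𝟙 (𝟙 b)) ≫ (A.runit g).hom = (A.runit f).hom ≫ x :=
  A.isPiTwoSupercat.isTwoSupercat.runit_naturality x

theorem lunit_nat {f g : a ⟶ b} (x : f ⟶ g) :
    A.hcomp (𝟙 (𝟙 a)) x ≫ (A.lunit g).hom = (A.lunit f).hom ≫ x :=
  A.isPiTwoSupercat.isTwoSupercat.lunit_naturality x

theorem assoc_nat {f f' : a ⟶ b} {g g' : b ⟶ c} {h h' : c ⟶ d}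
    (x : f ⟶ f') (y : g ⟶ g') (z : h ⟶ h') :
    A.hcomp (A.hcomp x y) z ≫ (A.assoc f' g' h').hom =
      (A.assoc f g h).hom ≫ A.hcomp x (A.hcomp y z) :=
  A.isPiTwoSupercat.isTwoSupercat.assoc_naturality x y z

theorem zr_naturality {f g : a ⟶ b} {x : f ⟶ g} (hx : x ∈ A.deg f g 0) :
    A.hcomp x (𝟙 (A.pi b)) ≫ A.zr g = A.zr f ≫ x := by
  unfold zr
  rw [← Category.assoc, ← A.exchange_even_left _ hx, Category.assoc, A.runit_nat, Category.assoc]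

/-- As `ζ` is odd, an odd 2-morphism moves past it up to a sign. -/
theorem zr_naturality_odd {f g : a ⟶ b} {x : f ⟶ g} (hx : x ∈ A.deg f g 1) :
    A.hcomp x (𝟙 (A.pi b)) ≫ A.zr g = -(A.zr f ≫ x) := by
  unfold zr
  rw [← Category.assoc, ← neg_eq_iff_eq_neg, ← Preadditive.neg_comp,
    ← A.exchange_odd hx (A.isPiTwoSupercat.zeta_mem b),
    Category.assoc, A.runit_nat, Category.assoc]

theorem zl_naturality {f g : a ⟶ b} {x : f ⟶ g} (hx : x ∈ A.deg f g 0) :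
    A.hcomp (𝟙 (A.pi a)) x ≫ A.zl g = A.zl f ≫ x := by
  unfold zl
  rw [← Category.assoc, A.exchange_even_right _ hx, Category.assoc, A.lunit_nat, Category.assoc]

theorem triangle (f : a ⟶ b) (g : b ⟶ c) :
    (A.assoc f (𝟙 b) g).hom ≫ A.hcomp (𝟙 f) (A.lunit g).hom = A.hcomp (A.runit f).hom (𝟙 g) :=
  A.isPiTwoSupercat.isTwoSupercat.triangle f g

/-- The two readings of `g ζ_b f`, with `ζ_b` whiskered onto `f` or onto `g`, agree. -/
theorem zl_whiskerLeft (f : a ⟶ b) (g : b ⟶ c) :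
    (A.assoc f (A.pi b) g).hom ≫ A.hcomp (𝟙 f) (A.zl g) = A.hcomp (A.zr f) (𝟙 g) := by
  unfold zl zr
  rw [A.whiskerLeft_comp, ← Category.assoc, ← A.assoc_nat, Category.assoc, A.triangle,
    A.comp_whiskerRight]

end PiTwoSupercat
end Super

/-! ### The underlying Π-2-category of a Π-2-supercategory -/

/-- The constructor of `InvPair.IsInverse`, with the category structure found by unification: the
structures on 1-morphisms of the categories built here are not found by instance search. -/
theorem InvPair.IsInverse.of_eq {C : Type u} {_ : CategoryStruct.{v} C} {X Y : C} {e : InvPair X Y}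
    (h : e.hom ≫ e.inv = 𝟙 X) (h' : e.inv ≫ e.hom = 𝟙 Y) : e.IsInverse :=
  ⟨h, h'⟩

section Super

variable {k : Type t} [CommRing k]

namespace PiTwoSupercat

variable (A : PiTwoSupercat.{w, v, u} k) {a b c d : A.Obj}

attribute [local instance] homCategory homPreadditive

theorem runit_comp (f : a ⟶ b) (g : b ⟶ c) :
    (A.runit (f ≫ g)).hom = (A.assoc f g (𝟙 c)).hom ≫ A.hcomp (𝟙 f) (A.runit g).hom := by
  let _ := A.toTwoSupercat.even
  exact congrArg Subtype.val (rightUnitor_comp (B := A.Obj) f g)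

theorem lunit_comp (f : a ⟶ b) (g : b ⟶ c) :
    (A.lunit (f ≫ g)).hom = (A.assoc (𝟙 a) f g).inv ≫ A.hcomp (A.lunit f).hom (𝟙 g) := by
  let _ := A.toTwoSupercat.even
  exact congrArg Subtype.val (leftUnitor_comp (B := A.Obj) f g)

theorem lunit_id (a : A.Obj) : (A.lunit (𝟙 a)).hom = (A.runit (𝟙 a)).hom := by
  let _ := A.toTwoSupercat.even
  exact congrArg Subtype.val (unitors_equal (B := A.Obj) (a := a))

theorem zr_comp (f : a ⟶ b) (g : b ⟶ c) :
    A.zr (f ≫ g) = (A.assoc f g (A.pi c)).hom ≫ A.hcomp (𝟙 f) (A.zr g) := by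
  unfold zr
  rw [A.whiskerLeft_comp, ← Category.assoc, ← A.assoc_nat, Category.assoc, A.runit_comp, A.hcomp_id]

theorem zl_comp (f : a ⟶ b) (g : b ⟶ c) :
    (A.assoc (A.pi a) f g).hom ≫ A.zl (f ≫ g) = A.hcomp (A.zl f) (𝟙 g) := by
  unfold zl
  rw [A.comp_whiskerRight, A.lunit_comp, ← A.hcomp_id, ← Category.assoc, ← A.assoc_nat,
    Category.assoc, ← Category.assoc (A.assoc _ _ _).hom, A.assoc_hom_inv, Category.id_comp]

theorem zr_id (a : A.Obj) : A.zr (𝟙 a) = (A.lunit (A.pi a)).hom ≫ (A.zeta a).hom := by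
  rw [zr, ← A.lunit_id, A.lunit_nat]

theorem zl_id (a : A.Obj) : A.zl (𝟙 a) = (A.runit (A.pi a)).hom ≫ (A.zeta a).hom := by
  rw [zl, A.lunit_id, A.runit_nat]

theorem zl_pi_zeta (a : A.Obj) :
    A.zl (A.pi a) ≫ (A.zeta a).hom =
      A.hcomp (A.zeta a).hom (A.zeta a).hom ≫ (A.lunit (𝟙 a)).hom := by
  rw [A.hcomp_eq, zl, Category.assoc, Category.assoc, A.lunit_nat]

theorem zr_pi_zeta (a : A.Obj) :
    A.zr (A.pi a) ≫ (A.zeta a).hom = -(A.zl (A.pi a) ≫ (A.zeta a).hom) := by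
  rw [zl_pi_zeta, A.hcomp_eq, zr, ← Preadditive.neg_comp, ← A.exchange_odd, A.lunit_id,
    Category.assoc, Category.assoc, A.runit_nat]
  · exact A.isPiTwoSupercat.zeta_mem a
  · exact A.isPiTwoSupercat.zeta_mem a

/-- The source of `β_π = -1`: `ζ π` and `π ζ` become opposite after composing with `ζ`, by super
interchange, and `ζ` is invertible. -/
theorem zr_pi (a : A.Obj) : A.zr (A.pi a) = -A.zl (A.pi a) := by
  have h := congrArg (· ≫ (A.zeta a).inv) (A.zr_pi_zeta a)
  rwa [← Preadditive.neg_comp, Category.assoc, A.zeta_hom_inv, Category.assoc, A.zeta_hom_inv,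
    Category.comp_id, Category.comp_id] at h

theorem lunit_inv_nat {f g : a ⟶ b} (x : f ⟶ g) :
    (A.lunit f).inv ≫ A.hcomp (𝟙 (𝟙 a)) x = x ≫ (A.lunit g).inv := by
  have h := congrArg (fun z => (A.lunit f).inv ≫ z ≫ (A.lunit g).inv) (A.lunit_nat x)
  simp only [Category.assoc] at h
  rw [A.lunit_hom_inv, Category.comp_id, ← Category.assoc (A.lunit f).inv (A.lunit f).hom,
    A.lunit_inv_hom, Category.id_comp] at h
  exact h

/-- `β_f` is the unique 2-morphism that carries `f ζ_a` to `ζ_b f`. As `f ζ_a` is invertible, the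
laws of `β` follow from identities between the odd 2-isomorphisms `zr` and `zl`. -/
theorem betaHom_zl (f : a ⟶ b) : (A.betaHom f).1 ≫ A.zl f = A.zr f := by
  have hA := A.isPiTwoSupercat.isTwoSupercat
  have h1 : A.hcomp (𝟙 f) (A.zeta b).hom ∈ A.deg _ _ 1 :=
    hA.hcomp_mem ((hA.hom a b).id_mem f) (A.isPiTwoSupercat.zeta_mem b)
  have h2 : A.hcomp (A.zeta a).inv (𝟙 (f ≫ 𝟙 b)) ≫ A.zl (f ≫ 𝟙 b) = (A.lunit _).hom := by
    rw [zl, ← Category.assoc, ← A.comp_whiskerRight, A.zeta_inv_hom, A.hcomp_id, Category.id_comp]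
  have h3 : A.hcomp (𝟙 (A.pi a)) (A.runit f).hom ≫ A.zl f = A.zl (f ≫ 𝟙 b) ≫ (A.runit f).hom :=
    A.zl_naturality (hA.runit_mem f)
  have h4 : A.hcomp (A.zeta a).inv (A.hcomp (𝟙 f) (A.zeta b).hom) =
      -(A.hcomp (𝟙 (𝟙 a)) (A.hcomp (𝟙 f) (A.zeta b).hom) ≫
        A.hcomp (A.zeta a).inv (𝟙 (f ≫ 𝟙 b))) := by
    rw [A.exchange_odd (A.zeta_inv_mem a) h1, neg_neg, A.hcomp_eq]
  dsimp only [betaHom]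
  rw [h4]
  simp only [Preadditive.neg_comp, Preadditive.comp_neg, neg_neg, Category.assoc]
  rw [h3, ← Category.assoc (A.hcomp (A.zeta a).inv _), h2,
    ← Category.assoc (A.hcomp _ _), A.lunit_nat, Category.assoc, ← Category.assoc (A.lunit _).inv,
    A.lunit_inv_hom, Category.id_comp, zr]

theorem betaHom_eq (f : a ⟶ b) : (A.betaHom f).1 = A.zr f ≫ A.zlInv f := by
  rw [← betaHom_zl, Category.assoc, A.zl_zlInv, Category.comp_id]

theorem betaInv_eq (f : a ⟶ b) : (A.betaInv f).1 = A.zl f ≫ A.zrInv f := by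
  have hA := A.isPiTwoSupercat.isTwoSupercat
  dsimp only [betaInv]
  rw [A.hcomp_eq (A.zeta a).hom, Category.assoc, A.lunit_nat, ← Category.assoc,
    ← Category.assoc, A.exchange_even_right _ (A.runit_inv_mem f), Category.assoc,
    Category.assoc, ← Category.assoc (A.hcomp (𝟙 (𝟙 a)) _), A.lunit_nat, zl, zrInv]
  simp only [Category.assoc]

theorem betaInv_zr (f : a ⟶ b) : (A.betaInv f).1 ≫ A.zr f = A.zl f := by
  rw [betaInv_eq, Category.assoc, A.zrInv_zr, Category.comp_id]

theorem xiHom_eq (a : A.Obj) : (A.xiHom a).1 = A.zl (A.pi a) ≫ (A.zeta a).hom :=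
  (A.zl_pi_zeta a).symm

theorem xiInv_eq (a : A.Obj) : (A.xiInv a).1 = (A.zeta a).inv ≫ A.zlInv (A.pi a) := by
  have hA := A.isPiTwoSupercat.isTwoSupercat
  dsimp only [xiInv]
  have h : A.hcomp (A.zeta a).inv (A.zeta a).inv =
      -(A.hcomp (𝟙 (𝟙 a)) (A.zeta a).inv ≫ A.hcomp (A.zeta a).inv (𝟙 (A.pi a))) := by
    rw [A.exchange_odd (A.zeta_inv_mem a) (A.zeta_inv_mem a), neg_neg, A.hcomp_eq]
  rw [h, Preadditive.comp_neg, neg_neg, zlInv, ← Category.assoc, ← Category.assoc,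
    A.lunit_inv_nat]

theorem betaHom_betaInv (f : a ⟶ b) : (A.betaHom f).1 ≫ (A.betaInv f).1 = 𝟙 (f ≫ A.pi b) := by
  rw [betaHom_eq, betaInv_eq, Category.assoc, reassoc_of% A.zlInv_zl, A.zr_zrInv]

theorem betaInv_betaHom (f : a ⟶ b) : (A.betaInv f).1 ≫ (A.betaHom f).1 = 𝟙 (A.pi a ≫ f) := by
  rw [betaHom_eq, betaInv_eq, Category.assoc, reassoc_of% A.zrInv_zr, A.zl_zlInv]

theorem xiHom_xiInv (a : A.Obj) : (A.xiHom a).1 ≫ (A.xiInv a).1 = 𝟙 (A.pi a ≫ A.pi a) := by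
  rw [xiHom_eq, xiInv_eq, Category.assoc, ← Category.assoc (A.zeta a).hom, A.zeta_hom_inv,
    Category.id_comp, A.zl_zlInv]

theorem xiInv_xiHom (a : A.Obj) : (A.xiInv a).1 ≫ (A.xiHom a).1 = 𝟙 (𝟙 a) := by
  rw [xiHom_eq, xiInv_eq, Category.assoc, reassoc_of% A.zlInv_zl, A.zeta_inv_hom]

/-- The 2-morphism `ξ_b f` is `ζ_b f` applied twice. -/
theorem zr_zr (f : a ⟶ b) :
    (A.assoc f (A.pi b) (A.pi b)).hom ≫ A.hcomp (𝟙 f) (A.xiHom b).1 ≫ (A.runit f).hom =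
      A.hcomp (A.zr f) (𝟙 (A.pi b)) ≫ A.zr f := by
  rw [xiHom_eq, A.whiskerLeft_comp, Category.assoc, reassoc_of% A.zl_whiskerLeft]
  rfl

end PiTwoSupercat
end Super

section Under

variable {k : Type t} [CommRing k]

theorem PiTwoSupercat.isPiTwoCat_underData (A : PiTwoSupercat.{w, v, u} k) :
    IsPiTwoCat A.underData := by
  have hA := A.isPiTwoSupercat.isTwoSupercat
  let _ := A.homCategory
  let _ := A.homPreadditive
  refine ⟨?_, ?_, ?_, ?_, ?_, ?_, ?_⟩
  · -- `β` is invertible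
    intro _ _ f
    exact .of_eq (TwoSupercat.EvenHom.ext (A.betaHom_betaInv f))
      (TwoSupercat.EvenHom.ext (A.betaInv_betaHom f))
  · -- `ξ` is invertible
    intro a
    exact .of_eq (TwoSupercat.EvenHom.ext (A.xiHom_xiInv a))
      (TwoSupercat.EvenHom.ext (A.xiInv_xiHom a))
  · -- `β` is natural
    intro a b f g x
    refine TwoSupercat.EvenHom.ext ?_
    show A.hcomp x.1 (𝟙 (A.pi b)) ≫ (A.betaHom g).1 =
      (A.betaHom f).1 ≫ A.hcomp (𝟙 (A.pi a)) x.1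
    rw [← cancel_mono (A.zl g), Category.assoc, Category.assoc, A.betaHom_zl,
      A.zl_naturality x.2, A.zr_naturality x.2, ← Category.assoc, A.betaHom_zl]
  · -- `β` at a composite 1-morphism
    intro a b c f g
    refine TwoSupercat.EvenHom.ext ?_
    show (A.betaHom (f ≫ g)).1 = (A.assoc f g (A.pi c)).hom ≫ A.hcomp (𝟙 f) (A.betaHom g).1 ≫
      (A.assoc f (A.pi b) g).inv ≫ A.hcomp (A.betaHom f).1 (𝟙 g) ≫ (A.assoc (A.pi a) f g).hom
    rw [← cancel_mono (A.zl (f ≫ g)), A.betaHom_zl]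
    simp only [Category.assoc]
    rw [A.zl_comp, ← A.comp_whiskerRight, A.betaHom_zl, ← A.zl_whiskerLeft,
      ← Category.assoc (A.assoc _ _ _).inv, A.assoc_inv_hom, Category.id_comp,
      ← A.whiskerLeft_comp, A.betaHom_zl, A.zr_comp]
  · -- `β` at an identity
    intro a
    refine TwoSupercat.EvenHom.ext ?_
    show (A.betaHom (𝟙 a)).1 = (A.lunit (A.pi a)).hom ≫ (A.runit (A.pi a)).inv
    rw [← cancel_mono (A.zl (𝟙 a)), A.betaHom_zl, A.zl_id, A.zr_id, Category.assoc,
      ← Category.assoc (A.runit _).inv, A.runit_inv_hom, Category.id_comp]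
  · -- `β_π = -1`
    intro a
    refine TwoSupercat.EvenHom.ext ?_
    show (A.betaHom (A.pi a)).1 = -𝟙 _
    rw [← cancel_mono (A.zl (A.pi a)), A.betaHom_zl, A.zr_pi, Preadditive.neg_comp,
      Category.id_comp]
  · -- `ξ_b f ξ_a⁻¹ = β_f π_a ∘ π_b β_f`
    intro a b f
    refine TwoSupercat.EvenHom.ext ?_
    show (A.assoc f (A.pi b) (A.pi b)).hom ≫ A.hcomp (𝟙 f) (A.xiHom b).1 ≫ (A.runit f).hom =
      A.hcomp (A.betaHom f).1 (𝟙 (A.pi b)) ≫ (A.assoc (A.pi a) f (A.pi b)).hom ≫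
        A.hcomp (𝟙 (A.pi a)) (A.betaHom f).1 ≫ (A.assoc (A.pi a) (A.pi a) f).inv ≫
          A.hcomp (A.xiHom a).1 (𝟙 f) ≫ (A.lunit f).hom
    have h1 : A.hcomp (A.xiHom a).1 (𝟙 f) ≫ (A.lunit f).hom =
        (A.assoc (A.pi a) (A.pi a) f).hom ≫ A.zl (A.pi a ≫ f) ≫ A.zl f := by
      rw [A.xiHom_eq, A.comp_whiskerRight, ← A.zl_comp, Category.assoc, Category.assoc]
      rfl
    rw [A.zr_zr, h1, ← Category.assoc (A.assoc _ _ _).inv, A.assoc_inv_hom, Category.id_comp,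
      reassoc_of% (A.zl_naturality (A.betaHom f).2), A.betaHom_zl,
      ← Category.assoc (A.assoc _ _ _).hom, A.zl_comp, ← Category.assoc,
      ← A.comp_whiskerRight, A.betaHom_zl]

namespace PiTwoSupercat

variable {A B : PiTwoSupercat.{w, v, u} k} (R : A ⟶ B) {a b : A.Obj}

attribute [local instance] homCategory homPreadditive

theorem jHom_map_zeta (a : A.Obj) :
    (jHom R a).1 ≫ R.map₂ (A.zeta a).hom = (B.zeta (R.obj a)).hom ≫ (R.i a).hom := by
  dsimp only [jHom]
  rw [Category.assoc, Category.assoc, ← R.isTwoSuperfunctor.map₂_comp, A.zeta_inv_hom,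
    R.isTwoSuperfunctor.map₂_id, Category.comp_id]

theorem jHom_jInv (a : A.Obj) : (jHom R a).1 ≫ (jInv R a).1 = 𝟙 _ := by
  dsimp only [jInv]
  rw [← Category.assoc, jHom_map_zeta, Category.assoc, ← Category.assoc (R.i a).hom,
    (R.isTwoSuperfunctor.i_inverse a).hom_inv, Category.id_comp, B.zeta_hom_inv]

theorem jInv_jHom (a : A.Obj) : (jInv R a).1 ≫ (jHom R a).1 = 𝟙 _ := by
  dsimp only [jInv, jHom]
  rw [Category.assoc, Category.assoc, ← Category.assoc (B.zeta _).inv, B.zeta_inv_hom,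
    Category.id_comp, ← Category.assoc (R.i a).inv, (R.isTwoSuperfunctor.i_inverse a).inv_hom,
    Category.id_comp, ← R.isTwoSuperfunctor.map₂_comp, A.zeta_hom_inv, R.isTwoSuperfunctor.map₂_id]

/-- A 2-superfunctor `R` carries `ζ_b f` to `ζ (R f)`, up to the coherence maps `c` and `j`; this is
`R ζ ∘ j = i ∘ ζ` whiskered with `f`. -/
theorem map_zr (f : a ⟶ b) :
    B.hcomp (𝟙 (R.map f)) (jHom R b).1 ≫ (R.c f (A.pi b)).hom ≫ R.map₂ (A.zr f) =
      B.zr (R.map f) := by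
  have hR := R.isTwoSuperfunctor
  have h := hR.c_naturality (𝟙 f) (A.zeta b).hom
  rw [hR.map₂_id] at h
  rw [zr, hR.map₂_comp, ← Category.assoc (R.c _ _).hom, ← h, Category.assoc, ← Category.assoc,
    ← B.whiskerLeft_comp, jHom_map_zeta, B.whiskerLeft_comp, Category.assoc, hR.map₂_runit, zr]

theorem map_zl (f : a ⟶ b) :
    B.hcomp (jHom R a).1 (𝟙 (R.map f)) ≫ (R.c (A.pi a) f).hom ≫ R.map₂ (A.zl f) =
      B.zl (R.map f) := by
  have hR := R.isTwoSuperfunctor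
  have h := hR.c_naturality (A.zeta a).hom (𝟙 f)
  rw [hR.map₂_id] at h
  rw [zl, hR.map₂_comp, ← Category.assoc (R.c _ _).hom, ← h, Category.assoc, ← Category.assoc,
    ← B.comp_whiskerRight, jHom_map_zeta, B.comp_whiskerRight, Category.assoc, hR.map₂_lunit, zl]

theorem isIso_map {f g : a ⟶ b} (x : f ⟶ g) [IsIso x] : IsIso (R.map₂ x) :=
  ⟨R.map₂ (inv x), by rw [← R.isTwoSuperfunctor.map₂_comp, IsIso.hom_inv_id,
    R.isTwoSuperfunctor.map₂_id], by rw [← R.isTwoSuperfunctor.map₂_comp, IsIso.inv_hom_id,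
    R.isTwoSuperfunctor.map₂_id]⟩

theorem isPiFunctor_underMap : IsPiFunctor (underMap R) := by
  have hR := R.isTwoSuperfunctor
  refine ⟨?_, ?_, ?_, ?_, ?_⟩
  · exact fun x y => TwoSupercat.EvenHom.ext (hR.map₂_add x.1 y.1)
  · exact fun r x => TwoSupercat.EvenHom.ext (hR.map₂_smul r x.1)
  · intro a
    exact .of_eq (TwoSupercat.EvenHom.ext (jHom_jInv R a))
      (TwoSupercat.EvenHom.ext (jInv_jHom R a))
  · intro a b f
    refine TwoSupercat.EvenHom.ext ?_
    show B.hcomp (𝟙 (R.map f)) (jHom R b).1 ≫ (R.c f (A.pi b)).hom ≫ R.map₂ (A.betaHom f).1 =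
      (B.betaHom (R.map f)).1 ≫ B.hcomp (jHom R a).1 (𝟙 (R.map f)) ≫ (R.c (A.pi a) f).hom
    have := isIso_map R (A.zl f)
    rw [← cancel_mono (R.map₂ (A.zl f))]
    simp only [Category.assoc]
    rw [← hR.map₂_comp, A.betaHom_zl, map_zr, map_zl, B.betaHom_zl]
  · intro a
    refine TwoSupercat.EvenHom.ext ?_
    show (B.hcomp (jHom R a).1 (𝟙 (B.pi (R.obj a))) ≫ B.hcomp (𝟙 (R.map (A.pi a))) (jHom R a).1) ≫
        (R.c (A.pi a) (A.pi a)).hom ≫ R.map₂ (A.xiHom a).1 =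
      (B.xiHom (R.obj a)).1 ≫ (R.i a).hom
    rw [← B.exchange_even_left _ (jHom R a).2, A.xiHom_eq, B.xiHom_eq, hR.map₂_comp,
      ← Category.assoc (R.c _ _).hom, ← Category.assoc, Category.assoc (B.hcomp _ _), map_zl,
      B.zl_naturality (jHom R a).2, Category.assoc, jHom_map_zeta, Category.assoc]

/-- The law of a Π-2-natural transformation is naturality of `x` at the odd 2-morphism `ζ_a`. -/
theorem isPiNat_underNat {R S : A ⟶ B} (X : PreTwoCategory.Hom₂ R S) : IsPiNat (underNat X) := by
  have hS := S.isTwoSuperfunctor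
  intro a
  refine TwoSupercat.EvenHom.ext ?_
  show (B.betaHom (X.app a)).1 ≫ B.hcomp (jHom R a).1 (𝟙 (X.app a)) ≫ X.naturality (A.pi a) =
    B.hcomp (𝟙 (X.app a)) (jHom S a).1
  have h1 := X.isTwoNat.naturality₂ (A.zeta a).hom
  have h2 := X.isTwoNat.naturality_id a
  have : IsIso (B.hcomp (𝟙 (X.app a)) (S.map₂ (A.zeta a).hom)) := by
    refine ⟨B.hcomp (𝟙 (X.app a)) (S.map₂ (A.zeta a).inv), ?_, ?_⟩
    · rw [← B.whiskerLeft_comp, ← hS.map₂_comp, A.zeta_hom_inv, hS.map₂_id, B.hcomp_id]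
    · rw [← B.whiskerLeft_comp, ← hS.map₂_comp, A.zeta_inv_hom, hS.map₂_id, B.hcomp_id]
  rw [← cancel_mono (B.hcomp (𝟙 (X.app a)) (S.map₂ (A.zeta a).hom)), Category.assoc,
    Category.assoc, ← h1, ← B.whiskerLeft_comp, jHom_map_zeta, B.whiskerLeft_comp, ← h2,
    ← Category.assoc (B.hcomp (jHom R a).1 _), ← B.comp_whiskerRight, jHom_map_zeta,
    B.comp_whiskerRight, Category.assoc, ← Category.assoc (B.hcomp (𝟙 (X.app a)) _),
    ← zr, ← B.betaHom_zl, zl]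
  simp only [Category.assoc]
  rw [← Category.assoc (B.lunit _).hom, B.lunit_hom_inv, Category.id_comp]

end PiTwoSupercat

theorem underlyingWellDefined : UnderlyingWellDefined.{w, v, u} k where
  obj A := A.isPiTwoCat_underData
  map R := PiTwoSupercat.isPiFunctor_underMap R
  nat X := PiTwoSupercat.isPiNat_underNat X

end Under

/-! ### Whiskered `β` and `ξ` in a Π-2-category -/

section Hat

variable {k : Type t} [CommRing k]

namespace PiTwoCatData

variable {A : PiTwoCatData.{w, v, u} k} {a b c d : A.Obj}

theorem whiskerLeft_add (f : a ⟶ b) {g h : b ⟶ c} (x y : g ⟶ h) :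
    f ◁ (x + y) = f ◁ x + f ◁ y :=
  LinearBicategory.whiskerLeft_add (k := k) f x y

theorem add_whiskerRight {f g : a ⟶ b} (x y : f ⟶ g) (h : b ⟶ c) :
    (x + y) ▷ h = x ▷ h + y ▷ h :=
  LinearBicategory.add_whiskerRight (k := k) x y h

theorem whiskerLeft_smul (f : a ⟶ b) {g h : b ⟶ c} (r : k) (x : g ⟶ h) :
    f ◁ (r • x) = r • f ◁ x :=
  LinearBicategory.whiskerLeft_smul f r x

theorem smul_whiskerRight {f g : a ⟶ b} (r : k) (x : f ⟶ g) (h : b ⟶ c) :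
    (r • x) ▷ h = r • x ▷ h :=
  LinearBicategory.smul_whiskerRight r x h

theorem whiskerLeft_neg (f : a ⟶ b) {g h : b ⟶ c} (x : g ⟶ h) : f ◁ (-x) = -f ◁ x := by
  rw [← neg_one_smul k, whiskerLeft_smul, neg_one_smul]

theorem neg_whiskerRight {f g : a ⟶ b} (x : f ⟶ g) (h : b ⟶ c) : (-x) ▷ h = -x ▷ h := by
  rw [← neg_one_smul k, smul_whiskerRight, neg_one_smul]

theorem whiskerLeft_sub (f : a ⟶ b) {g h : b ⟶ c} (x y : g ⟶ h) :
    f ◁ (x - y) = f ◁ x - f ◁ y := by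
  rw [sub_eq_add_neg, whiskerLeft_add, whiskerLeft_neg, sub_eq_add_neg]

theorem sub_whiskerRight {f g : a ⟶ b} (x y : f ⟶ g) (h : b ⟶ c) :
    (x - y) ▷ h = x ▷ h - y ▷ h := by
  rw [sub_eq_add_neg, add_whiskerRight, neg_whiskerRight, sub_eq_add_neg]

theorem whiskerLeft_zero (f : a ⟶ b) (g h : b ⟶ c) : f ◁ (0 : g ⟶ h) = 0 := by
  rw [← zero_smul k (0 : g ⟶ h), whiskerLeft_smul, zero_smul]

theorem zero_whiskerRight (f g : a ⟶ b) (h : b ⟶ c) : (0 : f ⟶ g) ▷ h = 0 := by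
  rw [← zero_smul k (0 : f ⟶ g), smul_whiskerRight, zero_smul]

theorem xiWhisker_naturality {f g : a ⟶ b} (x : f ⟶ g) :
    x ▷ A.pi b ▷ A.pi b ≫ A.xiWhisker g = A.xiWhisker f ≫ x := by
  unfold xiWhisker
  rw [associator_naturality_left_assoc, ← whisker_exchange_assoc, rightUnitor_naturality]
  simp only [Category.assoc]

theorem xiWhisker_comp (f : a ⟶ b) (g : b ⟶ c) :
    A.xiWhisker (f ≫ g) = (α_ f g (A.pi c)).hom ▷ A.pi c ≫ (α_ f (g ≫ A.pi c) (A.pi c)).hom ≫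
      f ◁ A.xiWhisker g := by
  unfold xiWhisker
  bicategory

theorem whiskerLeft_xiWhisker (h : a ⟶ b) (k : b ⟶ c) :
    (α_ h (k ≫ A.pi c) (A.pi c)).inv ≫ (α_ h k (A.pi c)).inv ▷ A.pi c ≫ A.xiWhisker (h ≫ k) =
      h ◁ A.xiWhisker k := by
  rw [xiWhisker_comp]
  simp

theorem betaWhisker_naturality_left {h h' : a ⟶ b} (x : h ⟶ h') (k : b ⟶ c) :
    x ▷ A.pi b ▷ k ≫ A.betaWhisker h' k = A.betaWhisker h k ≫ x ▷ k ▷ A.pi c := by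
  unfold betaWhisker
  rw [associator_naturality_left_assoc, ← whisker_exchange_assoc, associator_inv_naturality_left]
  simp only [Category.assoc]

theorem betaWhisker_whisker_middle (f : a ⟶ b) (g : b ⟶ c) (h : c ⟶ d) :
    (α_ f g (A.pi c)).inv ▷ h ≫ A.betaWhisker (f ≫ g) h ≫ (α_ f g h).hom ▷ A.pi d =
      (α_ f (g ≫ A.pi c) h).hom ≫ f ◁ A.betaWhisker g h ≫ (α_ f (g ≫ h) (A.pi d)).inv := by
  unfold betaWhisker
  bicategory

end PiTwoCatData

namespace IsPiTwoCat

open PiTwoCatData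

variable {A : PiTwoCatData.{w, v, u} k} (hA : IsPiTwoCat A) {a b c d : A.Obj}

include hA

theorem β_hom_inv (f : a ⟶ b) : (A.β f).hom ≫ (A.β f).inv = 𝟙 _ := (hA.β_inverse f).hom_inv

theorem β_inv_hom (f : a ⟶ b) : (A.β f).inv ≫ (A.β f).hom = 𝟙 _ := (hA.β_inverse f).inv_hom

/-- `β_f` as an isomorphism. -/
abbrev βIso (f : a ⟶ b) : f ≫ A.pi b ≅ A.pi a ≫ f :=
  ⟨(A.β f).hom, (A.β f).inv, hA.β_hom_inv f, hA.β_inv_hom f⟩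

theorem β_inv_naturality {f g : a ⟶ b} (x : f ⟶ g) :
    A.pi a ◁ x ≫ (A.β g).inv = (A.β f).inv ≫ x ▷ A.pi b := by
  have h := congrArg (fun z => (A.β f).inv ≫ z ≫ (A.β g).inv) (hA.β_naturality x)
  simpa [reassoc_of% hA.β_inv_hom, hA.β_hom_inv] using h.symm

theorem β_inv_comp (f : a ⟶ b) (g : b ⟶ c) :
    (A.β (f ≫ g)).inv = (α_ (A.pi a) f g).inv ≫ (A.β f).inv ▷ g ≫ (α_ f (A.pi b) g).hom ≫
      f ◁ (A.β g).inv ≫ (α_ f g (A.pi c)).inv := by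
  have h : hA.βIso (f ≫ g) = α_ f g (A.pi c) ≪≫ whiskerLeftIso f (hA.βIso g) ≪≫
      (α_ f (A.pi b) g).symm ≪≫ whiskerRightIso (hA.βIso f) g ≪≫ α_ (A.pi a) f g :=
    Iso.ext (hA.β_comp f g)
  have := congrArg Iso.inv h
  simpa using this

theorem β_inv_id (a : A.Obj) : (A.β (𝟙 a)).inv = (ρ_ (A.pi a)).hom ≫ (λ_ (A.pi a)).inv := by
  have h : hA.βIso (𝟙 a) = λ_ (A.pi a) ≪≫ (ρ_ (A.pi a)).symm := Iso.ext (hA.β_id a)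
  have := congrArg Iso.inv h
  simpa using this

theorem β_inv_pi (a : A.Obj) : (A.β (A.pi a)).inv = -𝟙 (A.pi a ≫ A.pi a) := by
  have := hA.β_hom_inv (A.pi a)
  rw [hA.β_pi, Preadditive.neg_comp, Category.id_comp] at this
  rw [← this, neg_neg]

/-- `ξ π = π ξ`: in the relation between `ξ` and `β` the two signs of `β_π = -1` cancel. -/
theorem xiWhisker_pi (a : A.Obj) :
    A.xiWhisker (A.pi a) = (A.ξ a).hom ▷ A.pi a ≫ (λ_ (A.pi a)).hom := by
  have := hA.ξ_β (A.pi a)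
  rw [hA.β_pi, neg_whiskerRight, whiskerLeft_neg] at this
  simpa [xiWhisker] using this

/-- `ξ_b (π_b f) = π_b (ξ_b f)`; this makes vertical composition of odd 2-morphisms associative. -/
theorem xiWhisker_comp_pi (f : a ⟶ b) :
    A.xiWhisker (f ≫ A.pi b) = A.xiWhisker f ▷ A.pi b := by
  rw [xiWhisker_comp, hA.xiWhisker_pi]
  unfold xiWhisker
  bicategory

theorem betaWhisker_naturality_right (h : a ⟶ b) {k k' : b ⟶ c} (y : k ⟶ k') :
    (h ≫ A.pi b) ◁ y ≫ A.betaWhisker h k' = A.betaWhisker h k ≫ (h ◁ y) ▷ A.pi c := by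
  have e : h ◁ A.pi b ◁ y ≫ h ◁ (A.β k').inv = h ◁ (A.β k).inv ≫ h ◁ y ▷ A.pi c := by
    rw [← Bicategory.whiskerLeft_comp, hA.β_inv_naturality, Bicategory.whiskerLeft_comp]
  unfold betaWhisker
  simp [reassoc_of% e]

/-- Sliding two copies of `π` past each other changes the sign: this is `β_π = -1`. -/
theorem betaWhisker_comp_pi (h : a ⟶ b) (k : b ⟶ c) :
    A.betaWhisker h (k ≫ A.pi c) ≫ (α_ h k (A.pi c)).inv ▷ A.pi c =
      -((α_ (h ≫ A.pi b) k (A.pi c)).inv ≫ A.betaWhisker h k ▷ A.pi c) := by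
  unfold betaWhisker
  rw [hA.β_inv_comp, hA.β_inv_pi, whiskerLeft_neg]
  simp only [Preadditive.neg_comp, Preadditive.comp_neg, whiskerLeft_neg]
  congr 1
  bicategory

/-- The relation between `ξ` and `β`, solved for `ξ_b`. -/
theorem whiskerLeft_β_inv_xiWhisker (k : b ⟶ c) :
    A.pi b ◁ (A.β k).inv ≫ (α_ (A.pi b) k (A.pi c)).inv ≫ (A.β k).inv ▷ A.pi c ≫ A.xiWhisker k =
      (α_ (A.pi b) (A.pi b) k).inv ≫ (A.ξ b).hom ▷ k ≫ (λ_ k).hom := by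
  have h : A.xiWhisker k = _ := hA.ξ_β k
  rw [h, ← comp_whiskerRight_assoc, hA.β_inv_hom, id_whiskerRight, Category.id_comp,
    Iso.inv_hom_id_assoc, ← Bicategory.whiskerLeft_comp_assoc, hA.β_inv_hom,
    Bicategory.whiskerLeft_id, Category.id_comp]

/-- Moving two copies of `π` past `k` and cancelling them by `ξ` is the same as cancelling them
first. -/
theorem betaWhisker_betaWhisker_xiWhisker (h : a ⟶ b) (k : b ⟶ c) :
    A.betaWhisker (h ≫ A.pi b) k ≫ A.betaWhisker h k ▷ A.pi c ≫ A.xiWhisker (h ≫ k) =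
      A.xiWhisker h ▷ k := by
  have e := congrArg (fun z => (α_ (h ≫ A.pi b) (A.pi b) k).hom ≫
    (α_ h (A.pi b) (A.pi b ≫ k)).hom ≫ h ◁ z) (hA.whiskerLeft_β_inv_xiWhisker k)
  rw [xiWhisker_comp]
  unfold betaWhisker
  trans
  · trans
    swap
    · exact e
    · bicategory
  · unfold xiWhisker
    bicategory

theorem betaWhisker_comp (f : a ⟶ b) (g : b ⟶ c) (h : c ⟶ d) :
    A.betaWhisker f g ▷ h ≫ A.betaWhisker (f ≫ g) h ≫ (α_ f g h).hom ▷ A.pi d =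
      (α_ (f ≫ A.pi b) g h).hom ≫ A.betaWhisker f (g ≫ h) := by
  unfold betaWhisker
  rw [hA.β_inv_comp]
  bicategory

theorem betaWhisker_id (f : a ⟶ b) :
    A.betaWhisker f (𝟙 b) ≫ (ρ_ f).hom ▷ A.pi b = (ρ_ (f ≫ A.pi b)).hom := by
  unfold betaWhisker
  rw [hA.β_inv_id]
  bicategory

end IsPiTwoCat

end Hat

/-! ### Vertical composition and whiskering of pairs of 2-morphisms -/

section Hat

variable {k : Type t} [CommRing k]

namespace PiTwoCatData

variable {A : PiTwoCatData.{w, v, u} k} {a b c d : A.Obj}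

/-- The even 2-morphism given by a 2-morphism of `A`. -/
def hatEven {f g : a ⟶ b} (x : f ⟶ g) : A.HatHom f g := (x, 0)

/-- Right whiskering in the associated 2-supercategory: `π` moves past `g` by `β_g⁻¹`. -/
def hatWhiskerRight {f f' : a ⟶ b} (x : A.HatHom f f') (g : b ⟶ c) :
    A.HatHom (f ≫ g) (f' ≫ g) :=
  (x.1 ▷ g, x.2 ▷ g ≫ A.betaWhisker f' g)

/-- Left whiskering in the associated 2-supercategory; no `β` is needed as `π` stays on the target
side. -/
def hatWhiskerLeft (f : a ⟶ b) {g g' : b ⟶ c} (y : A.HatHom g g') :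
    A.HatHom (f ≫ g) (f ≫ g') :=
  (f ◁ y.1, f ◁ y.2 ≫ (α_ f g' (A.pi c)).inv)

theorem hatComp_even_even {f g h : a ⟶ b} (x : f ⟶ g) (y : g ⟶ h) :
    hatComp (hatEven x) (hatEven y) = hatEven (x ≫ y) := by
  ext <;> simp [hatComp, hatEven, zero_whiskerRight]

theorem hatComp_even {f g h : a ⟶ b} (x : A.HatHom f g) (y : g ⟶ h) :
    hatComp x (hatEven y) = (x.1 ≫ y, x.2 ≫ y ▷ A.pi b) := by
  ext <;> simp [hatComp, hatEven, zero_whiskerRight]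

theorem even_hatComp {f g h : a ⟶ b} (x : f ⟶ g) (y : A.HatHom g h) :
    hatComp (hatEven x) y = (x ≫ y.1, x ≫ y.2) := by
  ext <;> simp [hatComp, hatEven]

theorem hatHcomp_even {f f' : a ⟶ b} {g g' : b ⟶ c} (x : f ⟶ f') (y : g ⟶ g') :
    hatHcomp (hatEven x) (hatEven y) = A.hatEven (x ▷ g ≫ f' ◁ y) := by
  ext <;> simp [hatHcomp, hatEven, zero_whiskerRight, whiskerLeft_zero]

theorem hatHcomp_id_right {f f' : a ⟶ b} (x : A.HatHom f f') (g : b ⟶ c) :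
    hatHcomp x (hatEven (𝟙 g)) = hatWhiskerRight x g := by
  ext <;> simp [hatHcomp, hatEven, hatWhiskerRight, whiskerLeft_zero]

theorem hatHcomp_id_left (f : a ⟶ b) {g g' : b ⟶ c} (y : A.HatHom g g') :
    hatHcomp (hatEven (𝟙 f)) y = hatWhiskerLeft f y := by
  ext <;> simp [hatHcomp, hatEven, hatWhiskerLeft, zero_whiskerRight]

theorem id_hatComp {f g : a ⟶ b} (x : A.HatHom f g) : hatComp (hatEven (𝟙 f)) x = x := by
  rw [even_hatComp]; simp

theorem hatComp_id {f g : a ⟶ b} (x : A.HatHom f g) : hatComp x (hatEven (𝟙 g)) = x := by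
  rw [hatComp_even]; simp

theorem hatWhiskerRight_even {f f' : a ⟶ b} (x : f ⟶ f') (g : b ⟶ c) :
    hatWhiskerRight (hatEven x) g = A.hatEven (x ▷ g) := by
  ext <;> simp [hatEven, hatWhiskerRight, zero_whiskerRight]

theorem hatWhiskerLeft_even (f : a ⟶ b) {g g' : b ⟶ c} (y : g ⟶ g') :
    hatWhiskerLeft f (hatEven y) = A.hatEven (f ◁ y) := by
  ext <;> simp [hatEven, hatWhiskerLeft, whiskerLeft_zero]

theorem hatWhiskerLeft_comp (f : a ⟶ b) {g h i : b ⟶ c} (x : A.HatHom g h) (y : A.HatHom h i) :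
    hatWhiskerLeft f (hatComp x y) = hatComp (hatWhiskerLeft f x) (hatWhiskerLeft f y) := by
  ext
  · simp [hatComp, hatWhiskerLeft, whiskerLeft_sub, whiskerLeft_xiWhisker]
  · simp [hatComp, hatWhiskerLeft, whiskerLeft_add]

theorem hat_exchange_even_left {f f' : a ⟶ b} {g g' : b ⟶ c} (x : f ⟶ f')
    (y : A.HatHom g g') :
    hatComp (hatWhiskerLeft f y) (hatWhiskerRight (hatEven x) g') =
      hatComp (hatWhiskerRight (hatEven x) g) (hatWhiskerLeft f' y) := by
  rw [hatWhiskerRight_even, hatWhiskerRight_even, hatComp_even, even_hatComp]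
  -- here and below whiskerings by composites stay unexpanded, so that `whisker_exchange` applies
  ext <;> simp [-comp_whiskerLeft, -whisker_assoc, -whiskerRight_comp, hatWhiskerLeft,
    whisker_exchange_assoc, whisker_exchange, ← associator_inv_naturality_left]

theorem mem_hatDeg_zero {f g : a ⟶ b} {x : A.HatHom f g} :
    x ∈ A.hatData.deg f g 0 ↔ x.2 = 0 := by
  simp only [hatData, if_true]
  exact ⟨fun h => h.2, fun h => ⟨trivial, h⟩⟩

theorem mem_hatDeg_one {f g : a ⟶ b} {x : A.HatHom f g} :
    x ∈ A.hatData.deg f g 1 ↔ x.1 = 0 := by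
  simp only [hatData, one_ne_zero, if_false]
  exact ⟨fun h => h.1, fun h => ⟨h, trivial⟩⟩

theorem hatEven_mem {f g : a ⟶ b} (x : f ⟶ g) : hatEven x ∈ A.hatData.deg f g 0 :=
  mem_hatDeg_zero.2 rfl

end PiTwoCatData

namespace IsPiTwoCat

open PiTwoCatData

variable {A : PiTwoCatData.{w, v, u} k} (hA : IsPiTwoCat A) {a b c d : A.Obj}

include hA

theorem hatComp_assoc {f g h i : a ⟶ b} (x : A.HatHom f g) (y : A.HatHom g h) (z : A.HatHom h i) :
    hatComp (hatComp x y) z = hatComp x (hatComp y z) := by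
  ext
  · simp [hatComp, sub_whiskerRight, add_whiskerRight, xiWhisker_naturality]
    abel
  · simp [hatComp, sub_whiskerRight, add_whiskerRight, ← hA.xiWhisker_comp_pi,
      xiWhisker_naturality]
    abel

theorem hatWhiskerRight_comp {f g h : a ⟶ b} (x : A.HatHom f g) (y : A.HatHom g h) (i : b ⟶ c) :
    hatWhiskerRight (hatComp x y) i = hatComp (hatWhiskerRight x i) (hatWhiskerRight y i) := by
  ext
  · simp [hatComp, hatWhiskerRight, sub_whiskerRight,
      ← reassoc_of% betaWhisker_naturality_left, hA.betaWhisker_betaWhisker_xiWhisker]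
  · simp [hatComp, hatWhiskerRight, add_whiskerRight, betaWhisker_naturality_left]

/-- Horizontal composition is whiskering followed by whiskering, so that the laws of horizontal
composition reduce to those of the two whiskerings. The signs in the vertical composite of two odd
2-morphisms and in `β_π = -1` cancel. -/
theorem hatHcomp_eq {f f' : a ⟶ b} {g g' : b ⟶ c} (x : A.HatHom f f') (y : A.HatHom g g') :
    hatHcomp x y = hatComp (hatWhiskerRight x g) (hatWhiskerLeft f' y) := by
  ext
  · simp [-comp_whiskerLeft, -whisker_assoc, -whiskerRight_comp, hatHcomp, hatComp,
      hatWhiskerRight, hatWhiskerLeft, ← reassoc_of% hA.betaWhisker_naturality_right,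
      reassoc_of% hA.betaWhisker_comp_pi]
  · simp [-comp_whiskerLeft, -whisker_assoc, -whiskerRight_comp, hatHcomp, hatComp,
      hatWhiskerRight, hatWhiskerLeft, hA.betaWhisker_naturality_right]

theorem hat_exchange_even_right {f f' : a ⟶ b} {g g' : b ⟶ c} (x : A.HatHom f f')
    (y : g ⟶ g') :
    hatComp (hatWhiskerLeft f (hatEven y)) (hatWhiskerRight x g') =
      hatComp (hatWhiskerRight x g) (hatWhiskerLeft f' (hatEven y)) := by
  rw [hatWhiskerLeft_even, hatWhiskerLeft_even, hatComp_even, even_hatComp]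
  ext
  · simp [-comp_whiskerLeft, -whisker_assoc, -whiskerRight_comp, hatWhiskerRight,
      whisker_exchange]
  · simp [-comp_whiskerLeft, -whisker_assoc, -whiskerRight_comp, hatWhiskerRight,
      whisker_exchange_assoc, hA.betaWhisker_naturality_right]

/-- Super interchange for two odd 2-morphisms: the sign is that of `β_π = -1`. -/
theorem hat_exchange_odd {f f' : a ⟶ b} {g g' : b ⟶ c} (x : f ⟶ f' ≫ A.pi b)
    (y : g ⟶ g' ≫ A.pi c) :
    hatComp (hatWhiskerLeft f (0, y)) (hatWhiskerRight ((0, x) : A.HatHom f f') g') =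
      -hatComp (hatWhiskerRight ((0, x) : A.HatHom f f') g) (hatWhiskerLeft f' (0, y)) := by
  ext
  · simp [-comp_whiskerLeft, -whisker_assoc, -whiskerRight_comp, hatComp, hatWhiskerRight,
      hatWhiskerLeft, whiskerLeft_zero, zero_whiskerRight,
      ← reassoc_of% hA.betaWhisker_naturality_right, reassoc_of% hA.betaWhisker_comp_pi,
      whisker_exchange_assoc, ← reassoc_of% associator_inv_naturality_left]
  · simp [-comp_whiskerLeft, -whisker_assoc, -whiskerRight_comp, hatComp, hatWhiskerRight,
      hatWhiskerLeft, whiskerLeft_zero, zero_whiskerRight]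

end IsPiTwoCat
end Hat

/-! ### The associated Π-2-supercategory of a Π-2-category -/

section Hat

variable {k : Type t} [CommRing k]

namespace PiTwoCatData

variable {A : PiTwoCatData.{w, v, u} k} {a b c d : A.Obj}

theorem hatWhiskerRight_assoc_middle (f : a ⟶ b) {g g' : b ⟶ c} (y : A.HatHom g g') (h : c ⟶ d) :
    hatComp (hatWhiskerRight (hatWhiskerLeft f y) h) (hatEven (α_ f g' h).hom) =
      hatComp (hatEven (α_ f g h).hom) (hatWhiskerLeft f (hatWhiskerRight y h)) := by
  rw [hatComp_even, even_hatComp]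
  ext
  · simp [hatWhiskerRight, hatWhiskerLeft]
  · simp [hatWhiskerRight, hatWhiskerLeft, betaWhisker_whisker_middle]

theorem hatWhiskerLeft_assoc (f : a ⟶ b) (g : b ⟶ c) {h h' : c ⟶ d} (z : A.HatHom h h') :
    hatComp (hatWhiskerLeft (f ≫ g) z) (hatEven (α_ f g h').hom) =
      hatComp (hatEven (α_ f g h).hom) (hatWhiskerLeft f (hatWhiskerLeft g z)) := by
  rw [hatComp_even, even_hatComp]
  ext <;> simp [hatWhiskerLeft]

theorem hatWhiskerLeft_lunit {f g : a ⟶ b} (x : A.HatHom f g) :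
    hatComp (hatWhiskerLeft (𝟙 a) x) (hatEven (λ_ g).hom) = hatComp (hatEven (λ_ f).hom) x := by
  rw [hatComp_even, even_hatComp]
  ext <;> simp [hatWhiskerLeft]

theorem hatComp_add {f g h : a ⟶ b} (x : A.HatHom f g) (y y' : A.HatHom g h) :
    hatComp x (y + y') = hatComp x y + hatComp x y' := by
  ext <;> simp [hatComp, add_whiskerRight] <;> abel

theorem add_hatComp {f g h : a ⟶ b} (x x' : A.HatHom f g) (y : A.HatHom g h) :
    hatComp (x + x') y = hatComp x y + hatComp x' y := by
  ext <;> simp [hatComp] <;> abel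

theorem hatComp_smul {f g h : a ⟶ b} (r : k) (x : A.HatHom f g) (y : A.HatHom g h) :
    hatComp x (r • y) = r • hatComp x y := by
  ext <;> simp [hatComp, smul_whiskerRight, smul_sub]

theorem smul_hatComp {f g h : a ⟶ b} (r : k) (x : A.HatHom f g) (y : A.HatHom g h) :
    hatComp (r • x) y = r • hatComp x y := by
  ext <;> simp [hatComp, smul_sub]

theorem hatComp_mem {f g h : a ⟶ b} {p q : ZMod 2} {x : A.HatHom f g} {y : A.HatHom g h}
    (hx : x ∈ A.hatData.deg f g p) (hy : y ∈ A.hatData.deg g h q) :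
    hatComp x y ∈ A.hatData.deg f h (p + q) := by
  fin_cases p <;> fin_cases q
  · exact mem_hatDeg_zero.2 (by simp [hatComp, mem_hatDeg_zero.1 hx, mem_hatDeg_zero.1 hy])
  · exact mem_hatDeg_one.2 (by simp [hatComp, mem_hatDeg_zero.1 hx, mem_hatDeg_one.1 hy])
  · exact mem_hatDeg_one.2 (by simp [hatComp, mem_hatDeg_one.1 hx, mem_hatDeg_zero.1 hy,
      zero_whiskerRight])
  · exact mem_hatDeg_zero.2 (by simp [hatComp, mem_hatDeg_one.1 hx, mem_hatDeg_one.1 hy,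
      zero_whiskerRight])

theorem hatHcomp_mem {f f' : a ⟶ b} {g g' : b ⟶ c} {p q : ZMod 2} {x : A.HatHom f f'}
    {y : A.HatHom g g'} (hx : x ∈ A.hatData.deg f f' p) (hy : y ∈ A.hatData.deg g g' q) :
    hatHcomp x y ∈ A.hatData.deg (f ≫ g) (f' ≫ g') (p + q) := by
  fin_cases p <;> fin_cases q
  · exact mem_hatDeg_zero.2 (by simp [hatHcomp, mem_hatDeg_zero.1 hx, mem_hatDeg_zero.1 hy,
      zero_whiskerRight, whiskerLeft_zero])
  · exact mem_hatDeg_one.2 (by simp [hatHcomp, mem_hatDeg_zero.1 hx, mem_hatDeg_one.1 hy,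
      zero_whiskerRight, whiskerLeft_zero])
  · exact mem_hatDeg_one.2 (by simp [-comp_whiskerLeft, hatHcomp, mem_hatDeg_one.1 hx,
      mem_hatDeg_zero.1 hy, zero_whiskerRight, whiskerLeft_zero])
  · exact mem_hatDeg_zero.2 (by simp [-comp_whiskerLeft, hatHcomp, mem_hatDeg_one.1 hx,
      mem_hatDeg_one.1 hy, zero_whiskerRight, whiskerLeft_zero])

theorem isCompl_hatDeg (f g : a ⟶ b) :
    IsCompl (Submodule.prod ⊤ ⊥ : Submodule k (A.HatHom f g)) (Submodule.prod ⊥ ⊤) := by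
  constructor
  · rw [Submodule.disjoint_def]
    exact fun x h0 h1 => Prod.ext h1.1 h0.2
  · rw [codisjoint_iff, eq_top_iff]
    intro x _
    have : x = ((x.1, 0) : A.HatHom f g) + ((0, x.2) : A.HatHom f g) := by ext <;> simp
    rw [this]
    exact Submodule.add_mem_sup ⟨trivial, rfl⟩ ⟨rfl, trivial⟩

theorem xiWhisker_id (a : A.Obj) :
    (λ_ (A.pi a)).inv ▷ A.pi a ≫ A.xiWhisker (𝟙 a) = (A.ξ a).hom := by
  unfold xiWhisker
  rw [id_whiskerLeft]
  simp

theorem hatIso_isInverse {f g : a ⟶ b} (e : f ≅ g) :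
    @InvPair.IsInverse (a ⟶ b) (A.hatHomStruct a b) f g (A.hatIso e) :=
  .of_eq ((hatComp_even_even e.hom e.inv).trans (congrArg hatEven e.hom_inv_id))
    ((hatComp_even_even e.inv e.hom).trans (congrArg hatEven e.inv_hom_id))

theorem add_hatHcomp {f f' : a ⟶ b} {g g' : b ⟶ c} (x x' : A.HatHom f f') (y : A.HatHom g g') :
    hatHcomp (x + x') y = hatHcomp x y + hatHcomp x' y := by
  ext <;> simp [-comp_whiskerLeft, hatHcomp, add_whiskerRight] <;> abel

theorem hatHcomp_add {f f' : a ⟶ b} {g g' : b ⟶ c} (x : A.HatHom f f') (y y' : A.HatHom g g') :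
    hatHcomp x (y + y') = hatHcomp x y + hatHcomp x y' := by
  ext <;> simp [-comp_whiskerLeft, hatHcomp, whiskerLeft_add] <;> abel

theorem smul_hatHcomp {f f' : a ⟶ b} {g g' : b ⟶ c} (r : k) (x : A.HatHom f f')
    (y : A.HatHom g g') : hatHcomp (r • x) y = r • hatHcomp x y := by
  ext <;> simp [-comp_whiskerLeft, hatHcomp, smul_whiskerRight]

theorem hatHcomp_smul {f f' : a ⟶ b} {g g' : b ⟶ c} (r : k) (x : A.HatHom f f')
    (y : A.HatHom g g') : hatHcomp x (r • y) = r • hatHcomp x y := by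
  ext <;> simp [-comp_whiskerLeft, hatHcomp, whiskerLeft_smul]

end PiTwoCatData

namespace IsPiTwoCat

open PiTwoCatData

variable {A : PiTwoCatData.{w, v, u} k} (hA : IsPiTwoCat A) {a b c d : A.Obj}

include hA

theorem hatWhiskerRight_assoc {f f' : a ⟶ b} (x : A.HatHom f f') (g : b ⟶ c) (h : c ⟶ d) :
    hatComp (hatWhiskerRight (hatWhiskerRight x g) h) (hatEven (α_ f' g h).hom) =
      hatComp (hatEven (α_ f g h).hom) (hatWhiskerRight x (g ≫ h)) := by
  rw [hatComp_even, even_hatComp]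
  ext
  · simp [hatWhiskerRight]
  · simp [hatWhiskerRight, hA.betaWhisker_comp]

theorem hatWhiskerRight_runit {f g : a ⟶ b} (x : A.HatHom f g) :
    hatComp (hatWhiskerRight x (𝟙 b)) (hatEven (ρ_ g).hom) = hatComp (hatEven (ρ_ f).hom) x := by
  rw [hatComp_even, even_hatComp]
  ext
  · simp [hatWhiskerRight]
  · simp only [hatWhiskerRight, Category.assoc, hA.betaWhisker_id, rightUnitor_naturality]

theorem hatHcomp_assoc {f f' : a ⟶ b} {g g' : b ⟶ c} {h h' : c ⟶ d} (x : A.HatHom f f')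
    (y : A.HatHom g g') (z : A.HatHom h h') :
    hatComp (hatHcomp (hatHcomp x y) z) (hatEven (α_ f' g' h').hom) =
      hatComp (hatEven (α_ f g h).hom) (hatHcomp x (hatHcomp y z)) := by
  rw [hA.hatHcomp_eq, hA.hatHcomp_eq, hA.hatHcomp_eq, hA.hatHcomp_eq, hA.hatComp_assoc,
    hatWhiskerLeft_assoc, hA.hatWhiskerRight_comp, hA.hatComp_assoc,
    ← hA.hatComp_assoc (hatWhiskerRight _ _) (hatEven _), hatWhiskerRight_assoc_middle,
    hA.hatComp_assoc (hatEven _), ← hA.hatComp_assoc _ (hatEven _), hA.hatWhiskerRight_assoc,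
    hA.hatComp_assoc, hatWhiskerLeft_comp]

theorem hat_interchange {f f' f'' : a ⟶ b} {g g' g'' : b ⟶ c} {p q : ZMod 2}
    (x : A.HatHom f f') {u : A.HatHom f' f''} {y : A.HatHom g g'} (v : A.HatHom g' g'')
    (hu : u ∈ A.hatData.deg f' f'' p) (hy : y ∈ A.hatData.deg g g' q) :
    hatComp (hatHcomp x y) (hatHcomp u v) =
      (-1 : k) ^ (p.val * q.val) • hatHcomp (hatComp x u) (hatComp y v) := by
  -- only the middle two whiskerings of the four have to be exchanged
  have key : hatComp (hatWhiskerLeft f' y) (hatWhiskerRight u g') =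
      (-1 : k) ^ (p.val * q.val) • hatComp (hatWhiskerRight u g) (hatWhiskerLeft f'' y) := by
    obtain ⟨u0, u1⟩ := u
    obtain ⟨y0, y1⟩ := y
    have v0 : ZMod.val (n := 2) 0 = 0 := rfl
    have v1 : ZMod.val (n := 2) 1 = 1 := rfl
    fin_cases p
    · obtain rfl : u1 = 0 := mem_hatDeg_zero.1 hu
      have : (-1 : k) ^ (ZMod.val (n := 2) 0 * q.val) = 1 := by rw [v0, zero_mul, pow_zero]
      exact (hat_exchange_even_left u0 (y0, y1)).trans
        ((congrArg (· • _) this).trans (one_smul k _)).symm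
    · fin_cases q
      · obtain rfl : y1 = 0 := mem_hatDeg_zero.1 hy
        have : (-1 : k) ^ (ZMod.val (n := 2) 1 * ZMod.val (n := 2) 0) = 1 := by
          rw [v0, mul_zero, pow_zero]
        exact (hA.hat_exchange_even_right (u0, u1) y0).trans
          ((congrArg (· • _) this).trans (one_smul k _)).symm
      · obtain rfl : u0 = 0 := mem_hatDeg_one.1 hu
        obtain rfl : y0 = 0 := mem_hatDeg_one.1 hy
        have : (-1 : k) ^ (ZMod.val (n := 2) 1 * ZMod.val (n := 2) 1) = -1 := by
          rw [v1, one_mul, pow_one]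
        exact (hA.hat_exchange_odd u1 y1).trans
          ((congrArg (· • _) this).trans (neg_one_smul k _)).symm
  rw [hA.hatHcomp_eq, hA.hatHcomp_eq, hA.hatHcomp_eq, hA.hatComp_assoc,
    ← hA.hatComp_assoc (hatWhiskerLeft _ _), key, smul_hatComp, hatComp_smul,
    hA.hatWhiskerRight_comp, hatWhiskerLeft_comp]
  simp only [hA.hatComp_assoc]

theorem isSupercategory_hat (a b : A.Obj) :
    @IsSupercategory k _ (a ⟶ b) (A.hatHomStruct a b) A.hatData.homAdd A.hatData.homMod
      (fun f g => A.hatData.deg f g) :=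
  @IsSupercategory.mk k _ (a ⟶ b) (A.hatHomStruct a b) A.hatData.homAdd A.hatData.homMod
    (fun f g => A.hatData.deg f g)
    (fun x => id_hatComp x) (fun x => hatComp_id x) (fun x y z => hA.hatComp_assoc x y z)
    (fun x x' y => add_hatComp x x' y) (fun x y y' => hatComp_add x y y')
    (fun r x y => smul_hatComp r x y) (fun r x y => hatComp_smul r x y)
    (fun f g => isCompl_hatDeg f g) (fun f => hatEven_mem (𝟙 f)) (fun hx hy => hatComp_mem hx hy)

theorem isTwoSupercat_hatData : IsTwoSupercat A.hatData.toTwoSupercatData where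
  hom a b := hA.isSupercategory_hat a b
  add_hcomp x x' y := add_hatHcomp x x' y
  hcomp_add x y y' := hatHcomp_add x y y'
  smul_hcomp r x y := smul_hatHcomp r x y
  hcomp_smul r x y := hatHcomp_smul r x y
  hcomp_mem hx hy := hatHcomp_mem hx hy
  hcomp_id f g := (hatHcomp_even (𝟙 _) (𝟙 _)).trans (congrArg hatEven (by simp))
  interchange x _ _ v hu hy := hA.hat_interchange x v hu hy
  assoc_inverse f g h := hatIso_isInverse (α_ f g h)
  assoc_mem f g h := hatEven_mem (α_ f g h).hom
  assoc_naturality x y z := hA.hatHcomp_assoc x y z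
  lunit_inverse f := hatIso_isInverse (λ_ f)
  lunit_mem f := hatEven_mem (λ_ f).hom
  lunit_naturality x := (congrArg (hatComp · _) (hatHcomp_id_left _ x)).trans
    (hatWhiskerLeft_lunit x)
  runit_inverse f := hatIso_isInverse (ρ_ f)
  runit_mem f := hatEven_mem (ρ_ f).hom
  runit_naturality x := (congrArg (hatComp · _) (hatHcomp_id_right x _)).trans
    (hA.hatWhiskerRight_runit x)
  pentagon f g h i := by
    show hatComp (hatHcomp (hatEven (α_ f g h).hom) (hatEven (𝟙 i)))
        (hatComp (hatEven (α_ f (g ≫ h) i).hom)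
          (hatHcomp (hatEven (𝟙 f)) (hatEven (α_ g h i).hom))) =
      hatComp (hatEven (α_ (f ≫ g) h i).hom) (hatEven (α_ f g (h ≫ i)).hom)
    simp only [hatHcomp_even, hatComp_even_even]
    congr 1
    simp
  triangle f g := by
    show hatComp (hatEven (α_ f (𝟙 _) g).hom) (hatHcomp (hatEven (𝟙 f)) (hatEven (λ_ g).hom)) =
      hatHcomp (hatEven (ρ_ f).hom) (hatEven (𝟙 g))
    simp only [hatHcomp_even, hatComp_even_even]
    congr 1
    simp

theorem isPiTwoSupercat_hatData : IsPiTwoSupercat A.hatData where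
  isTwoSupercat := hA.isTwoSupercat_hatData
  zeta_inverse a := by
    refine .of_eq ?_ ?_
    · show hatComp ((0, (λ_ (A.pi a)).inv) : A.HatHom (A.pi a) (𝟙 a))
        ((0, -(A.ξ a).inv) : A.HatHom (𝟙 a) (A.pi a)) = hatEven (𝟙 (A.pi a))
      ext
      · simp [hatComp, hatEven, neg_whiskerRight, hA.xiWhisker_pi,
          ← comp_whiskerRight_assoc, (hA.ξ_inverse a).inv_hom]
      · simp [hatComp, hatEven, neg_whiskerRight, zero_whiskerRight]
    · show hatComp ((0, -(A.ξ a).inv) : A.HatHom (𝟙 a) (A.pi a))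
        ((0, (λ_ (A.pi a)).inv) : A.HatHom (A.pi a) (𝟙 a)) = hatEven (𝟙 (𝟙 a))
      ext
      · simp [-leftUnitor_inv_whiskerRight, hatComp, hatEven, xiWhisker_id,
          (hA.ξ_inverse a).inv_hom]
      · simp [hatComp, hatEven, zero_whiskerRight]
  zeta_mem a := mem_hatDeg_one.2 rfl

end IsPiTwoCat
end Hat

/-! ### Associated 2-superfunctors and 2-natural transformations -/

section Hat

variable {k : Type t} [CommRing k]

theorem map₂_associator_mapComp {B : Type u} [Bicategory.{w, v} B] {C : Type u}
    [Bicategory.{w, v} C] (R : Pseudofunctor B C) {a b c d : B} (f : a ⟶ b) (g : b ⟶ c)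
    (h : c ⟶ d) :
    R.map₂ (α_ f g h).hom ≫ (R.mapComp f (g ≫ h)).hom ≫ R.map f ◁ (R.mapComp g h).hom =
      (R.mapComp (f ≫ g) h).hom ≫ (R.mapComp f g).hom ▷ R.map h ≫
        (α_ (R.map f) (R.map g) (R.map h)).hom := by
  simp

theorem map₂_associator_inv_mapComp {B : Type u} [Bicategory.{w, v} B] {C : Type u}
    [Bicategory.{w, v} C] (R : Pseudofunctor B C) {a b c d : B} (f : a ⟶ b) (g : b ⟶ c)
    (h : c ⟶ d) :
    R.map₂ (α_ f g h).inv ≫ (R.mapComp (f ≫ g) h).hom ≫ (R.mapComp f g).hom ▷ R.map h =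
      (R.mapComp f (g ≫ h)).hom ≫ R.map f ◁ (R.mapComp g h).hom ≫
        (α_ (R.map f) (R.map g) (R.map h)).inv := by
  have h1 := congrArg (fun z => R.map₂ (α_ f g h).inv ≫ z ≫
    (α_ (R.map f) (R.map g) (R.map h)).inv) (map₂_associator_mapComp R f g h)
  have h2 : R.map₂ (α_ f g h).inv ≫ R.map₂ (α_ f g h).hom = 𝟙 _ := by
    rw [← R.map₂_comp, Iso.inv_hom_id, R.map₂_id]
  simp only [Category.assoc, reassoc_of% h2, Iso.hom_inv_id, Category.comp_id] at h1
  exact h1.symm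

theorem map₂_whiskerLeft_mapComp {B : Type u} [Bicategory.{w, v} B] {C : Type u}
    [Bicategory.{w, v} C] (R : Pseudofunctor B C) {a b c : B} (f : a ⟶ b) {g h : b ⟶ c}
    (x : g ⟶ h) :
    R.map₂ (f ◁ x) ≫ (R.mapComp f h).hom = (R.mapComp f g).hom ≫ R.map f ◁ R.map₂ x := by
  simp

theorem map₂_whiskerRight_mapComp {B : Type u} [Bicategory.{w, v} B] {C : Type u}
    [Bicategory.{w, v} C] (R : Pseudofunctor B C) {a b c : B} {f g : a ⟶ b} (x : f ⟶ g)
    (h : b ⟶ c) :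
    R.map₂ (x ▷ h) ≫ (R.mapComp g h).hom = (R.mapComp f h).hom ≫ R.map₂ x ▷ R.map h := by
  simp

namespace PiFunctorData

open PiTwoCatData

variable {A B : PiTwoCatData.{w, v, u} k} (R : PiFunctorData A B) {a b c d : A.Obj}

/-- `j⁻¹ (R g) ∘ c⁻¹`, from `R (π_b g)` to `π_{R b} (R g)` in the usual notation. -/
def pullPi (g : a ⟶ b) : R.map (g ≫ A.pi b) ⟶ R.map g ≫ B.pi (R.obj b) :=
  (R.mapComp g (A.pi b)).hom ≫ R.map g ◁ (R.j b).inv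

/-- The action of the associated 2-superfunctor on 2-morphisms. -/
def hatMap₂ {f g : a ⟶ b} (x : A.HatHom f g) : B.HatHom (R.map f) (R.map g) :=
  (R.map₂ x.1, R.map₂ x.2 ≫ R.pullPi g)

theorem pullPi_naturality {f g : a ⟶ b} (x : f ⟶ g) :
    R.map₂ (x ▷ A.pi b) ≫ R.pullPi g = R.pullPi f ≫ R.map₂ x ▷ B.pi (R.obj b) := by
  unfold pullPi
  rw [reassoc_of% map₂_whiskerRight_mapComp R.toPseudofunctor, ← whisker_exchange,
    Category.assoc]

theorem pullPi_comp (f : a ⟶ b) (g : b ⟶ c) :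
    R.map₂ (α_ f g (A.pi c)).inv ≫ R.pullPi (f ≫ g) ≫ (R.mapComp f g).hom ▷ B.pi (R.obj c) =
      (R.mapComp f (g ≫ A.pi c)).hom ≫ R.map f ◁ R.pullPi g ≫
        (α_ (R.map f) (R.map g) (B.pi (R.obj c))).inv := by
  unfold pullPi
  rw [Category.assoc, whisker_exchange,
    reassoc_of% map₂_associator_inv_mapComp R.toPseudofunctor]
  simp

theorem hatMap₂_whiskerLeft (f : a ⟶ b) {g g' : b ⟶ c} (y : A.HatHom g g') :
    hatComp (hatWhiskerLeft (R.map f) (R.hatMap₂ y)) (hatEven (R.mapComp f g').inv) =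
      hatComp (hatEven (R.mapComp f g).inv) (R.hatMap₂ (hatWhiskerLeft f y)) := by
  rw [hatComp_even, even_hatComp]
  ext
  · simp [hatMap₂, hatWhiskerLeft]
  · have h := congrArg (· ≫ (R.mapComp f g').inv ▷ B.pi _) (R.pullPi_comp f g')
    simp only [Category.assoc, ← comp_whiskerRight, Iso.hom_inv_id, id_whiskerRight,
      Category.comp_id] at h
    simp [-comp_whiskerRight, hatMap₂, hatWhiskerLeft, h]

end PiFunctorData

namespace IsPiFunctor

open PiTwoCatData

variable {A B : PiTwoCatData.{w, v, u} k} {R : PiFunctorData A B} (hR : IsPiFunctor R)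
  (hA : IsPiTwoCat A) (hB : IsPiTwoCat B) {a b c d : A.Obj}

include hR

/-- The law that relates `j` and `ξ`, solved for the image of `ξ_a`. -/
theorem map₂_ξ (a : A.Obj) :
    R.map₂ (A.ξ a).hom ≫ (R.mapId a).hom = R.pullPi (A.pi a) ≫ (R.j a).inv ▷ B.pi (R.obj a) ≫
      (B.ξ (R.obj a)).hom := by
  have h := congrArg (fun z => R.pullPi (A.pi a) ≫ (R.j a).inv ▷ B.pi (R.obj a) ≫ z ≫
    (R.mapId a).hom) (hR.j_ξ a)
  simp only [PiFunctorData.pullPi, Category.assoc, Iso.inv_hom_id, Category.comp_id] at h ⊢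
  rw [← h, ← comp_whiskerRight_assoc, (hR.j_inverse a).inv_hom, id_whiskerRight,
    Category.id_comp, ← Bicategory.whiskerLeft_comp_assoc, (hR.j_inverse a).inv_hom,
    Bicategory.whiskerLeft_id, Category.id_comp, Iso.hom_inv_id_assoc]

theorem map₂_xiWhisker (h : a ⟶ b) :
    R.map₂ (A.xiWhisker h) =
      R.pullPi (h ≫ A.pi b) ≫ R.pullPi h ▷ B.pi (R.obj b) ≫ B.xiWhisker (R.map h) := by
  unfold xiWhisker
  rw [R.map₂_comp, R.map₂_comp, R.map₂_right_unitor,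
    reassoc_of% map₂_whiskerLeft_mapComp R.toPseudofunctor,
    ← Bicategory.whiskerLeft_comp_assoc, hR.map₂_ξ]
  simp only [PiFunctorData.pullPi, Bicategory.whiskerLeft_comp, comp_whiskerRight, Category.assoc]
  rw [reassoc_of% map₂_associator_mapComp R.toPseudofunctor, whisker_exchange_assoc]
  simp

section

include hA hB

/-- The law that relates `j` and `β`, solved for the image of `β_k⁻¹`. -/
theorem map₂_β_inv (k : b ⟶ c) :
    R.map₂ (A.β k).inv ≫ R.pullPi k =
      (R.mapComp (A.pi b) k).hom ≫ (R.j b).inv ▷ R.map k ≫ (B.β (R.map k)).inv := by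
  have h := congrArg (fun z => (R.mapComp (A.pi b) k).hom ≫ (R.j b).inv ▷ R.map k ≫
    (B.β (R.map k)).inv ≫ z ≫ R.map₂ (A.β k).inv ≫ (R.mapComp k (A.pi c)).hom ≫
      R.map k ◁ (R.j c).inv) (hR.j_β k)
  have e : R.map₂ (A.β k).hom ≫ R.map₂ (A.β k).inv = 𝟙 _ := by
    rw [← R.map₂_comp, hA.β_hom_inv, R.map₂_id]
  have e1 : R.map k ◁ (R.j c).hom ≫ R.map k ◁ (R.j c).inv = 𝟙 _ := by
    rw [← Bicategory.whiskerLeft_comp, (hR.j_inverse c).hom_inv, Bicategory.whiskerLeft_id]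
  have e2 : (R.j b).inv ▷ R.map k ≫ (R.j b).hom ▷ R.map k = 𝟙 _ := by
    rw [← comp_whiskerRight, (hR.j_inverse b).inv_hom, id_whiskerRight]
  simp only [Category.assoc, reassoc_of% e, Iso.inv_hom_id_assoc, e1, Category.comp_id,
    reassoc_of% hB.β_inv_hom, reassoc_of% e2, Iso.hom_inv_id_assoc] at h
  exact h.symm

theorem map₂_betaWhisker (h : a ⟶ b) (k : b ⟶ c) :
    R.map₂ (A.betaWhisker h k) ≫ R.pullPi (h ≫ k) ≫ (R.mapComp h k).hom ▷ B.pi (R.obj c) =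
      (R.mapComp (h ≫ A.pi b) k).hom ≫ R.pullPi h ▷ R.map k ≫
        B.betaWhisker (R.map h) (R.map k) := by
  unfold betaWhisker
  rw [R.map₂_comp, R.map₂_comp, Category.assoc, Category.assoc, R.pullPi_comp,
    reassoc_of% map₂_whiskerLeft_mapComp R.toPseudofunctor,
    ← Bicategory.whiskerLeft_comp_assoc, hR.map₂_β_inv hA hB]
  simp only [PiFunctorData.pullPi, Bicategory.whiskerLeft_comp, comp_whiskerRight, Category.assoc]
  rw [reassoc_of% map₂_associator_mapComp R.toPseudofunctor]
  simp

end

theorem map₂_sub {f g : a ⟶ b} (x y : f ⟶ g) : R.map₂ (x - y) = R.map₂ x - R.map₂ y := by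
  rw [sub_eq_add_neg, hR.map₂_add, ← neg_one_smul k y, hR.map₂_smul, neg_one_smul, sub_eq_add_neg]

theorem map₂_zero (f g : a ⟶ b) : R.map₂ (0 : f ⟶ g) = 0 := by
  rw [← zero_smul k (0 : f ⟶ g), hR.map₂_smul, zero_smul]

theorem hatMap₂_comp {f g h : a ⟶ b} (x : A.HatHom f g) (y : A.HatHom g h) :
    R.hatMap₂ (hatComp x y) = hatComp (R.hatMap₂ x) (R.hatMap₂ y) := by
  ext
  · simp only [PiFunctorData.hatMap₂, hatComp, hR.map₂_sub, R.map₂_comp, hR.map₂_xiWhisker,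
      comp_whiskerRight, Category.assoc, reassoc_of% R.pullPi_naturality]
  · simp only [PiFunctorData.hatMap₂, hatComp, hR.map₂_add, R.map₂_comp,
      Preadditive.add_comp, Category.assoc, R.pullPi_naturality]

theorem hatMap₂_even {f g : a ⟶ b} (x : f ⟶ g) :
    R.hatMap₂ (hatEven x) = hatEven (R.map₂ x) := by
  ext <;> simp [PiFunctorData.hatMap₂, hatEven, hR.map₂_zero]

theorem hatMap₂_whiskerRight (hA : IsPiTwoCat A) (hB : IsPiTwoCat B) {f f' : a ⟶ b}
    (x : A.HatHom f f') (g : b ⟶ c) :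
    hatComp (hatWhiskerRight (R.hatMap₂ x) (R.map g)) (hatEven (R.mapComp f' g).inv) =
      hatComp (hatEven (R.mapComp f g).inv) (R.hatMap₂ (hatWhiskerRight x g)) := by
  rw [hatComp_even, even_hatComp]
  ext
  · simp [PiFunctorData.hatMap₂, hatWhiskerRight]
  · have h := congrArg (· ≫ (R.mapComp f' g).inv ▷ B.pi _) (hR.map₂_betaWhisker hA hB f' g)
    simp only [Category.assoc, ← comp_whiskerRight, Iso.hom_inv_id, id_whiskerRight,
      Category.comp_id] at h
    simp [PiFunctorData.hatMap₂, hatWhiskerRight, h]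

theorem hatMap₂_hcomp (hA : IsPiTwoCat A) (hB : IsPiTwoCat B) {f f' : a ⟶ b} {g g' : b ⟶ c}
    (x : A.HatHom f f') (y : A.HatHom g g') :
    hatComp (hatHcomp (R.hatMap₂ x) (R.hatMap₂ y)) (hatEven (R.mapComp f' g').inv) =
      hatComp (hatEven (R.mapComp f g).inv) (R.hatMap₂ (hatHcomp x y)) := by
  rw [hA.hatHcomp_eq, hB.hatHcomp_eq, hB.hatComp_assoc, R.hatMap₂_whiskerLeft,
    ← hB.hatComp_assoc, hR.hatMap₂_whiskerRight hA hB, hB.hatComp_assoc, hR.hatMap₂_comp]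

theorem isTwoSuperfunctor_hatMap (hA : IsPiTwoCat A) (hB : IsPiTwoCat B) :
    IsTwoSuperfunctor (hatMap R) where
  map₂_id f := (hR.hatMap₂_even (𝟙 f)).trans (congrArg hatEven (R.map₂_id f))
  map₂_comp x y := hR.hatMap₂_comp x y
  map₂_add {a b f g} x y := by
    obtain ⟨x₀, x₁⟩ := x
    obtain ⟨y₀, y₁⟩ := y
    show R.hatMap₂ ((x₀, x₁) + (y₀, y₁) : A.HatHom f g) =
      R.hatMap₂ ((x₀, x₁) : A.HatHom f g) + R.hatMap₂ ((y₀, y₁) : A.HatHom f g)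
    ext <;> simp [PiFunctorData.hatMap₂, hR.map₂_add]
  map₂_smul {a b f g} r x := by
    obtain ⟨x₀, x₁⟩ := x
    show R.hatMap₂ (r • (x₀, x₁) : A.HatHom f g) = r • R.hatMap₂ ((x₀, x₁) : A.HatHom f g)
    ext <;> simp [PiFunctorData.hatMap₂, hR.map₂_smul]
  map₂_mem {a b f g p x} hx := by
    fin_cases p
    · refine mem_hatDeg_zero.2 ?_
      show R.map₂ (Prod.snd x) ≫ _ = 0
      rw [mem_hatDeg_zero.1 hx, hR.map₂_zero, Limits.zero_comp]
    · refine mem_hatDeg_one.2 ?_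
      show R.map₂ (Prod.fst x) = 0
      rw [mem_hatDeg_one.1 hx, hR.map₂_zero]
  c_inverse f g := hatIso_isInverse (R.mapComp f g).symm
  c_mem f g := hatEven_mem (R.mapComp f g).inv
  c_naturality x y := hR.hatMap₂_hcomp hA hB x y
  i_inverse a := hatIso_isInverse (R.mapId a).symm
  i_mem a := hatEven_mem (R.mapId a).inv
  map₂_assoc f g h := by
    show hatComp (hatHcomp (hatEven (R.mapComp f g).inv) (hatEven (𝟙 (R.map h))))
        (hatComp (hatEven (R.mapComp (f ≫ g) h).inv) (R.hatMap₂ (hatEven (α_ f g h).hom))) =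
      hatComp (hatEven (α_ (R.map f) (R.map g) (R.map h)).hom)
        (hatComp (hatHcomp (hatEven (𝟙 (R.map f))) (hatEven (R.mapComp g h).inv))
          (hatEven (R.mapComp f (g ≫ h)).inv))
    simp only [hR.hatMap₂_even, hatHcomp_even, hatComp_even_even]
    congr 1
    simp
  map₂_lunit {a b} f := by
    show hatComp (hatHcomp (hatEven (R.mapId a).inv) (hatEven (𝟙 (R.map f))))
        (hatComp (hatEven (R.mapComp (𝟙 a) f).inv) (R.hatMap₂ (hatEven (λ_ f).hom))) =
      hatEven (λ_ (R.map f)).hom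
    simp only [hR.hatMap₂_even, hatHcomp_even, hatComp_even_even]
    congr 1
    simp
  map₂_runit {a b} f := by
    show hatComp (hatHcomp (hatEven (𝟙 (R.map f))) (hatEven (R.mapId b).inv))
        (hatComp (hatEven (R.mapComp f (𝟙 b)).inv) (R.hatMap₂ (hatEven (ρ_ f).hom))) =
      hatEven (ρ_ (R.map f)).hom
    simp only [hR.hatMap₂_even, hatHcomp_even, hatComp_even_even]
    congr 1
    simp

end IsPiFunctor

section Nat

/-- Compatibility with composition, rewritten from the coherence maps `mapComp` of a pseudofunctor
to their inverses, which are the maps `c` of a 2-superfunctor. -/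
theorem oplax_naturality_comp_symm {B : Type u} [Bicategory.{w, v} B] {a b c a' b' c' : B}
    {X : a ⟶ a'} {Y : b ⟶ b'} {Z : c ⟶ c'} {f : a ⟶ b} {g : b ⟶ c} {e : a ⟶ c} {f' : a' ⟶ b'}
    {g' : b' ⟶ c'} {e' : a' ⟶ c'} {x : f ≫ Y ⟶ X ≫ f'} {y : g ≫ Z ⟶ Y ≫ g'}
    {z : e ≫ Z ⟶ X ≫ e'} (m : e ≅ f ≫ g) (m' : e' ≅ f' ≫ g')
    (h : z ≫ X ◁ m'.hom = m.hom ▷ Z ≫ (α_ _ _ _).hom ≫ f ◁ y ≫ (α_ _ _ _).inv ≫ x ▷ g' ≫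
      (α_ _ _ _).hom) :
    m.inv ▷ Z ≫ z = (α_ _ _ _).hom ≫ f ◁ y ≫ (α_ _ _ _).inv ≫ x ▷ g' ≫
      (α_ _ _ _).hom ≫ X ◁ m'.inv := by
  have := congrArg (fun t => m.inv ▷ Z ≫ t ≫ X ◁ m'.inv) h
  simpa using this

/-- Compatibility with units, rewritten from `mapId` to its inverse. -/
theorem oplax_naturality_id_symm {B : Type u} [Bicategory.{w, v} B] {a b : B} {X : a ⟶ b}
    {r : a ⟶ a} {s : b ⟶ b} {x : r ≫ X ⟶ X ≫ s} (i : r ≅ 𝟙 a) (j : s ≅ 𝟙 b)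
    (h : x ≫ X ◁ j.hom = i.hom ▷ X ≫ (λ_ X).hom ≫ (ρ_ X).inv) :
    (ρ_ X).hom ≫ (λ_ X).inv ≫ i.inv ▷ X ≫ x = X ◁ j.inv := by
  have := congrArg (fun t => (ρ_ X).hom ≫ (λ_ X).inv ≫ i.inv ▷ X ≫ t ≫ X ◁ j.inv) h
  simpa using this

open PiTwoCatData

variable {B : PiTwoCatData.{w, v, u} k}

theorem hat_naturality₂ {p q p' q' : B.Obj} {X : p ⟶ p'} {Y : q ⟶ q'} {r₀ r₁ : p ⟶ q}
    {s₀ s₁ : p' ⟶ q'} {x₀ : r₀ ≫ Y ⟶ X ≫ s₀} {x₁ : r₁ ≫ Y ⟶ X ≫ s₁} {y : B.HatHom r₀ r₁}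
    {z : B.HatHom s₀ s₁} (h₀ : y.1 ▷ Y ≫ x₁ = x₀ ≫ X ◁ z.1)
    (h₁ : y.2 ▷ Y ≫ B.betaWhisker r₁ Y ≫ x₁ ▷ B.pi q' =
      x₀ ≫ X ◁ z.2 ≫ (α_ X s₁ (B.pi q')).inv) :
    hatComp (hatHcomp y (hatEven (𝟙 Y))) (hatEven x₁) =
      hatComp (hatEven x₀) (hatHcomp (hatEven (𝟙 X)) z) := by
  rw [hatHcomp_id_left, hatHcomp_id_right, hatComp_even, even_hatComp]
  ext
  · exact h₀
  · simpa [hatWhiskerRight, hatWhiskerLeft] using h₁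

theorem hat_naturality_comp {a b c a' b' c' : B.Obj}
    {X : a ⟶ a'} {Y : b ⟶ b'} {Z : c ⟶ c'} {f : a ⟶ b} {g : b ⟶ c} {e : a ⟶ c} {f' : a' ⟶ b'}
    {g' : b' ⟶ c'} {e' : a' ⟶ c'} {x : f ≫ Y ⟶ X ≫ f'} {y : g ≫ Z ⟶ Y ≫ g'}
    {z : e ≫ Z ⟶ X ≫ e'} {m : f ≫ g ⟶ e} {m' : f' ≫ g' ⟶ e'}
    (h : m ▷ Z ≫ z = (α_ _ _ _).hom ≫ f ◁ y ≫ (α_ _ _ _).inv ≫ x ▷ g' ≫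
      (α_ _ _ _).hom ≫ X ◁ m') :
    hatComp (hatHcomp (hatEven m) (hatEven (𝟙 Z))) (hatEven z) =
      hatComp (hatEven (α_ f g Z).hom)
        (hatComp (hatHcomp (hatEven (𝟙 f)) (hatEven y))
          (hatComp (hatEven (α_ f Y g').inv)
            (hatComp (hatHcomp (hatEven x) (hatEven (𝟙 g')))
              (hatComp (hatEven (α_ X f' g').hom)
                (hatHcomp (hatEven (𝟙 X)) (hatEven m')))))) := by
  simp only [hatHcomp_even, hatComp_even_even]
  congr 1
  simpa using h

theorem hat_naturality_id {a b : B.Obj} {X : a ⟶ b} {r : a ⟶ a} {s : b ⟶ b} {x : r ≫ X ⟶ X ≫ s}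
    {i : 𝟙 a ⟶ r} {j : 𝟙 b ⟶ s} (h : (ρ_ X).hom ≫ (λ_ X).inv ≫ i ▷ X ≫ x = X ◁ j) :
    hatComp (hatEven (ρ_ X).hom) (hatComp (hatEven (λ_ X).inv)
        (hatComp (hatHcomp (hatEven i) (hatEven (𝟙 X))) (hatEven x))) =
      hatHcomp (hatEven (𝟙 X)) (hatEven j) := by
  simp only [hatHcomp_even, hatComp_even_even]
  congr 1
  simpa using h

/-- Let `x`, `y`, `z` be components of a 2-natural transformation at `f`, at `π` and at their
composite `e`. If `y` satisfies the law of a Π-2-natural transformation, then replacing the images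
of `π` by `π` through `i` and `i'` replaces `y` by `β_Y⁻¹`. With `e = π_b f` this is what naturality
at odd 2-morphisms asks for. -/
theorem betaWhisker_naturality_of_pi (hB : IsPiTwoCat B) {a b a' b' : B.Obj} {X : a ⟶ a'}
    {Y : b ⟶ b'} {f e : a ⟶ b} {g : b ⟶ b} {f' e' : a' ⟶ b'} {g' : b' ⟶ b'}
    {x : f ≫ Y ⟶ X ≫ f'} {y : g ≫ Y ⟶ Y ≫ g'} {z : e ≫ Y ⟶ X ≫ e'} {m : e ⟶ f ≫ g}
    {m' : e' ⟶ f' ≫ g'} {i : InvPair (B.pi b) g} {i' : InvPair (B.pi b') g'}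
    (hi : i.IsInverse) (hi' : i'.IsInverse)
    (h : z ≫ X ◁ m' = m ▷ Y ≫ (α_ _ _ _).hom ≫ f ◁ y ≫ (α_ _ _ _).inv ≫ x ▷ g' ≫
      (α_ _ _ _).hom)
    (hy : (B.β Y).hom ≫ i.hom ▷ Y ≫ y = Y ◁ i'.hom) :
    (m ≫ f ◁ i.inv) ▷ Y ≫ B.betaWhisker f Y ≫ x ▷ B.pi b' =
      z ≫ X ◁ (m' ≫ f' ◁ i'.inv) ≫ (α_ X f' (B.pi b')).inv := by
  have hy' : y ≫ Y ◁ i'.inv = i.inv ▷ Y ≫ (B.β Y).inv := by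
    have e := congrArg (fun t => i.inv ▷ Y ≫ (B.β Y).inv ≫ t ≫ Y ◁ i'.inv) hy
    have e1 : i.inv ▷ Y ≫ i.hom ▷ Y = 𝟙 _ := by
      rw [← comp_whiskerRight, hi.inv_hom, id_whiskerRight]
    have e2 : Y ◁ i'.hom ≫ Y ◁ i'.inv = 𝟙 _ := by
      rw [← Bicategory.whiskerLeft_comp, hi'.hom_inv, Bicategory.whiskerLeft_id]
    simpa only [Category.assoc, reassoc_of% hB.β_inv_hom, reassoc_of% e1, e2,
      Category.comp_id] using e
  have key := congrArg (fun t => m ▷ Y ≫ (α_ _ _ _).hom ≫ f ◁ t ≫ (α_ _ _ _).inv ≫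
    x ▷ B.pi b') hy'
  simp only [betaWhisker, Bicategory.whiskerLeft_comp, comp_whiskerRight, Category.assoc] at key ⊢
  rw [reassoc_of% h]
  have e : X ◁ f' ◁ i'.inv ≫ (α_ X f' (B.pi b')).inv =
      (α_ X f' g').inv ≫ (X ≫ f') ◁ i'.inv := by simp
  rw [e, Iso.hom_inv_id_assoc, ← whisker_exchange, associator_naturality_middle_assoc, ← key]
  simp

theorem whisker_naturality_trans {B : Type u} [Bicategory.{w, v} B] {a b a' b' : B} {X : a ⟶ a'}
    {Y : b ⟶ b'} {r₀ r₁ r₂ : a ⟶ b} {s₀ s₁ s₂ : a' ⟶ b'} {x₀ : r₀ ≫ Y ⟶ X ≫ s₀}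
    {x₁ : r₁ ≫ Y ⟶ X ≫ s₁} {y : r₀ ⟶ r₁} {t : r₁ ⟶ r₂} {y' : s₀ ⟶ s₁} {t' : s₁ ⟶ s₂}
    {d : a ⟶ b'} {z : r₂ ≫ Y ⟶ d} {l : X ≫ s₂ ⟶ d} (h : y ▷ Y ≫ x₁ = x₀ ≫ X ◁ y')
    (h' : t ▷ Y ≫ z = x₁ ≫ X ◁ t' ≫ l) :
    (y ≫ t) ▷ Y ≫ z = x₀ ≫ X ◁ (y' ≫ t') ≫ l := by
  rw [comp_whiskerRight, Category.assoc, h', reassoc_of% h, Bicategory.whiskerLeft_comp,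
    Category.assoc]

end Nat

namespace IsPiNat

open PiTwoCatData

variable {A B : PiTwoCatData.{w, v, u} k} {R S : PiFunctorData A B} {X : PiNatData R S}

theorem isTwoNat_hatNat (hX : IsPiNat X) (hR : IsPiFunctor R) (hS : IsPiFunctor S)
    (hB : IsPiTwoCat B) : IsTwoNat (hatNat X) where
  mem f := hatEven_mem (X.naturality f)
  naturality₂ {a b f g} y := by
    refine hat_naturality₂ (B := B) (X.naturality_naturality (Prod.fst y)) ?_
    have h := X.naturality_naturality (Prod.snd y)
    have h' := betaWhisker_naturality_of_pi hB (hR.j_inverse b) (hS.j_inverse b)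
      (X.naturality_comp g (A.pi b)) (hX b)
    exact whisker_naturality_trans h h'
  naturality_comp f g := hat_naturality_comp (B := B)
    (oplax_naturality_comp_symm (R.mapComp f g) (S.mapComp f g) (X.naturality_comp f g))
  naturality_id a := hat_naturality_id (B := B)
    (oplax_naturality_id_symm (R.mapId a) (S.mapId a) (X.naturality_id a))

end IsPiNat
end Hat

/-! ### Strictness of `𝔼₂` and `𝔻₂` -/

section Strict

variable {k : Type t} [CommRing k]

theorem associatedWellDefined : AssociatedWellDefined.{w, v, u} k where
  obj A := A.isPiTwoCat.isPiTwoSupercat_hatData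
  map {A B} R := R.isPiFunctor.isTwoSuperfunctor_hatMap A.isPiTwoCat B.isPiTwoCat
  nat {A B R S} X := X.isPiNat.isTwoNat_hatNat R.isPiFunctor S.isPiFunctor B.isPiTwoCat

theorem TwoNat.heq_of_eq {A B : TwoSupercatData.{w, v, u} k} {R R' S S' : TwoSuperfunctorData A B}
    (hR : R = R') (hS : S = S') {X : TwoNat R S} {X' : TwoNat R' S'}
    (happ : ∀ a, HEq (X.app a) (X'.app a))
    (hnat : ∀ {a b : A.Obj} (f : a ⟶ b), HEq (X.naturality f) (X'.naturality f)) : HEq X X' := by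
  subst hR hS
  obtain ⟨⟨app, nat⟩, h⟩ := X
  obtain ⟨⟨app', nat'⟩, h'⟩ := X'
  obtain rfl : app = app' := funext fun a => eq_of_heq (happ a)
  obtain rfl : @nat = @nat' := by funext a b f; exact eq_of_heq (hnat f)
  rfl

theorem PiNat.heq_of_eq {A B : PiTwoCatData.{w, v, u} k} {R R' S S' : PiFunctorData A B}
    (hR : R = R') (hS : S = S') {X : PiNat R S} {X' : PiNat R' S'}
    (happ : ∀ a, HEq (X.toNat.app a) (X'.toNat.app a))
    (hnat : ∀ {a b : A.Obj} (f : a ⟶ b), HEq (X.toNat.naturality f) (X'.toNat.naturality f)) :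
    HEq X X' := by
  subst hR hS
  obtain ⟨⟨app, nat, _, _, _⟩, h⟩ := X
  obtain ⟨⟨app', nat', _, _, _⟩, h'⟩ := X'
  obtain rfl : app = app' := funext fun a => eq_of_heq (happ a)
  obtain rfl : @nat = @nat' := by funext a b f; exact eq_of_heq (hnat f)
  rfl

theorem TwoSuperfunctor.ext_map₂ {A B : TwoSupercatData.{w, v, u} k} {obj : A.Obj → B.Obj}
    {map : ∀ {a b : A.Obj}, (a ⟶ b) → (obj a ⟶ obj b)}
    {map₂ map₂' : ∀ {a b : A.Obj} {f g : a ⟶ b}, (f ⟶ g) → (map f ⟶ map g)}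
    {c c' : ∀ {a b c : A.Obj} (f : a ⟶ b) (g : b ⟶ c), InvPair (map f ≫ map g) (map (f ≫ g))}
    {i i' : ∀ a : A.Obj, InvPair (𝟙 (obj a)) (map (𝟙 a))}
    {h : IsTwoSuperfunctor ⟨obj, map, map₂, c, i⟩}
    {h' : IsTwoSuperfunctor ⟨obj, map, map₂', c', i'⟩}
    (hmap₂ : ∀ {a b : A.Obj} {f g : a ⟶ b} (x : f ⟶ g), map₂ x = map₂' x)
    (hc : ∀ {a b d : A.Obj} (f : a ⟶ b) (g : b ⟶ d), c f g = c' f g) (hi : ∀ a, i a = i' a) :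
    (⟨⟨obj, map, map₂, c, i⟩, h⟩ : TwoSuperfunctor A B) = ⟨⟨obj, map, map₂', c', i'⟩, h'⟩ := by
  obtain rfl : @map₂ = @map₂' := by funext a b f g x; exact hmap₂ x
  exact TwoSuperfunctor.ext' hc hi

namespace PiTwoSupercat

attribute [local instance] homCategory homPreadditive

theorem jHom_id (A : PiTwoSupercat.{w, v, u} k) (a : A.Obj) :
    (jHom (𝟙 A) a).1 = 𝟙 (A.pi a) := by
  show (A.zeta a).hom ≫ 𝟙 (𝟙 a) ≫ (A.zeta a).inv = 𝟙 (A.pi a)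
  exact (congrArg _ (Category.id_comp _)).trans (A.zeta_hom_inv a)

theorem jInv_id (A : PiTwoSupercat.{w, v, u} k) (a : A.Obj) :
    (jInv (𝟙 A) a).1 = 𝟙 (A.pi a) := by
  show (A.zeta a).hom ≫ 𝟙 (𝟙 a) ≫ (A.zeta a).inv = 𝟙 (A.pi a)
  exact (congrArg _ (Category.id_comp _)).trans (A.zeta_hom_inv a)

variable {A B C : PiTwoSupercat.{w, v, u} k}

theorem jHom_comp (R : A ⟶ B) (S : B ⟶ C) (a : A.Obj) :
    (jHom (R ≫ S) a).1 = (jHom S (R.obj a)).1 ≫ S.map₂ (jHom R a).1 := by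
  show (C.zeta (S.obj (R.obj a))).hom ≫ ((S.i (R.obj a)).hom ≫ S.map₂ (R.i a).hom) ≫
    S.map₂ (R.map₂ (A.zeta a).inv) = _
  rw [show (jHom R a).1 = (B.zeta (R.obj a)).hom ≫ (R.i a).hom ≫ R.map₂ (A.zeta a).inv from rfl,
    S.isTwoSuperfunctor.map₂_comp, S.isTwoSuperfunctor.map₂_comp, ← Category.assoc (jHom S _).1,
    jHom_map_zeta]
  simp only [Category.assoc]

theorem jInv_comp (R : A ⟶ B) (S : B ⟶ C) (a : A.Obj) :
    (jInv (R ≫ S) a).1 = S.map₂ (jInv R a).1 ≫ (jInv S (R.obj a)).1 := by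
  show S.map₂ (R.map₂ (A.zeta a).hom) ≫ (S.map₂ (R.i a).inv ≫ (S.i (R.obj a)).inv) ≫
    (C.zeta (S.obj (R.obj a))).inv = _
  have h : S.map₂ (B.zeta (R.obj a)).inv ≫ (jInv S (R.obj a)).1 =
      (S.i (R.obj a)).inv ≫ (C.zeta (S.obj (R.obj a))).inv := by
    dsimp only [jInv]
    rw [← Category.assoc, ← S.isTwoSuperfunctor.map₂_comp, B.zeta_inv_hom,
      S.isTwoSuperfunctor.map₂_id, Category.id_comp]
  rw [show (jInv R a).1 = R.map₂ (A.zeta a).hom ≫ (R.i a).inv ≫ (B.zeta (R.obj a)).inv from rfl,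
    S.isTwoSuperfunctor.map₂_comp, S.isTwoSuperfunctor.map₂_comp, Category.assoc, Category.assoc,
    Category.assoc, h]

end PiTwoSupercat

theorem E₂_map_id (h : UnderlyingWellDefined.{w, v, u} k) (A : PiTwoSupercat.{w, v, u} k) :
    (E₂ h).map (𝟙 A) = 𝟙 ((E₂ h).obj A) := by
  refine PiFunctor.ext' ?_ ?_ ?_ ?_ ?_
  · rfl
  · intro a; exact HEq.rfl
  · intro a b c f g; exact HEq.rfl
  · exact fun a => heq_of_eq (TwoSupercat.EvenHom.ext (PiTwoSupercat.jHom_id A a))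
  · exact fun a => heq_of_eq (TwoSupercat.EvenHom.ext (PiTwoSupercat.jInv_id A a))

theorem E₂_map_comp (h : UnderlyingWellDefined.{w, v, u} k) {A B C : PiTwoSupercat.{w, v, u} k}
    (R : A ⟶ B) (S : B ⟶ C) : (E₂ h).map (R ≫ S) = (E₂ h).map R ≫ (E₂ h).map S := by
  refine PiFunctor.ext' ?_ ?_ ?_ ?_ ?_
  · rfl
  · intro a; exact HEq.rfl
  · intro a b c f g; exact HEq.rfl
  · exact fun a => heq_of_eq (TwoSupercat.EvenHom.ext (PiTwoSupercat.jHom_comp R S a))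
  · exact fun a => heq_of_eq (TwoSupercat.EvenHom.ext (PiTwoSupercat.jInv_comp R S a))

theorem E₂_isStrict (h : UnderlyingWellDefined.{w, v, u} k) : (E₂ h).IsStrict where
  map_id := E₂_map_id h
  map_comp := E₂_map_comp h
  map₂_id {A B} R := PiNat.ext rfl
  map₂_vcomp {A B R S T} X Y := PiNat.ext rfl
  map₂_whiskerLeft {A B C} R S T X := by
    refine PiNat.heq_of_eq ?_ ?_ ?_ ?_
    · exact congrArg PiFunctor.toPiFunctorData (E₂_map_comp h R S)
    · exact congrArg PiFunctor.toPiFunctorData (E₂_map_comp h R T)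
    · intro a; exact HEq.rfl
    · intro a b f; exact HEq.rfl
  map₂_whiskerRight {A B C R S} X T := by
    refine PiNat.heq_of_eq ?_ ?_ ?_ ?_
    · exact congrArg PiFunctor.toPiFunctorData (E₂_map_comp h R T)
    · exact congrArg PiFunctor.toPiFunctorData (E₂_map_comp h S T)
    · intro a; exact HEq.rfl
    · intro a b f; exact HEq.rfl

namespace PiFunctorData

open PiTwoCatData

theorem hatMap₂_id {A : PiTwoCatData.{w, v, u} k} {a b : A.Obj} {f g : a ⟶ b} (x : A.HatHom f g) :
    (PiFunctorData.id A).hatMap₂ x = x := by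
  refine Prod.ext rfl ?_
  show x.2 ≫ 𝟙 (g ≫ A.pi b) ≫ g ◁ 𝟙 (A.pi b) = x.2
  simp

theorem hatMap₂_hatMap₂ {A B C : PiTwoCatData.{w, v, u} k} (R : PiFunctorData A B)
    (S : PiFunctorData B C) {a b : A.Obj} {f g : a ⟶ b} (x : A.HatHom f g) :
    (R.comp S).hatMap₂ x = S.hatMap₂ (R.hatMap₂ x) := by
  refine Prod.ext rfl ?_
  show S.map₂ (R.map₂ x.2) ≫ (S.map₂ (R.mapComp g (A.pi b)).hom ≫
      (S.mapComp (R.map g) (R.map (A.pi b))).hom) ≫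
        S.map (R.map g) ◁ (S.map₂ (R.j b).inv ≫ (S.j (R.obj b)).inv) =
    S.map₂ (R.map₂ x.2 ≫ (R.mapComp g (A.pi b)).hom ≫ R.map g ◁ (R.j b).inv) ≫
      (S.mapComp (R.map g) (B.pi (R.obj b))).hom ≫ S.map (R.map g) ◁ (S.j (R.obj b)).inv
  simp

end PiFunctorData

/-- The component of a vertical composite of 2-natural transformations, computed in `A` and in the
associated 2-supercategory. -/
theorem PiTwoCatData.hatEven_vcomp {A : PiTwoCatData.{w, v, u} k} {a b a' b' a'' b'' : A.Obj}
    {X : a ⟶ a'} {X' : a' ⟶ a''} {Y : b ⟶ b'} {Y' : b' ⟶ b''} {f : a ⟶ b} {f' : a' ⟶ b'}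
    {f'' : a'' ⟶ b''} (x : f ≫ Y ⟶ X ≫ f') (x' : f' ≫ Y' ⟶ X' ≫ f'') :
    A.hatEven ((α_ f Y Y').inv ≫ x ▷ Y' ≫ (α_ X f' Y').hom ≫ X ◁ x' ≫ (α_ X X' f'').inv) =
      hatComp (hatEven (α_ f Y Y').inv) (hatComp (hatHcomp (hatEven x) (hatEven (𝟙 Y')))
        (hatComp (hatEven (α_ X f' Y').hom) (hatComp (hatHcomp (hatEven (𝟙 X)) (hatEven x'))
          (hatEven (α_ X X' f'').inv)))) := by
  simp only [hatHcomp_even, hatComp_even_even]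
  congr 1
  simp

/-- The component of a 2-natural transformation whiskered with a Π-2-functor, computed in `B` and in
the associated 2-supercategory. -/
theorem IsPiFunctor.hatEven_conj {A B : PiTwoCatData.{w, v, u} k} {R : PiFunctorData A B}
    (hR : IsPiFunctor R) {a b : A.Obj} {f g : a ⟶ b} {p q : R.obj a ⟶ R.obj b} (y : p ⟶ R.map f)
    (x : f ⟶ g) (z : R.map g ⟶ q) :
    B.hatEven (y ≫ R.map₂ x ≫ z) = PiTwoCatData.hatComp (PiTwoCatData.hatEven y)
      (PiTwoCatData.hatComp (R.hatMap₂ (PiTwoCatData.hatEven x)) (PiTwoCatData.hatEven z)) := by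
  rw [hR.hatMap₂_even, PiTwoCatData.hatComp_even_even, PiTwoCatData.hatComp_even_even]

theorem D₂_map_id (h : AssociatedWellDefined.{w, v, u} k) (A : PiTwoCat.{w, v, u} k) :
    (D₂ h).map (𝟙 A) = 𝟙 ((D₂ h).obj A) := by
  refine TwoSuperfunctor.ext_map₂ ?_ ?_ ?_
  · intro a b f g x
    exact PiFunctorData.hatMap₂_id (A := A.toPiTwoCatData) x
  · intro a b c f g
    rfl
  · intro a
    rfl

theorem D₂_map_comp (h : AssociatedWellDefined.{w, v, u} k) {A B C : PiTwoCat.{w, v, u} k}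
    (R : A ⟶ B) (S : B ⟶ C) : (D₂ h).map (R ≫ S) = (D₂ h).map R ≫ (D₂ h).map S := by
  have hS := S.isPiFunctor
  refine TwoSuperfunctor.ext_map₂ ?_ ?_ ?_
  · intro a b f g x
    exact PiFunctorData.hatMap₂_hatMap₂ R.toPiFunctorData S.toPiFunctorData x
  · intro a b c f g
    refine InvPair.ext ?_ ?_
    · exact ((congrArg _ (hS.hatMap₂_even _)).trans (PiTwoCatData.hatComp_even_even _ _)).symm
    · exact ((congrArg (PiTwoCatData.hatComp · _) (hS.hatMap₂_even _)).trans
        (PiTwoCatData.hatComp_even_even _ _)).symm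
  · intro a
    refine InvPair.ext ?_ ?_
    · exact ((congrArg _ (hS.hatMap₂_even _)).trans (PiTwoCatData.hatComp_even_even _ _)).symm
    · exact ((congrArg (PiTwoCatData.hatComp · _) (hS.hatMap₂_even _)).trans
        (PiTwoCatData.hatComp_even_even _ _)).symm

theorem D₂_isStrict (h : AssociatedWellDefined.{w, v, u} k) : (D₂ h).IsStrict where
  map_id := D₂_map_id h
  map_comp := D₂_map_comp h
  map₂_id {A B} R := by
    refine eq_of_heq (TwoNat.heq_of_eq rfl rfl ?_ ?_)
    · intro a; exact HEq.rfl
    · intro a b f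
      exact heq_of_eq (PiTwoCatData.hatComp_even_even _ _).symm
  map₂_vcomp {A B R S T} X Y := by
    refine eq_of_heq (TwoNat.heq_of_eq rfl rfl ?_ ?_)
    · intro a; exact HEq.rfl
    · intro a b f
      exact heq_of_eq (PiTwoCatData.hatEven_vcomp _ _)
  map₂_whiskerLeft {A B C} R S T X := by
    refine TwoNat.heq_of_eq ?_ ?_ ?_ ?_
    · exact congrArg TwoSuperfunctor.toTwoSuperfunctorData (D₂_map_comp h R S)
    · exact congrArg TwoSuperfunctor.toTwoSuperfunctorData (D₂_map_comp h R T)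
    · intro a; exact HEq.rfl
    · intro a b f; exact HEq.rfl
  map₂_whiskerRight {A B C R S} X T := by
    refine TwoNat.heq_of_eq ?_ ?_ ?_ ?_
    · exact congrArg TwoSuperfunctor.toTwoSuperfunctorData (D₂_map_comp h R T)
    · exact congrArg TwoSuperfunctor.toTwoSuperfunctorData (D₂_map_comp h S T)
    · intro a; exact HEq.rfl
    · intro a b f
      refine heq_of_eq ?_
      exact T.isPiFunctor.hatEven_conj _ _ _

end Strict

/-! ### The isomorphism from `𝔻₂ ∘ 𝔼₂` to the identity -/

section Evaluation

variable {k : Type t} [CommRing k]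

namespace PiTwoSupercat

attribute [local instance] homCategory homPreadditive

variable (A : PiTwoSupercat.{w, v, u} k) {a b c : A.Obj}

theorem evalHom_eq {f g : a ⟶ b} (x₀ : f ⟶ g) (x₁ : f ⟶ g ≫ A.pi b) :
    A.evalHom x₀ x₁ = x₀ + x₁ ≫ A.zr g := rfl

theorem evalHom_zero {f g : a ⟶ b} (x₀ : f ⟶ g) : A.evalHom x₀ 0 = x₀ := by
  rw [evalHom_eq, Limits.zero_comp, add_zero]

/-- The sign in the vertical composite of odd 2-morphisms is that of moving the odd `ζ_b h` past
itself. -/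
theorem evalHom_comp {f g h : a ⟶ b} (x₀ : f ⟶ g) (x₁ : f ⟶ g ≫ A.pi b) {y₀ : g ⟶ h}
    {y₁ : g ⟶ h ≫ A.pi b} (hy₀ : y₀ ∈ A.deg _ _ 0) (hy₁ : y₁ ∈ A.deg _ _ 0) :
    A.evalHom (x₀ ≫ y₀ - x₁ ≫ A.hcomp y₁ (𝟙 (A.pi b)) ≫
        (A.assoc h (A.pi b) (A.pi b)).hom ≫ A.hcomp (𝟙 h) (A.xiHom b).1 ≫ (A.runit h).hom)
      (x₀ ≫ y₁ + x₁ ≫ A.hcomp y₀ (𝟙 (A.pi b))) =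
    A.evalHom x₀ x₁ ≫ A.evalHom y₀ y₁ := by
  rw [A.zr_zr, A.zr_naturality_odd (A.zr_mem h), Preadditive.comp_neg,
    reassoc_of% (A.zr_naturality hy₁)]
  simp only [evalHom_eq, Preadditive.add_comp, Preadditive.comp_add, Preadditive.comp_neg,
    Category.assoc, A.zr_naturality hy₀]
  abel

theorem evalHom_whiskerRight {f f' : a ⟶ b} (x₀ : f ⟶ f') (x₁ : f ⟶ f' ≫ A.pi b) (g : b ⟶ c) :
    A.evalHom (A.hcomp x₀ (𝟙 g)) (A.hcomp x₁ (𝟙 g) ≫ (A.assoc f' (A.pi b) g).hom ≫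
      A.hcomp (𝟙 f') (A.betaInv g).1 ≫ (A.assoc f' g (A.pi c)).inv) =
    A.hcomp (A.evalHom x₀ x₁) (𝟙 g) := by
  simp only [evalHom_eq, A.isPiTwoSupercat.isTwoSupercat.add_hcomp, A.comp_whiskerRight,
    Category.assoc, A.zr_comp]
  rw [← Category.assoc (A.assoc f' g _).inv, A.assoc_inv_hom, Category.id_comp,
    ← A.whiskerLeft_comp, A.betaInv_zr, A.zl_whiskerLeft]

theorem evalHom_whiskerLeft (f : a ⟶ b) {g g' : b ⟶ c} (y₀ : g ⟶ g') (y₁ : g ⟶ g' ≫ A.pi c) :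
    A.evalHom (A.hcomp (𝟙 f) y₀) (A.hcomp (𝟙 f) y₁ ≫ (A.assoc f g' (A.pi c)).inv) =
    A.hcomp (𝟙 f) (A.evalHom y₀ y₁) := by
  simp only [evalHom_eq, A.isPiTwoSupercat.isTwoSupercat.hcomp_add, A.whiskerLeft_comp,
    Category.assoc, A.zr_comp]
  rw [← Category.assoc (A.assoc f g' _).inv, A.assoc_inv_hom, Category.id_comp]

/-- An odd 2-morphism `z` is `ζ_b g` composed with the even 2-morphism `(ζ_b g)⁻¹ ∘ z`. -/
theorem evalHom_surjective {f g : a ⟶ b} (x : f ⟶ g) :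
    ∃ (x₀ : A.toTwoSupercat.EvenHom f g) (x₁ : A.toTwoSupercat.EvenHom f (g ≫ A.pi b)),
      A.evalHom x₀.1 x₁.1 = x := by
  have hA := A.isPiTwoSupercat.isTwoSupercat.hom a b
  obtain ⟨y, hy, z, hz, rfl⟩ := Submodule.mem_sup.1
    ((hA.isCompl f g).sup_eq_top ▸ Submodule.mem_top : x ∈ A.deg f g 0 ⊔ A.deg f g 1)
  refine ⟨⟨y, hy⟩, ⟨z ≫ A.zrInv g, hA.comp_mem hz (A.zrInv_mem g)⟩, ?_⟩
  rw [evalHom_eq, Category.assoc, A.zrInv_zr, Category.comp_id]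

theorem evalHom_injective {f g : a ⟶ b} {x₀ y₀ : f ⟶ g} {x₁ y₁ : f ⟶ g ≫ A.pi b}
    (hx₀ : x₀ ∈ A.deg _ _ 0) (hx₁ : x₁ ∈ A.deg _ _ 0) (hy₀ : y₀ ∈ A.deg _ _ 0)
    (hy₁ : y₁ ∈ A.deg _ _ 0) (h : A.evalHom x₀ x₁ = A.evalHom y₀ y₁) : x₀ = y₀ ∧ x₁ = y₁ := by
  have hA := A.isPiTwoSupercat.isTwoSupercat.hom a b
  have e : x₀ - y₀ = (y₁ - x₁) ≫ A.zr g := by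
    rw [Preadditive.sub_comp, sub_eq_sub_iff_add_eq_add, add_comm (y₁ ≫ _)]
    exact h
  have m₀ : x₀ - y₀ ∈ A.deg f g 0 := Submodule.sub_mem _ hx₀ hy₀
  have m₁ : x₀ - y₀ ∈ A.deg f g 1 := by
    rw [e]
    exact hA.comp_mem (Submodule.sub_mem _ hy₁ hx₁) (A.zr_mem g)
  have z := Submodule.disjoint_def.1 (hA.isCompl f g).disjoint _ m₀ m₁
  refine ⟨sub_eq_zero.1 z, ?_⟩
  rw [z] at e
  have : (y₁ - x₁) = (0 : f ⟶ g ≫ A.pi b) := by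
    rw [← cancel_mono (A.zr g), ← e, Limits.zero_comp]
  exact (sub_eq_zero.1 this).symm

/-- The 2-morphisms of the Π-2-supercategory associated to the underlying Π-2-category of `A`. -/
abbrev PairHom (f g : a ⟶ b) := A.underData.HatHom f g

/-- The additive structure on 2-morphisms of the associated 2-supercategory. -/
@[reducible]
def pairAddCommGroup (f g : a ⟶ b) : AddCommGroup (A.PairHom f g) :=
  A.underData.hatData.homAdd f g

attribute [local instance] pairAddCommGroup

/-- The `k`-module structure on 2-morphisms of the associated 2-supercategory. -/
@[reducible]
def pairModule (f g : a ⟶ b) : Module k (A.PairHom f g) :=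
  A.underData.hatData.homMod f g

attribute [local instance] pairModule

/-- `(x₀, x₁) ↦ x₀ + ζ_b g ∘ x₁`. -/
def eval {f g : a ⟶ b} (x : A.PairHom f g) : f ⟶ g :=
  A.evalHom (Subtype.val (Prod.fst x)) (Subtype.val (Prod.snd x))

open PiTwoCatData

theorem eval_comp {f g h : a ⟶ b} (x : A.PairHom f g) (y : A.PairHom g h) :
    A.eval (hatComp x y) = A.eval x ≫ A.eval y :=
  A.evalHom_comp (Subtype.val (Prod.fst x)) (Subtype.val (Prod.snd x))
    (Subtype.property (Prod.fst y)) (Subtype.property (Prod.snd y))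

theorem eval_even {f g : a ⟶ b} (x : A.toTwoSupercat.EvenHom f g) :
    A.eval (hatEven (A := A.underData) x) = x.1 :=
  A.evalHom_zero x.1

theorem eval_whiskerRight {f f' : a ⟶ b} (x : A.PairHom f f') (g : b ⟶ c) :
    A.eval (hatWhiskerRight x g) = A.hcomp (A.eval x) (𝟙 g) :=
  A.evalHom_whiskerRight (Subtype.val (Prod.fst x)) (Subtype.val (Prod.snd x)) g

theorem eval_whiskerLeft (f : a ⟶ b) {g g' : b ⟶ c} (y : A.PairHom g g') :
    A.eval (hatWhiskerLeft f y) = A.hcomp (𝟙 f) (A.eval y) :=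
  A.evalHom_whiskerLeft f (Subtype.val (Prod.fst y)) (Subtype.val (Prod.snd y))

theorem eval_hcomp {f f' : a ⟶ b} {g g' : b ⟶ c} (x : A.PairHom f f') (y : A.PairHom g g') :
    A.eval (hatHcomp x y) = A.hcomp (A.eval x) (A.eval y) := by
  rw [A.isPiTwoCat_underData.hatHcomp_eq, A.eval_comp, A.eval_whiskerRight, A.eval_whiskerLeft,
    ← A.hcomp_eq]

theorem eval_bijective (f g : a ⟶ b) : Function.Bijective (A.eval (f := f) (g := g)) := by
  constructor
  · intro x y h
    obtain ⟨h₀, h₁⟩ := A.evalHom_injective (Subtype.property (Prod.fst x))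
      (Subtype.property (Prod.snd x)) (Subtype.property (Prod.fst y))
      (Subtype.property (Prod.snd y)) h
    exact Prod.ext (Subtype.ext h₀) (Subtype.ext h₁)
  · intro x
    obtain ⟨x₀, x₁, h⟩ := A.evalHom_surjective x
    exact ⟨(x₀, x₁), h⟩

theorem eval_mem {f g : a ⟶ b} {p : ZMod 2} {x : A.PairHom f g}
    (hx : x ∈ A.underData.hatData.deg f g p) : A.eval x ∈ A.deg f g p := by
  have hA := A.isPiTwoSupercat.isTwoSupercat.hom a b
  obtain ⟨x₀, x₁⟩ := x
  fin_cases p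
  · obtain rfl := mem_hatDeg_zero.1 hx
    show A.evalHom (Subtype.val x₀) 0 ∈ A.deg f g 0
    rw [A.evalHom_zero]
    exact Subtype.property x₀
  · obtain rfl := mem_hatDeg_one.1 hx
    show A.evalHom 0 (Subtype.val x₁) ∈ A.deg f g 1
    rw [A.evalHom_eq, zero_add]
    exact hA.comp_mem (Subtype.property x₁) (A.zr_mem g)

theorem eval_add {f g : a ⟶ b} (x y : A.PairHom f g) : A.eval (x + y) = A.eval x + A.eval y := by
  show (Subtype.val (Prod.fst x) + Subtype.val (Prod.fst y) : f ⟶ g) +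
      (Subtype.val (Prod.snd x) + Subtype.val (Prod.snd y) : f ⟶ g ≫ A.pi b) ≫ A.zr g =
    (Subtype.val (Prod.fst x) + Subtype.val (Prod.snd x) ≫ A.zr g) +
      (Subtype.val (Prod.fst y) + Subtype.val (Prod.snd y) ≫ A.zr g)
  rw [Preadditive.add_comp, add_add_add_comm]

theorem eval_smul {f g : a ⟶ b} (r : k) (x : A.PairHom f g) : A.eval (r • x) = r • A.eval x := by
  show (r • Subtype.val (Prod.fst x) : f ⟶ g) +
      (r • Subtype.val (Prod.snd x) : f ⟶ g ≫ A.pi b) ≫ A.zr g =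
    r • (Subtype.val (Prod.fst x) + Subtype.val (Prod.snd x) ≫ A.zr g)
  rw [smul_add]
  congr 1
  exact (A.isPiTwoSupercat.isTwoSupercat.hom a b).smul_comp r _ (A.zr g)

/-- The shape of the coherence axioms of a 2-superfunctor with identity coherence maps. -/
theorem hcomp_id_comp_id_comp (f : a ⟶ b) (g : b ⟶ c) {h : a ⟶ c} {x y : f ≫ g ⟶ h} (e : x = y) :
    A.hcomp (𝟙 f) (𝟙 g) ≫ 𝟙 (f ≫ g) ≫ x = y := by
  rw [A.hcomp_id, Category.id_comp, Category.id_comp, e]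

theorem comp_hcomp_id_comp_id (f : a ⟶ b) (g : b ⟶ c) {h : a ⟶ c} (x : h ⟶ f ≫ g) :
    x ≫ A.hcomp (𝟙 f) (𝟙 g) ≫ 𝟙 (f ≫ g) = x := by
  rw [A.hcomp_id, Category.comp_id, Category.comp_id]

theorem isTwoSuperfunctor_TData : IsTwoSuperfunctor (TData A) where
  map₂_id f := A.eval_even _
  map₂_comp x y := A.eval_comp x y
  map₂_add x y := A.eval_add x y
  map₂_smul r x := A.eval_smul r x
  map₂_mem hx := A.eval_mem hx
  c_inverse f g := ⟨Category.id_comp _, Category.id_comp _⟩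
  c_mem f g := (A.isPiTwoSupercat.isTwoSupercat.hom _ _).id_mem _
  c_naturality x y := (Category.comp_id _).trans
    ((A.eval_hcomp x y).symm.trans (Category.id_comp _).symm)
  i_inverse a := ⟨Category.id_comp _, Category.id_comp _⟩
  i_mem a := (A.isPiTwoSupercat.isTwoSupercat.hom _ _).id_mem _
  map₂_assoc f g h := A.hcomp_id_comp_id_comp (f ≫ g) h
    ((A.eval_even _).trans (A.comp_hcomp_id_comp_id f (g ≫ h) _).symm)
  map₂_lunit f := A.hcomp_id_comp_id_comp (𝟙 _) f (A.eval_even _)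
  map₂_runit f := A.hcomp_id_comp_id_comp f (𝟙 _) (A.eval_even _)

/-- The inverse of `eval`. -/
noncomputable def evalEquiv (f g : a ⟶ b) : A.PairHom f g ≃ (f ⟶ g) :=
  Equiv.ofBijective A.eval (A.eval_bijective f g)

/-- The decomposition of a 2-morphism `x` as `x₀ + ζ_b g ∘ x₁` with `x₀` and `x₁` even. -/
noncomputable def split {f g : a ⟶ b} (x : f ⟶ g) : A.PairHom f g := (A.evalEquiv f g).symm x

theorem eval_split {f g : a ⟶ b} (x : f ⟶ g) : A.eval (A.split x) = x :=
  (A.evalEquiv f g).apply_symm_apply x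

theorem split_eval {f g : a ⟶ b} (x : A.PairHom f g) : A.split (A.eval x) = x :=
  (A.evalEquiv f g).symm_apply_apply x

theorem split_even {f g : a ⟶ b} (x : A.toTwoSupercat.EvenHom f g) :
    A.split x.1 = hatEven (A := A.underData) x := by
  rw [← A.eval_even, A.split_eval]

theorem split_id (f : a ⟶ b) :
    A.split (𝟙 f) = hatEven (A := A.underData) (TwoSupercat.EvenHom.id f) :=
  A.split_even (TwoSupercat.EvenHom.id (A := A.toTwoSupercat) f)

theorem split_comp {f g h : a ⟶ b} (x : f ⟶ g) (y : g ⟶ h) :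
    A.split (x ≫ y) = hatComp (A.split x) (A.split y) :=
  (A.eval_bijective f h).1 (by rw [A.eval_comp, A.eval_split, A.eval_split, A.eval_split])

theorem split_hcomp {f f' : a ⟶ b} {g g' : b ⟶ c} (x : f ⟶ f') (y : g ⟶ g') :
    A.split (A.hcomp x y) = hatHcomp (A.split x) (A.split y) :=
  (A.eval_bijective (f ≫ g) (f' ≫ g')).1
    (by rw [A.eval_hcomp, A.eval_split, A.eval_split, A.eval_split])

theorem split_mem {f g : a ⟶ b} {p : ZMod 2} {x : f ⟶ g} (hx : x ∈ A.deg f g p) :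
    A.split x ∈ A.underData.hatData.deg f g p := by
  have hA := A.isPiTwoSupercat.isTwoSupercat.hom a b
  fin_cases p
  · rw [A.split_even ⟨x, hx⟩]
    exact hatEven_mem (A := A.underData) _
  · have h : A.split x = (((0 : A.toTwoSupercat.EvenHom f g),
        ⟨x ≫ A.zrInv g, hA.comp_mem hx (A.zrInv_mem g)⟩) : A.PairHom f g) := by
      refine (A.eval_bijective f g).1 ?_
      rw [A.eval_split]
      show x = 0 + (x ≫ A.zrInv g) ≫ A.zr g
      rw [Category.assoc, A.zrInv_zr, Category.comp_id, zero_add]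
    rw [h]
    exact mem_hatDeg_one.2 rfl

/-- The data of the inverse of the canonical 2-superfunctor. -/
noncomputable abbrev TInvData :
    TwoSuperfunctorData A.toTwoSupercatData A.underData.hatData.toTwoSupercatData where
  obj a := a
  map f := f
  map₂ x := A.split x
  c f g := A.underData.hatIso (@Iso.refl _ (A.toTwoSupercat.evenCategory _ _) (f ≫ g))
  i a := A.underData.hatIso (@Iso.refl _ (A.toTwoSupercat.evenCategory _ _) (𝟙 a))

theorem hatHcomp_id_comp_id_comp {B : PiTwoCatData.{w, v, u} k} {a b c : B.Obj} (f : a ⟶ b)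
    (g : b ⟶ c) {h : a ⟶ c} {x y : B.HatHom (f ≫ g) h} (e : x = y) :
    hatComp (hatHcomp (hatEven (𝟙 f)) (hatEven (𝟙 g))) (hatComp (hatEven (𝟙 (f ≫ g))) x) = y := by
  rw [hatHcomp_even, id_hatComp, id_whiskerRight, Bicategory.whiskerLeft_id, Category.id_comp,
    id_hatComp, e]

theorem hatComp_hcomp_id_comp_id {B : PiTwoCatData.{w, v, u} k} {a b c : B.Obj} (f : a ⟶ b)
    (g : b ⟶ c) {h : a ⟶ c} (x : B.HatHom h (f ≫ g)) :
    hatComp x (hatComp (hatHcomp (hatEven (𝟙 f)) (hatEven (𝟙 g))) (hatEven (𝟙 (f ≫ g)))) = x := by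
  rw [hatHcomp_even, hatComp_id, id_whiskerRight, Bicategory.whiskerLeft_id, Category.id_comp,
    hatComp_id]

theorem isTwoSuperfunctor_TInvData : IsTwoSuperfunctor A.TInvData where
  map₂_id f := A.split_id f
  map₂_comp x y := A.split_comp x y
  map₂_add {a b f g} x y := (A.eval_bijective f g).1 ((A.eval_split _).trans
    ((congrArg₂ (· + ·) (A.eval_split x) (A.eval_split y)).symm.trans (A.eval_add _ _).symm))
  map₂_smul {a b f g} r x := (A.eval_bijective f g).1 ((A.eval_split _).trans
    ((congrArg (r • ·) (A.eval_split x)).symm.trans (A.eval_smul r _).symm))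
  map₂_mem hx := A.split_mem hx
  c_inverse f g := hatIso_isInverse (A := A.underData) _
  c_mem f g := hatEven_mem (A := A.underData) _
  c_naturality x y := (hatComp_id (A := A.underData) _).trans
    ((A.split_hcomp x y).symm.trans (id_hatComp (A := A.underData) _).symm)
  i_inverse a := hatIso_isInverse (A := A.underData) _
  i_mem a := hatEven_mem (A := A.underData) _
  map₂_assoc f g h := hatHcomp_id_comp_id_comp (B := A.underData) (f ≫ g) h
    ((A.split_even ⟨(A.assoc f g h).hom, A.isPiTwoSupercat.isTwoSupercat.assoc_mem f g h⟩).trans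
      (hatComp_hcomp_id_comp_id (B := A.underData) f (g ≫ h) _).symm)
  map₂_lunit f := hatHcomp_id_comp_id_comp (B := A.underData) (𝟙 _) f
    (A.split_even ⟨(A.lunit f).hom, A.isPiTwoSupercat.isTwoSupercat.lunit_mem f⟩)
  map₂_runit f := hatHcomp_id_comp_id_comp (B := A.underData) f (𝟙 _)
    (A.split_even ⟨(A.runit f).hom, A.isPiTwoSupercat.isTwoSupercat.runit_mem f⟩)

end PiTwoSupercat

section

variable (hE : UnderlyingWellDefined.{w, v, u} k) (hD : AssociatedWellDefined.{w, v, u} k)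

/-- The canonical 2-superfunctor as an isomorphism of Π-2-supercategories. -/
noncomputable def TIso (A : PiTwoSupercat.{w, v, u} k) : ((E₂ hE).comp (D₂ hD)).obj A ≅ A where
  hom := ⟨TData A, A.isTwoSuperfunctor_TData⟩
  inv := ⟨A.TInvData, A.isTwoSuperfunctor_TInvData⟩
  hom_inv_id := by
    refine TwoSuperfunctor.ext_map₂ (fun x => A.split_eval x) (fun f g => InvPair.ext ?_ ?_)
      (fun a => InvPair.ext ?_ ?_)
    · exact (PiTwoCatData.id_hatComp (A := A.underData) _).trans (A.split_id (f ≫ g))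
    · exact (PiTwoCatData.hatComp_id (A := A.underData) _).trans (A.split_id (f ≫ g))
    · exact (PiTwoCatData.id_hatComp (A := A.underData) _).trans (A.split_id (𝟙 a))
    · exact (PiTwoCatData.hatComp_id (A := A.underData) _).trans (A.split_id (𝟙 a))
  inv_hom_id := by
    have hA := A.isPiTwoSupercat.isTwoSupercat
    refine TwoSuperfunctor.ext_map₂ (fun x => A.eval_split x) (fun f g => InvPair.ext ?_ ?_)
      (fun a => InvPair.ext ?_ ?_)
    · exact ((hA.hom _ _).id_comp _).trans (A.eval_even _)
    · exact ((hA.hom _ _).comp_id _).trans (A.eval_even _)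
    · exact ((hA.hom _ _).id_comp _).trans (A.eval_even _)
    · exact ((hA.hom _ _).comp_id _).trans (A.eval_even _)

namespace PiTwoSupercat

attribute [local instance] homCategory homPreadditive

/-- The canonical 2-superfunctors are natural on 2-morphisms: this is the defining property of
`j`. -/
theorem eval_hatMap₂ {A B : PiTwoSupercat.{w, v, u} k} (R : A ⟶ B) {a b : A.Obj} {f g : a ⟶ b}
    (x : A.PairHom f g) : B.eval ((underMap R).hatMap₂ x) = R.map₂ (A.eval x) := by
  have hR := R.isTwoSuperfunctor
  have h := map_zr R g
  show R.map₂ (Subtype.val (Prod.fst x)) + (R.map₂ (Subtype.val (Prod.snd x)) ≫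
      (R.c g (A.pi b)).inv ≫ B.hcomp (𝟙 (R.map g)) (jInv R b).1) ≫ B.zr (R.map g) =
    R.map₂ (Subtype.val (Prod.fst x) + Subtype.val (Prod.snd x) ≫ A.zr g)
  rw [hR.map₂_add, hR.map₂_comp, Category.assoc, Category.assoc, ← h,
    ← Category.assoc (B.hcomp _ _) (B.hcomp _ _), ← B.whiskerLeft_comp, jInv_jHom, B.hcomp_id,
    Category.id_comp, ← Category.assoc (R.c _ _).inv, (hR.c_inverse _ _).inv_hom, Category.id_comp]

end PiTwoSupercat

theorem TIso_naturality {A B : PiTwoSupercat.{w, v, u} k} (R : A ⟶ B) :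
    ((E₂ hE).comp (D₂ hD)).map R ≫ (TIso hE hD B).hom = (TIso hE hD A).hom ≫ R := by
  have hB := B.isPiTwoSupercat.isTwoSupercat
  have hR := R.isTwoSuperfunctor
  refine TwoSuperfunctor.ext_map₂ (fun x => PiTwoSupercat.eval_hatMap₂ R x)
    (fun f g => InvPair.ext ?_ ?_) (fun a => InvPair.ext ?_ ?_)
  · exact ((hB.hom _ _).id_comp _).trans ((B.eval_even _).trans
      (((congrArg _ (hR.map₂_id _)).trans ((hB.hom _ _).comp_id _)).symm))
  · exact ((hB.hom _ _).comp_id _).trans ((B.eval_even _).trans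
      (((congrArg (· ≫ _) (hR.map₂_id _)).trans ((hB.hom _ _).id_comp _)).symm))
  · exact ((hB.hom _ _).id_comp _).trans ((B.eval_even _).trans
      (((congrArg _ (hR.map₂_id _)).trans ((hB.hom _ _).comp_id _)).symm))
  · exact ((hB.hom _ _).comp_id _).trans ((B.eval_even _).trans
      (((congrArg (· ≫ _) (hR.map₂_id _)).trans ((hB.hom _ _).id_comp _)).symm))

/-- The canonical 2-superfunctors form a strict 2-natural isomorphism. -/
noncomputable def TNatIso : ((E₂ hE).comp (D₂ hD)).StrictNatIso
    (TwoPrefunctor.id (PiTwoSupercat.{w, v, u} k)) where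
  app A := TIso hE hD A
  naturality R := TIso_naturality hE hD R
  naturality₂ {A B R S} X := by
    have hB := B.isPiTwoSupercat.isTwoSupercat
    refine TwoNat.heq_of_eq ?_ ?_ ?_ ?_
    · exact congrArg TwoSuperfunctor.toTwoSuperfunctorData (TIso_naturality hE hD R)
    · exact congrArg TwoSuperfunctor.toTwoSuperfunctorData (TIso_naturality hE hD S)
    · intro a; exact HEq.rfl
    · intro a b f
      exact heq_of_eq (((hB.hom _ _).id_comp _).trans (((hB.hom _ _).comp_id _).trans
        (B.eval_even _)))

end
end Evaluation

/-! ### The isomorphism from `𝔼₂ ∘ 𝔻₂` to the identity -/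

section Identity

theorem PrelaxFunctor.ext_map₂ {B C : Type u} [Bicategory.{w, v} B] [Bicategory.{w, v} C]
    {P : B ⥤q C} {map₂ map₂' : ∀ {a b : B} {f g : a ⟶ b}, (f ⟶ g) → (P.map f ⟶ P.map g)}
    {hi hc hi' hc'} (h : ∀ {a b : B} {f g : a ⟶ b} (x : f ⟶ g), map₂ x = map₂' x) :
    (⟨⟨P, map₂⟩, hi, hc⟩ : PrelaxFunctor B C) = ⟨⟨P, map₂'⟩, hi', hc'⟩ := by
  obtain rfl : @map₂ = @map₂' := by funext a b f g x; exact h x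
  rfl

variable {k : Type t} [CommRing k]

namespace PiTwoSupercat

attribute [local instance] homCategory homPreadditive

/-- `β_f` is determined by what it does to `f ζ_a`. -/
theorem betaHom_eq_of_comp_zl {A : PiTwoSupercat.{w, v, u} k} {a b : A.Obj} {f : a ⟶ b}
    {y : f ≫ A.pi b ⟶ A.pi a ≫ f} (h : y ≫ A.zl f = A.zr f) : (A.betaHom f).1 = y := by
  rw [A.betaHom_eq, ← h, Category.assoc, A.zl_zlInv, Category.comp_id]

/-- `j_a` is determined by `R ζ_a ∘ j_a = i ∘ ζ_{R a}`. -/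
theorem jHom_eq_of_comp_map {A B : PiTwoSupercat.{w, v, u} k} {R : A ⟶ B} {a : A.Obj}
    {y : B.pi (R.obj a) ⟶ R.map (A.pi a)}
    (h : y ≫ R.map₂ (A.zeta a).hom = (B.zeta (R.obj a)).hom ≫ (R.i a).hom) :
    (jHom R a).1 = y := by
  have hR := R.isTwoSuperfunctor
  dsimp only [jHom]
  rw [← Category.assoc, ← h, Category.assoc, ← hR.map₂_comp, A.zeta_hom_inv, hR.map₂_id,
    Category.comp_id]

end PiTwoSupercat

namespace PiTwoCatData

section

variable {A : PiTwoCatData.{w, v, u} k} (h : IsPiTwoSupercat A.hatData) {a b c : A.Obj}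

theorem hat_zr (f : a ⟶ b) :
    (⟨A.hatData, h⟩ : PiTwoSupercat k).zr f = ((0, 𝟙 (f ≫ A.pi b)) : A.HatHom (f ≫ A.pi b) f) := by
  show hatComp (hatHcomp (hatEven (𝟙 f)) ((0, (λ_ (A.pi b)).inv) : A.HatHom (A.pi b) (𝟙 b)))
    (hatEven (ρ_ f).hom) = _
  rw [hatHcomp_id_left, hatComp_even]
  ext <;> simp [hatWhiskerLeft, whiskerLeft_zero]

theorem hat_zl (f : a ⟶ b) :
    (⟨A.hatData, h⟩ : PiTwoSupercat k).zl f = ((0, (A.β f).inv) : A.HatHom (A.pi a ≫ f) f) := by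
  show hatComp (hatHcomp ((0, (λ_ (A.pi a)).inv) : A.HatHom (A.pi a) (𝟙 a)) (hatEven (𝟙 f)))
    (hatEven (λ_ f).hom) = _
  rw [hatHcomp_id_right, hatComp_even]
  ext
  · simp [hatWhiskerRight, zero_whiskerRight]
  · simp [hatWhiskerRight, betaWhisker]

/-- In the associated Π-2-supercategory, `-ζ_b f ζ_a⁻¹` is the even 2-morphism `β_f`. -/
theorem betaHom_hat (hA : IsPiTwoCat A) (f : a ⟶ b) :
    ((⟨A.hatData, h⟩ : PiTwoSupercat k).betaHom f).1 = hatEven (A.β f).hom := by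
  refine PiTwoSupercat.betaHom_eq_of_comp_zl ?_
  rw [hat_zr, hat_zl]
  refine (even_hatComp _ _).trans ?_
  ext
  · simp
  · simp [hA.β_hom_inv]

/-- In the associated Π-2-supercategory, `ζ_a ζ_a` is the even 2-morphism `ξ_a`. -/
theorem xiHom_hat (hA : IsPiTwoCat A) (a : A.Obj) :
    ((⟨A.hatData, h⟩ : PiTwoSupercat k).xiHom a).1 = hatEven (A.ξ a).hom := by
  refine ((⟨A.hatData, h⟩ : PiTwoSupercat k).xiHom_eq a).trans ?_
  rw [hat_zl]
  show hatComp ((0, (A.β (A.pi a)).inv) : A.HatHom (A.pi a ≫ A.pi a) (A.pi a))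
    ((0, (λ_ (A.pi a)).inv) : A.HatHom (A.pi a) (𝟙 a)) = _
  ext
  · simp [-leftUnitor_inv_whiskerRight, hatComp, hatEven, hA.β_inv_pi, xiWhisker_id]
  · simp [hatComp, hatEven, zero_whiskerRight]

/-- The Π-2-category underlying the associated Π-2-supercategory. -/
abbrev underHat : PiTwoCatData.{w, v, u} k :=
  PiTwoSupercat.underData ⟨A.hatData, h⟩

theorem fst_hatComp {f g h : a ⟶ b} {x : A.HatHom f g} (hx : x ∈ A.hatData.deg f g 0)
    (y : A.HatHom g h) : (hatComp x y).1 = x.1 ≫ y.1 := by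
  show x.1 ≫ y.1 - x.2 ≫ _ = _
  rw [mem_hatDeg_zero.1 hx, Limits.zero_comp, sub_zero]

theorem whiskerLeft_id_comp_id_comp_eq {B : Type u} [Bicategory.{w, v} B] {a b : B} {f : a ⟶ b}
    {p : b ⟶ b} {q : a ⟶ a} {x y : f ≫ p ⟶ q ≫ f} (e : x = y) :
    f ◁ 𝟙 p ≫ 𝟙 (f ≫ p) ≫ x = y ≫ 𝟙 q ▷ f ≫ 𝟙 (q ≫ f) := by
  simp [e]

theorem id_hcomp_id_comp_id_comp_eq {B : Type u} [Bicategory.{w, v} B] {a : B} {p : a ⟶ a}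
    {x y : p ≫ p ⟶ 𝟙 a} (e : x = y) :
    (𝟙 p ▷ p ≫ p ◁ 𝟙 p) ≫ 𝟙 (p ≫ p) ≫ x = y ≫ 𝟙 (𝟙 a) := by
  simp [e]

/-- The even 2-morphisms of the associated 2-supercategory. -/
abbrev HatEvenHom (f g : a ⟶ b) : Type w :=
  (⟨A.hatData, h⟩ : PiTwoSupercat k).toTwoSupercat.EvenHom f g

variable {h} in
/-- The 2-morphism that an even 2-morphism of the associated 2-supercategory consists of. -/
def HatEvenHom.fst {f g : a ⟶ b} (x : HatEvenHom h f g) : f ⟶ g :=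
  Prod.fst (Subtype.val x)

/-- A 2-morphism as an even 2-morphism of the associated 2-supercategory. -/
def toHatEven {f g : a ⟶ b} (x : f ⟶ g) : HatEvenHom h f g :=
  ⟨hatEven x, hatEven_mem x⟩

theorem HatEvenHom.ext_fst {f g : a ⟶ b} {x y : HatEvenHom h f g} (e : x.fst = y.fst) : x = y :=
  Subtype.ext (Prod.ext e ((mem_hatDeg_zero.1 x.2).trans (mem_hatDeg_zero.1 y.2).symm))

theorem HatEvenHom.hcomp_id_fst {f g : a ⟶ b} (x : HatEvenHom h f g) (l : b ⟶ c) :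
    HatEvenHom.fst (x.hcomp (TwoSupercat.EvenHom.id l)) = x.fst ▷ l :=
  congrArg Prod.fst (hatHcomp_id_right (Subtype.val x) l)

theorem HatEvenHom.id_hcomp_fst {f g : b ⟶ c} (l : a ⟶ b) (x : HatEvenHom h f g) :
    HatEvenHom.fst ((TwoSupercat.EvenHom.id l).hcomp x) = l ◁ x.fst :=
  congrArg Prod.fst (hatHcomp_id_left l (Subtype.val x))

theorem HatEvenHom.comp_fst {f g l : a ⟶ b} (x : HatEvenHom h f g) (y : HatEvenHom h g l) :
    HatEvenHom.fst (x.comp y) = x.fst ≫ y.fst :=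
  fst_hatComp (Subtype.property x) (Subtype.val y)

/-- The identification of the 2-category underlying the associated 2-supercategory with the
original 2-category. -/
def fromUnderHat : PiFunctorData (underHat h) A where
  obj a := a
  map f := f
  map₂ x := HatEvenHom.fst x
  map₂_id f := rfl
  map₂_comp x y := HatEvenHom.comp_fst h x y
  mapId a := @Iso.refl _ (A.bicat.homCategory a a) (𝟙 a)
  mapComp {a b c} f g := @Iso.refl _ (A.bicat.homCategory a c) (f ≫ g)
  map₂_whisker_left f _ _ y := (HatEvenHom.id_hcomp_fst h f y).trans
    ((Pseudofunctor.id A.Obj).map₂_whisker_left f (HatEvenHom.fst y))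
  map₂_whisker_right x g := (HatEvenHom.hcomp_id_fst h x g).trans
    ((Pseudofunctor.id A.Obj).map₂_whisker_right (HatEvenHom.fst x) g)
  map₂_associator f g h := (Pseudofunctor.id A.Obj).map₂_associator f g h
  map₂_left_unitor f := (Pseudofunctor.id A.Obj).map₂_left_unitor f
  map₂_right_unitor f := (Pseudofunctor.id A.Obj).map₂_right_unitor f
  j a := ⟨𝟙 (A.pi a), 𝟙 (A.pi a)⟩

theorem toHatEven_comp {f g l : a ⟶ b} (x : f ⟶ g) (y : g ⟶ l) :
    toHatEven h (x ≫ y) = (toHatEven h x).comp (toHatEven h y) :=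
  Subtype.ext (hatComp_even_even x y).symm

theorem toHatEven_whiskerLeft {f g : b ⟶ c} (l : a ⟶ b) (x : f ⟶ g) :
    toHatEven h (l ◁ x) = (TwoSupercat.EvenHom.id l).hcomp (toHatEven h x) :=
  Subtype.ext ((hatHcomp_id_left l (hatEven x)).trans (hatWhiskerLeft_even l x)).symm

theorem toHatEven_whiskerRight {f g : a ⟶ b} (x : f ⟶ g) (l : b ⟶ c) :
    toHatEven h (x ▷ l) = (toHatEven h x).hcomp (TwoSupercat.EvenHom.id l) :=
  Subtype.ext ((hatHcomp_id_right (hatEven x) l).trans (hatWhiskerRight_even x l)).symm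

/-- The inverse of `fromUnderHat`. -/
def toUnderHat : PiFunctorData A (underHat h) where
  obj a := a
  map f := f
  map₂ x := toHatEven h x
  map₂_id f := rfl
  map₂_comp x y := toHatEven_comp h x y
  mapId a := @Iso.refl _ ((underHat h).bicat.homCategory a a) (𝟙 a)
  mapComp {a b c} f g := @Iso.refl _ ((underHat h).bicat.homCategory a c) (f ≫ g)
  map₂_whisker_left f _ _ y := (toHatEven_whiskerLeft h f y).trans
    ((Pseudofunctor.id (underHat h).Obj).map₂_whisker_left f (toHatEven h y))
  map₂_whisker_right x g := (toHatEven_whiskerRight h x g).trans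
    ((Pseudofunctor.id (underHat h).Obj).map₂_whisker_right (toHatEven h x) g)
  map₂_associator f g l := (Pseudofunctor.id (underHat h).Obj).map₂_associator f g l
  map₂_left_unitor f := (Pseudofunctor.id (underHat h).Obj).map₂_left_unitor f
  map₂_right_unitor f := (Pseudofunctor.id (underHat h).Obj).map₂_right_unitor f
  j a := (PiFunctorData.id (underHat h)).j a

theorem isPiFunctor_fromUnderHat (hA : IsPiTwoCat A) : IsPiFunctor (fromUnderHat h) where
  map₂_add x y := rfl
  map₂_smul r x := rfl
  j_inverse a := ⟨Category.id_comp (𝟙 (A.pi a)), Category.id_comp (𝟙 (A.pi a))⟩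
  j_β f := whiskerLeft_id_comp_id_comp_eq (congrArg Prod.fst (betaHom_hat h hA f))
  j_ξ a := id_hcomp_id_comp_id_comp_eq (congrArg Prod.fst (xiHom_hat h hA a))

theorem isPiFunctor_toUnderHat (hA : IsPiTwoCat A) : IsPiFunctor (toUnderHat h) where
  map₂_add x y := Subtype.ext (Prod.ext rfl (add_zero _).symm)
  map₂_smul r x := HatEvenHom.ext_fst h rfl
  j_inverse a := (@PiFunctor.id k _ (underHat h)).isPiFunctor.j_inverse a
  j_β f := whiskerLeft_id_comp_id_comp_eq (B := (underHat h).Obj)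
    (Subtype.ext (betaHom_hat h hA f).symm)
  j_ξ a := id_hcomp_id_comp_id_comp_eq (B := (underHat h).Obj)
    (Subtype.ext (xiHom_hat h hA a).symm)


theorem map₂_leftUnitor_inv_mapComp {B C : Type u} [Bicategory.{w, v} B] [Bicategory.{w, v} C]
    (R : Pseudofunctor B C) {a b : B} (f : a ⟶ b) :
    R.map₂ (λ_ f).inv ≫ (R.mapComp (𝟙 a) f).hom =
      (λ_ (R.map f)).inv ≫ (R.mapId a).inv ▷ R.map f := by
  have e : (R.mapComp (𝟙 a) f).symm ≪≫ R.map₂Iso (λ_ f) =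
      whiskerRightIso (R.mapId a) (R.map f) ≪≫ λ_ (R.map f) :=
    Iso.ext ((Iso.inv_comp_eq _).2 (R.map₂_left_unitor f))
  exact congrArg Iso.inv e

/-- `R ζ_a ∘ j_a = i ∘ ζ_{R a}` for the 2-superfunctor associated to `R`, on odd parts. -/
theorem j_comp_map₂_leftUnitor_inv {A B : PiTwoCatData.{w, v, u} k} {R : PiFunctorData A B}
    (hj : ∀ a, (R.j a).IsInverse) (a : A.Obj) :
    (R.j a).hom ≫ R.map₂ (λ_ (A.pi a)).inv ≫ (R.mapComp (𝟙 a) (A.pi a)).hom ≫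
      R.map (𝟙 a) ◁ (R.j a).inv = (λ_ (B.pi (R.obj a))).inv ≫ (R.mapId a).inv ▷ B.pi _ := by
  have e := map₂_leftUnitor_inv_mapComp R.toPseudofunctor (A.pi a)
  rw [reassoc_of% e, leftUnitor_inv_naturality_assoc, whisker_exchange_assoc,
    ← Bicategory.whiskerLeft_comp, (hj a).hom_inv, Bicategory.whiskerLeft_id, Category.comp_id]

/-- The 2-morphism `j` of the Π-2-functor underlying the associated 2-superfunctor of `R` is that
of `R`. -/
theorem jHom_hatMap {A B : PiTwoCat.{w, v, u} k} {hA : IsPiTwoSupercat A.hatData}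
    {hB : IsPiTwoSupercat B.hatData} (R : A ⟶ B)
    (hR : IsTwoSuperfunctor (hatMap (PiFunctor.toPiFunctorData R))) (a : A.Obj) :
    (PiTwoSupercat.jHom (A := ⟨A.hatData, hA⟩) (B := ⟨B.hatData, hB⟩)
      ⟨hatMap R.toPiFunctorData, hR⟩ a).1 = hatEven (R.j a).hom := by
  refine PiTwoSupercat.jHom_eq_of_comp_map ?_
  refine (even_hatComp _ _).trans (Eq.trans ?_ (hatComp_even _ _).symm)
  ext
  · exact (congrArg (_ ≫ ·) (R.isPiFunctor.map₂_zero _ _)).trans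
      (Limits.comp_zero.trans Limits.zero_comp.symm)
  · exact j_comp_map₂_leftUnitor_inv R.isPiFunctor.j_inverse a

theorem jInv_hatMap_fst {A B : PiTwoCat.{w, v, u} k} {hA : IsPiTwoSupercat A.hatData}
    {hB : IsPiTwoSupercat B.hatData} (R : A ⟶ B)
    (hR : IsTwoSuperfunctor (hatMap (PiFunctor.toPiFunctorData R))) (a : A.Obj) :
    Prod.fst (PiTwoSupercat.jInv (A := ⟨A.hatData, hA⟩) (B := ⟨B.hatData, hB⟩)
      ⟨hatMap R.toPiFunctorData, hR⟩ a).1 = (R.j a).inv := by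
  have e := congrArg Prod.fst (PiTwoSupercat.jHom_jInv (A := ⟨A.hatData, hA⟩)
    (B := ⟨B.hatData, hB⟩) ⟨hatMap R.toPiFunctorData, hR⟩ a)
  rw [jHom_hatMap] at e
  have e' := (congrArg Prod.fst (even_hatComp _ _)).symm.trans e
  have e'' := congrArg ((R.j a).inv ≫ ·) e'
  exact (Category.id_comp _).symm.trans
    ((congrArg (· ≫ _) (R.isPiFunctor.j_inverse a).inv_hom.symm).trans
      ((Category.assoc _ _ _).trans (e''.trans (Category.comp_id _))))

end
end PiTwoCatData

section

open PiTwoCatData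

variable (hE : UnderlyingWellDefined.{w, v, u} k) (hD : AssociatedWellDefined.{w, v, u} k)

/-- The Π-2-category underlying the associated Π-2-supercategory is isomorphic to the original
one. -/
def SIso (A : PiTwoCat.{w, v, u} k) : ((D₂ hD).comp (E₂ hE)).obj A ≅ A where
  hom := ⟨fromUnderHat (hD.obj A), isPiFunctor_fromUnderHat (hD.obj A) A.isPiTwoCat⟩
  inv := ⟨toUnderHat (hD.obj A), isPiFunctor_toUnderHat (hD.obj A) A.isPiTwoCat⟩
  hom_inv_id := by
    refine PiFunctor.ext' ?_ ?_ ?_ ?_ ?_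
    · exact PrelaxFunctor.ext_map₂ fun x => HatEvenHom.ext_fst (hD.obj A) rfl
    · intro a
      exact heq_of_eq (@Category.id_comp _ ((underHat (hD.obj A)).bicat.homCategory a a) _ _ _)
    · intro a b c f g
      exact heq_of_eq (@Category.id_comp _ ((underHat (hD.obj A)).bicat.homCategory a c) _ _ _)
    · intro a
      exact heq_of_eq (@Category.id_comp _ ((underHat (hD.obj A)).bicat.homCategory a a) _ _ _)
    · intro a
      exact heq_of_eq (@Category.id_comp _ ((underHat (hD.obj A)).bicat.homCategory a a) _ _ _)
  inv_hom_id := by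
    refine PiFunctor.ext' rfl ?_ ?_ ?_ ?_
    · intro a; exact heq_of_eq (Category.id_comp (𝟙 (𝟙 (a : A.Obj))))
    · intro a b c f g; exact heq_of_eq (Category.id_comp (𝟙 ((f ≫ g : (a : A.Obj) ⟶ c))))
    · intro a; exact heq_of_eq (Category.id_comp (𝟙 (A.pi a)))
    · intro a; exact heq_of_eq (Category.id_comp (𝟙 (A.pi a)))

theorem SIso_naturality {A B : PiTwoCat.{w, v, u} k} (R : A ⟶ B) :
    ((D₂ hD).comp (E₂ hE)).map R ≫ (SIso hE hD B).hom = (SIso hE hD A).hom ≫ R := by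
  refine PiFunctor.ext' rfl ?_ ?_ ?_ ?_
  · intro a
    exact heq_of_eq ((Category.comp_id (R.mapId a).hom).trans
      ((congrArg (· ≫ (R.mapId a).hom) (R.map₂_id _)).trans (Category.id_comp _)).symm)
  · intro a b c f g
    exact heq_of_eq ((Category.comp_id (R.mapComp f g).hom).trans
      ((congrArg (· ≫ (R.mapComp f g).hom) (R.map₂_id _)).trans (Category.id_comp _)).symm)
  · intro a
    exact heq_of_eq ((Category.id_comp _).trans
      ((congrArg Prod.fst (jHom_hatMap R (hD.map R) a)).trans
        ((congrArg ((R.j a).hom ≫ ·) (R.map₂_id _)).trans (Category.comp_id _)).symm))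
  · intro a
    exact heq_of_eq ((Category.comp_id _).trans ((jInv_hatMap_fst R (hD.map R) a).trans
      ((congrArg (· ≫ (R.j a).inv) (R.map₂_id _)).trans (Category.id_comp _)).symm))

/-- The identifications form a strict 2-natural isomorphism. -/
def SNatIso : ((D₂ hD).comp (E₂ hE)).StrictNatIso (TwoPrefunctor.id (PiTwoCat.{w, v, u} k)) where
  app A := SIso hE hD A
  naturality R := SIso_naturality hE hD R
  naturality₂ {A B R S} X := by
    refine PiNat.heq_of_eq ?_ ?_ ?_ ?_
    · exact congrArg PiFunctor.toPiFunctorData (SIso_naturality hE hD R)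
    · exact congrArg PiFunctor.toPiFunctorData (SIso_naturality hE hD S)
    · intro a; exact HEq.rfl
    · intro a b f
      exact heq_of_eq ((Category.id_comp _).trans (Category.comp_id _))

theorem isCanonicalIdentity_SIso (A : PiTwoCat.{w, v, u} k) :
    IsCanonicalIdentity (PiFunctor.toPiFunctorData (SIso hE hD A).hom) where
  obj a := rfl
  map f := HEq.rfl
  map₂ x := HEq.rfl
  mapComp f g := HEq.rfl
  mapId a := HEq.rfl
  j a := HEq.rfl

end
end Identity

end PiTwo

theorem mainTheorem8 (k : Type t) [CommRing k] :
    ∃ (hE : UnderlyingWellDefined.{w, v, u} k) (hD : AssociatedWellDefined.{w, v, u} k),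
      (E₂ hE).IsStrict ∧ (D₂ hD).IsStrict ∧
      (∃ S : ((D₂ hD).comp (E₂ hE)).StrictNatIso (TwoPrefunctor.id (PiTwoCat.{w, v, u} k)),
        ∀ A : PiTwoCat.{w, v, u} k,
          IsCanonicalIdentity (PiFunctor.toPiFunctorData (S.app A).hom)) ∧
      (∃ T : ((E₂ hE).comp (D₂ hD)).StrictNatIso (TwoPrefunctor.id (PiTwoSupercat.{w, v, u} k)),
        ∀ A : PiTwoSupercat.{w, v, u} k,
          TwoSuperfunctor.toTwoSuperfunctorData (T.app A).hom = TData A) := by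
  have hE : UnderlyingWellDefined.{w, v, u} k := underlyingWellDefined
  have hD : AssociatedWellDefined.{w, v, u} k := associatedWellDefined
  exact ⟨hE, hD, E₂_isStrict hE, D₂_isStrict hD, ⟨SNatIso hE hD, isCanonicalIdentity_SIso hE hD⟩,
    ⟨TNatIso hE hD, fun A => rfl⟩⟩
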